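/- Fix an integer $m\ge 1$ and let $\mathcal H=H^m([0,1])$ be the space of functions $f$ on $[0,1]$ such that $f,f',\dots,f^{(m-1)}$ are absolutely continuous and $f^{(m)}\in L_2([0,1])$; put $J(f,g)=\int_0^1 f^{(m)}g^{(m)}$. For subjects $i=1,2,\dots$ one observes $$Y_{ij}=X_i(T_{ij})+\varepsilon_{ij},\qquad j=1,\dots,N_i,$$ where $X_1,X_2,\dots$ are i.i.d. random functions on $[0,1]$ with $E\{X_i(t)^2\}<\infty$ and $E\{X_i(t)\}=\mu(t)$ for all $t\in[0,1]$; the $T_{ij}\in[0,1]$ are i.i.d. copies of $T$; the $\varepsilon_{ij}$ are i.i.d.; the $N_i$ are i.i.d. copies of $N$; and the four families $(X_i)$, $(T_{ij})$, $(\varepsilon_{ij})$, $(N_i)$ are mutually independent. Assume: 1. the pairs $(Y_{ij},T_{ij})$ have a common bounded joint density, and the density $\pi$ of $T$ on $[0,1]$ is bounded away from $0$ and $\infty$; 2. $E(\varepsilon_{ij})=0$ and $\mathrm{Var}(\varepsilon_{ij})=\sigma_\varepsilon^2<\infty$; 3. $N$ is a positive integer-valued random variable with $E(N)<\infty$, $\mathrm{Var}(N)<\infty$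 and $P(N>1)>0$; 4. almost surely $X_i\in\mathcal H$, and $E\int_0^1\{X_i^{(m)}(t)\}^2dt<\infty$; 5. with $V(f,g)=E\{f(T)g(T)\}$, there are functions $h_v\in\mathcal H$ ($v\ge 1$) with $\sup_v\sup_{t\in[0,1]}|h_v(t)|<\infty$ and a nondecreasing sequence $\gamma_v\asymp v^{2m}$ such that $V(h_u,h_v)=\delta_{uv}$ and $J(h_u,h_v)=\gamma_u\delta_{uv}$ for all $u,v$, and every $g\in\mathcal H$ satisfies $g=\sum_v V(g,h_v)h_v$, with convergence in the norm $\{V(f,f)+\lambda J(f,f)\}^{1/2}$ for every $\lambda>0$. Let $h=h_n>0$ be deterministic, $\lambda=\lambda_n=h^{2m}$, $M=\sum_{i=1}^n N_i$, let $\hat\mu_\lambda$ be a minimizer over $f\in\mathcal H$ of $$\frac1{2M}\sum_{i=1}^n\sum_{j=1}^{N_i}\{Y_{ij}-f(T_{ij})\}^2+\frac{\lambda}{2}J(f,f),$$ and let $\|f\|^2=V(f,f)+\lambda J(f,f)$. Suppose that, as $n\to\infty$, $$h=o(1)\quad\text{and}\quad\{nh^{3-1/(2m)}\}^{-1/2}(\log\log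 n)^{1/2}=o(1).$$ Then $\mu\in\mathcal H$ and $$\|\hat\mu_\lambda-\mu\|=O_p(d_n),\qquad d_n=h^m+(nh)^{-1/2}.$$ In particular, if $h\asymp n^{-1/(2m+1)}$, then $\|\hat\mu_\lambda-\mu\|=O_p(n^{-m/(2m+1)})$, and this is the optimal order of the rate $d_n$: $x^m+(nx)^{-1/2}\ge n^{-m/(2m+1)}$ for every $n\ge 1$ and every $x>0$. -/

import Mathlib

open MeasureTheory ProbabilityTheory Filter Topology Asymptotics

noncomputable section

/-- The Sobolev space `H^m([0,1])`: `f, f', …, f^(m-1)` exist and are absolutely continuous on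
`[0,1]`, and `f^(m)` (which then exists almost everywhere) is square integrable on `[0,1]`.
Functions are real functions on `ℝ` of which only the values on `[0,1]` are used; derivatives are
taken within `[0,1]` (one-sided at the end points). -/
def MemSobolev (m : ℕ) (f : ℝ → ℝ) : Prop :=
  (∀ k, k + 1 < m →
    DifferentiableOn ℝ (iteratedDerivWithin k f (Set.Icc 0 1)) (Set.Icc 0 1)) ∧
  (∀ k, k < m →
    AbsolutelyContinuousOnInterval (iteratedDerivWithin k f (Set.Icc 0 1)) 0 1) ∧
  MemLp (iteratedDerivWithin m f (Set.Icc 0 1)) 2 (volume.restrict (Set.Icc (0 : ℝ) 1))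

/-- The roughness form `J(f, g) = ∫₀¹ f^(m) g^(m)`. -/
def roughness (m : ℕ) (f g : ℝ → ℝ) : ℝ :=
  ∫ t in Set.Icc (0 : ℝ) 1,
    iteratedDerivWithin m f (Set.Icc 0 1) t * iteratedDerivWithin m g (Set.Icc 0 1) t

/-- The form `V(f, g) = E{f(T) g(T)}`, where `ν` is the law of `T`. -/
def designForm (ν : Measure ℝ) (f g : ℝ → ℝ) : ℝ := ∫ t, f t * g t ∂ν

/-- The inner product `⟨f, g⟩ = V(f, g) + lam J(f, g)` on `H^m([0,1])`. -/
def rkhsInner (m : ℕ) (ν : Measure ℝ) (lam : ℝ) (f g : ℝ → ℝ) : ℝ :=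
  designForm ν f g + lam * roughness m f g

/-- The norm induced by `rkhsInner`. -/
def rkhsNorm (m : ℕ) (ν : Measure ℝ) (lam : ℝ) (f : ℝ → ℝ) : ℝ :=
  Real.sqrt (rkhsInner m ν lam f f)

/-- The observations `Y i j = X i (T i j) + ε i j`. -/
def obsY {Ω : Type*} (X : ℕ → Ω → ℝ → ℝ) (T ε : ℕ → ℕ → Ω → ℝ) (i j : ℕ) (ω : Ω) : ℝ :=
  X i ω (T i j ω) + ε i j ω

/-- The total number `M` of observations of the first `n` subjects. -/
def totalObs {Ω : Type*} (N : ℕ → Ω → ℕ) (n : ℕ) (ω : Ω) : ℕ := ∑ i ∈ Finset.range n, N i ω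

/-- The penalized least squares criterion
`(2M)⁻¹ ∑_{i<n} ∑_{j<N i} (Y i j - f (T i j))² + (lam/2) J(f, f)`. -/
def penalizedLoss {Ω : Type*} (m : ℕ) (X : ℕ → Ω → ℝ → ℝ) (T ε : ℕ → ℕ → Ω → ℝ)
    (N : ℕ → Ω → ℕ) (lam : ℝ) (n : ℕ) (ω : Ω) (f : ℝ → ℝ) : ℝ :=
  1 / (2 * (totalObs N n ω : ℝ)) *
      ∑ i ∈ Finset.range n, ∑ j ∈ Finset.range (N i ω), (obsY X T ε i j ω - f (T i j ω)) ^ 2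
    + lam / 2 * roughness m f f

/-- `f` is a smoothing spline estimate: a minimizer of the penalized criterion over
`H^m([0,1])`. -/
def IsSmoothingSpline {Ω : Type*} (m : ℕ) (X : ℕ → Ω → ℝ → ℝ) (T ε : ℕ → ℕ → Ω → ℝ)
    (N : ℕ → Ω → ℕ) (lam : ℝ) (n : ℕ) (ω : Ω) (f : ℝ → ℝ) : Prop :=
  MemSobolev m f ∧
    ∀ g, MemSobolev m g →
      penalizedLoss m X T ε N lam n ω f ≤ penalizedLoss m X T ε N lam n ω g

/-- `Z_n = O_p(a_n)`. -/
def IsBigOInProb {Ω : Type*} [MeasurableSpace Ω] (P : Measure Ω) (Z : ℕ → Ω → ℝ)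
    (a : ℕ → ℝ) : Prop :=
  ∀ δ : ℝ, 0 < δ → ∃ C : ℝ, ∀ᶠ n in atTop, P {ω | C * a n < |Z n ω|} ≤ ENNReal.ofReal δ

/-- The sampling scheme of the functional data model: the random functions `X i` are i.i.d. second
order processes on `[0,1]` with mean function `μ`, each of the families `T i j`, `ε i j`, `N i` is
i.i.d., and the four families are independent of one another. -/
structure SamplingModel {Ω : Type*} [MeasurableSpace Ω] (P : Measure Ω) (X : ℕ → Ω → ℝ → ℝ)
    (T ε : ℕ → ℕ → Ω → ℝ) (N : ℕ → Ω → ℕ) (μ : ℝ → ℝ) : Prop where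
  measurable_X : ∀ i, ∀ t ∈ Set.Icc (0 : ℝ) 1, Measurable (fun ω => X i ω t)
  measurable_T : ∀ i j, Measurable (T i j)
  measurable_ε : ∀ i j, Measurable (ε i j)
  measurable_N : ∀ i, Measurable (N i)
  memLp_X : ∀ i, ∀ t ∈ Set.Icc (0 : ℝ) 1, MemLp (fun ω => X i ω t) 2 P
  mean_X : ∀ i, ∀ t ∈ Set.Icc (0 : ℝ) 1, ∫ ω, X i ω t ∂P = μ t
  ident_X : ∀ i, IdentDistrib (fun ω => (Set.Icc (0 : ℝ) 1).domRestrict (X i ω))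
    (fun ω => (Set.Icc (0 : ℝ) 1).domRestrict (X 0 ω)) P P
  ident_T : ∀ i j, IdentDistrib (T i j) (T 0 0) P P
  ident_ε : ∀ i j, IdentDistrib (ε i j) (ε 0 0) P P
  ident_N : ∀ i, IdentDistrib (N i) (N 0) P P
  iIndep_X : iIndepFun (fun i ω => (Set.Icc (0 : ℝ) 1).domRestrict (X i ω)) P
  iIndep_T : iIndepFun (fun p : ℕ × ℕ => T p.1 p.2) P
  iIndep_ε : iIndepFun (fun p : ℕ × ℕ => ε p.1 p.2) P
  iIndep_N : iIndepFun N P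
  indep_X_T : IndepFun (fun ω (i : ℕ) => (Set.Icc (0 : ℝ) 1).domRestrict (X i ω))
    (fun ω (p : ℕ × ℕ) => T p.1 p.2 ω) P
  indep_XT_ε : IndepFun
    (fun ω => ((fun i : ℕ => (Set.Icc (0 : ℝ) 1).domRestrict (X i ω)),
      (fun p : ℕ × ℕ => T p.1 p.2 ω)))
    (fun ω (p : ℕ × ℕ) => ε p.1 p.2 ω) P
  indep_XTε_N : IndepFun
    (fun ω => ((fun i : ℕ => (Set.Icc (0 : ℝ) 1).domRestrict (X i ω)),
      (fun p : ℕ × ℕ => T p.1 p.2 ω), (fun p : ℕ × ℕ => ε p.1 p.2 ω)))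
    (fun ω (i : ℕ) => N i ω) P

/-- The pairs `(Y, T)` have a common bounded joint density, and `T` is `[0,1]`-valued with a density
bounded away from zero and infinity on `[0,1]`. -/
structure DensityAssumption {Ω : Type*} [MeasurableSpace Ω] (P : Measure Ω) (X : ℕ → Ω → ℝ → ℝ)
    (T ε : ℕ → ℕ → Ω → ℝ) : Prop where
  joint : ∃ (p : ℝ × ℝ → ℝ) (B : ℝ), Measurable p ∧ (∀ z, 0 ≤ p z ∧ p z ≤ B) ∧
    ∀ i j, P.map (fun ω => (obsY X T ε i j ω, T i j ω)) =
      volume.withDensity (fun z => ENNReal.ofReal (p z))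
  marginal : ∃ (q : ℝ → ℝ) (b B : ℝ), Measurable q ∧ 0 < b ∧
    (∀ t ∈ Set.Icc (0 : ℝ) 1, b ≤ q t ∧ q t ≤ B) ∧
    ∀ i j, P.map (T i j) =
      (volume.restrict (Set.Icc (0 : ℝ) 1)).withDensity (fun t => ENNReal.ofReal (q t))

/-- The measurement errors are centred with finite variance. -/
def ErrorAssumption {Ω : Type*} [MeasurableSpace Ω] (P : Measure Ω)
    (ε : ℕ → ℕ → Ω → ℝ) : Prop :=
  ∀ i j, MemLp (ε i j) 2 P ∧ ∫ ω, ε i j ω ∂P = 0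

/-- The numbers of observations are positive, with finite variance and `P(N > 1) > 0`. -/
def CountAssumption {Ω : Type*} [MeasurableSpace Ω] (P : Measure Ω) (N : ℕ → Ω → ℕ) : Prop :=
  ∀ i, (∀ᵐ ω ∂P, 0 < N i ω) ∧ MemLp (fun ω => (N i ω : ℝ)) 2 P ∧ 0 < P {ω | 1 < N i ω}

/-- The sample paths lie almost surely in `H^m([0,1])`, and `E ∫₀¹ (X^(m))² < ∞`. -/
def PathAssumption {Ω : Type*} [MeasurableSpace Ω] (P : Measure Ω) (m : ℕ)
    (X : ℕ → Ω → ℝ → ℝ) : Prop :=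
  ∀ i, (∀ᵐ ω ∂P, MemSobolev m (X i ω)) ∧
    ∫⁻ ω, (∫⁻ t in Set.Icc (0 : ℝ) 1,
      ENNReal.ofReal ((iteratedDerivWithin m (X i ω) (Set.Icc 0 1) t) ^ 2)) ∂P < ⊤

/-- There are uniformly bounded `e_1, e_2, … ∈ H^m([0,1])` and nondecreasing `γ_v ≍ v^(2m)` with
`V(e_u, e_v) = δ_uv`, `J(e_u, e_v) = γ_u δ_uv`, such that every `g ∈ H^m([0,1])` is the sum of
`V(g, e_v) e_v` in the norm of `H^m([0,1])` (these norms are equivalent for all `lam > 0`).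
The index `v : ℕ` stands for the `(v+1)`-st member. -/
def EigenAssumption (m : ℕ) (ν : Measure ℝ) : Prop :=
  ∃ (e : ℕ → ℝ → ℝ) (γ : ℕ → ℝ),
    (∀ v, MemSobolev m (e v)) ∧
    (∃ B : ℝ, ∀ v, ∀ t ∈ Set.Icc (0 : ℝ) 1, |e v t| ≤ B) ∧
    Monotone γ ∧
    (γ =Θ[atTop] fun v : ℕ => ((v : ℝ) + 1) ^ (2 * m)) ∧
    (∀ u v, designForm ν (e u) (e v) = if u = v then 1 else 0) ∧
    (∀ u v, roughness m (e u) (e v) = if u = v then γ u else 0) ∧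
    ∀ g, MemSobolev m g → ∀ lam : ℝ, 0 < lam →
      Tendsto (fun k => rkhsNorm m ν lam
        (fun t => g t - ∑ v ∈ Finset.range k, designForm ν g (e v) * e v t)) atTop (𝓝 0)

end

/-! # Convergence rate of smoothing splines for the mean of functional data

Write `ν` for the law of the design points, `e_v` for the eigenfunctions and `w_v = 1 + λ γ_v`, so
that `‖f‖² = ∑ w_v V(f, e_v)²` for `f ∈ H^m` (`IsEigensystem.hasSum_rkhsInner`). Let
`δ = μ̂ - μ`. Testing the first order condition of the penalized criterion with `δ` itself gives

  `M⁻¹ ∑ δ(T_ij)² + λ J(δ, δ) = M⁻¹ ∑ {Y_ij - μ(T_ij)} δ(T_ij) - λ J(μ, δ)`.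

Expanding `δ` in the eigenfunctions, the Cauchy-Schwarz inequality bounds the first term on the
right by `‖δ‖` times the norm of the noise, `M⁻¹ (∑_v U_v² / w_v)^(1/2)` with
`U_v = ∑ {Y_ij - μ(T_ij)} e_v(T_ij)`, and the second one by `h^m J(μ, μ)^(1/2) ‖δ‖`. The left side is
at least `‖δ‖² / 2` as soon as the Gram matrix `M⁻¹ ∑ e_u(T_ij) e_v(T_ij)`, rescaled by
`(w_u w_v)^(-1/2)`, has Hilbert-Schmidt distance at most `1/2` to its expectation. This is the
deterministic bound `IsEigensystem.rkhsNorm_sub_le`.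

Both random quantities are sums of squares of centred sums over independent subjects. Their second
moments are at most a constant times `n` (`SamplingModel.lintegral_sq_sum_le`), where nothing beyond
`E N² < ∞` is needed about the dependence within a subject, and `M ≥ n`. Since
`∑ 1 / w_v = O(1/h)` (`IsEigensystem.exists_sum_inv_le`), Markov's inequality gives `O_p((nh)^(-1/2))`
for the noise and `O_p(1 / (n h²))` for the squared Hilbert-Schmidt distance
(`SamplingModel.exists_measure_lt_le`). The assumption on the bandwidth makes `n h² → ∞`, because
`3 - 1/(2m) ≥ 2`; no maximal inequality for empirical processes is needed.

That `μ ∈ H^m` (`IsEigensystem.memSobolev_mean`) is seen on the coefficients `x_v = V(X, e_v)`: the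
moment assumptions give `∑ (1 + γ_v) E x_v² < ∞`, hence `∑ (1 + γ_v) (E x_v)² < ∞`, and
`μ = ∑ E(x_v) e_v` pointwise, so `μ ∈ H^m` by the completeness of this space
(`memSobolev_of_tendsto`). Completeness rests on Taylor's formula: a member of `H^m` is a polynomial of
degree less than `m` plus an `m`-fold primitive of its `m`-th derivative.
-/

noncomputable section

/-! ### The Sobolev space `H^m([0,1])` is a complete vector space -/

lemma AbsolutelyContinuousOnInterval.congr_uIcc {f g : ℝ → ℝ} {a b : ℝ}
    (hf : AbsolutelyContinuousOnInterval f a b) (h : Set.EqOn g f (Set.uIcc a b)) :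
    AbsolutelyContinuousOnInterval g a b := by
  rw [absolutelyContinuousOnInterval_iff] at hf ⊢
  intro ε hε
  obtain ⟨δ, hδ, H⟩ := hf ε hε
  refine ⟨δ, hδ, fun E hE hlt => ?_⟩
  refine lt_of_eq_of_lt (Finset.sum_congr rfl fun i hi => ?_) (H E hE hlt)
  rw [h (hE.1 i hi).1, h (hE.1 i hi).2]

lemma AbsolutelyContinuousOnInterval.ae_differentiableWithinAt_unitInterval {f : ℝ → ℝ}
    (hf : AbsolutelyContinuousOnInterval f 0 1) :
    ∀ᵐ t ∂(volume.restrict (Set.Icc (0 : ℝ) 1)),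
      DifferentiableWithinAt ℝ f (Set.Icc 0 1) t := by
  have h := hf.ae_differentiableAt
  rw [Set.uIcc_of_le zero_le_one] at h
  filter_upwards [ae_restrict_of_ae h, ae_restrict_mem measurableSet_Icc] with t ht hmem
  exact (ht hmem).differentiableWithinAt

/-- The fundamental theorem of calculus on `[0,1]`, with the derivative taken within `[0,1]`. -/
lemma AbsolutelyContinuousOnInterval.integral_derivWithin {f : ℝ → ℝ}
    (hf : AbsolutelyContinuousOnInterval f 0 1) {t : ℝ} (ht : t ∈ Set.Icc (0 : ℝ) 1) :
    ∫ x in (0 : ℝ)..t, derivWithin f (Set.Icc 0 1) x = f t - f 0 := by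
  have hsub : Set.uIcc (0 : ℝ) t ⊆ Set.uIcc 0 1 := by
    rw [Set.uIcc_of_le zero_le_one, Set.uIcc_of_le ht.1]
    exact Set.Icc_subset_Icc_right ht.2
  rw [← (hf.mono hsub).integral_deriv_eq_sub]
  refine intervalIntegral.integral_congr_uIoo fun x hx => ?_
  rw [Set.uIoo_of_le ht.1] at hx
  exact derivWithin_of_mem_nhds (Icc_mem_nhds hx.1 (hx.2.trans_le ht.2))

namespace MemSobolev

variable {m : ℕ} {f g : ℝ → ℝ}

lemma continuousOn (hm : 1 ≤ m) (hf : MemSobolev m f) : ContinuousOn f (Set.Icc 0 1) := by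
  have h := (hf.2.1 0 hm).continuousOn
  rwa [iteratedDerivWithin_zero, Set.uIcc_of_le zero_le_one] at h

lemma iteratedDerivWithin_linComb_of_lt (hf : MemSobolev m f) (hg : MemSobolev m g) (a b : ℝ)
    {k : ℕ} (hk : k < m) :
    Set.EqOn (iteratedDerivWithin k (fun t => a * f t + b * g t) (Set.Icc 0 1))
      (fun t => a * iteratedDerivWithin k f (Set.Icc 0 1) t +
        b * iteratedDerivWithin k g (Set.Icc 0 1) t) (Set.Icc 0 1) := by
  induction k with
  | zero => intro t _; simp
  | succ k ih =>
    intro t ht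
    simp only [iteratedDerivWithin_succ]
    rw [derivWithin_congr (ih (by omega)) (ih (by omega) ht)]
    have h1 := (hf.1 k hk t ht).const_mul a
    have h2 := (hg.1 k hk t ht).const_mul b
    rw [derivWithin_fun_add h1 h2, derivWithin_const_mul_field, derivWithin_const_mul_field]

lemma iteratedDerivWithin_linComb_ae (hf : MemSobolev m f) (hg : MemSobolev m g) (a b : ℝ) :
    iteratedDerivWithin m (fun t => a * f t + b * g t) (Set.Icc 0 1)
      =ᵐ[volume.restrict (Set.Icc (0 : ℝ) 1)]
      fun t => a * iteratedDerivWithin m f (Set.Icc 0 1) t +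
        b * iteratedDerivWithin m g (Set.Icc 0 1) t := by
  cases m with
  | zero => exact ae_of_all _ fun t => by simp
  | succ k =>
    filter_upwards [(hf.2.1 k k.lt_succ_self).ae_differentiableWithinAt_unitInterval,
      (hg.2.1 k k.lt_succ_self).ae_differentiableWithinAt_unitInterval,
      ae_restrict_mem measurableSet_Icc] with t h1 h2 ht
    have ih := hf.iteratedDerivWithin_linComb_of_lt hg a b k.lt_succ_self
    simp only [iteratedDerivWithin_succ]
    rw [derivWithin_congr ih (ih ht), derivWithin_fun_add (h1.const_mul a) (h2.const_mul b),
      derivWithin_const_mul_field, derivWithin_const_mul_field]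

lemma linComb (hf : MemSobolev m f) (hg : MemSobolev m g) (a b : ℝ) :
    MemSobolev m (fun t => a * f t + b * g t) := by
  refine ⟨fun k hk => ?_, fun k hk => ?_, ?_⟩
  · refine DifferentiableOn.congr ?_
      (hf.iteratedDerivWithin_linComb_of_lt hg a b (k := k) (by omega))
    exact ((hf.1 k hk).const_mul a).add ((hg.1 k hk).const_mul b)
  · refine AbsolutelyContinuousOnInterval.congr_uIcc
      (((hf.2.1 k hk).const_mul a).fun_add ((hg.2.1 k hk).const_mul b)) ?_
    rw [Set.uIcc_of_le zero_le_one]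
    exact hf.iteratedDerivWithin_linComb_of_lt hg a b hk
  · exact (memLp_congr_ae (hf.iteratedDerivWithin_linComb_ae hg a b)).2
      ((hf.2.2.const_mul a).add (hg.2.2.const_mul b))

lemma sub (hf : MemSobolev m f) (hg : MemSobolev m g) : MemSobolev m (fun t => f t - g t) := by
  simpa [sub_eq_add_neg] using hf.linComb hg 1 (-1)

lemma zero : MemSobolev m (fun _ => (0 : ℝ)) := by
  have h : ∀ k, iteratedDerivWithin k (fun _ : ℝ => (0 : ℝ)) (Set.Icc 0 1) = fun _ => 0 := by
    intro k; funext t; simp [iteratedDerivWithin_fun_const_zero]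
  refine ⟨fun k _ => ?_, fun k _ => ?_, ?_⟩
  · rw [h]; exact differentiableOn_const 0
  · rw [h]; exact contDiffOn_const.absolutelyContinuousOnInterval
  · rw [h]; exact MemLp.zero

lemma sum {e : ℕ → ℝ → ℝ} (he : ∀ v, MemSobolev m (e v)) (c : ℕ → ℝ) (s : Finset ℕ) :
    MemSobolev m (fun t => ∑ v ∈ s, c v * e v t) := by
  classical
  induction s using Finset.induction_on with
  | empty => simpa using zero
  | insert a s ha ih =>
    simp only [Finset.sum_insert ha]
    simpa using (he a).linComb ih (c a) 1

lemma iteratedDerivWithin_sum_ae {e : ℕ → ℝ → ℝ} (he : ∀ v, MemSobolev m (e v)) (c : ℕ → ℝ)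
    (s : Finset ℕ) :
    iteratedDerivWithin m (fun t => ∑ v ∈ s, c v * e v t) (Set.Icc 0 1)
      =ᵐ[volume.restrict (Set.Icc (0 : ℝ) 1)]
      fun t => ∑ v ∈ s, c v * iteratedDerivWithin m (e v) (Set.Icc 0 1) t := by
  classical
  induction s using Finset.induction_on with
  | empty => exact ae_of_all _ fun t => by simp [iteratedDerivWithin_fun_const_zero]
  | insert a s ha ih =>
    simp only [Finset.sum_insert ha]
    have h := (he a).iteratedDerivWithin_linComb_ae (MemSobolev.sum he c s) (c a) 1
    simp only [one_mul] at h
    filter_upwards [h, ih] with t h1 h2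
    rw [h1, h2]

/-- One more derivative: `f ∈ H^{m+2}` as soon as `f` is differentiable with `f' ∈ H^{m+1}`. -/
lemma of_derivWithin (hd : DifferentiableOn ℝ f (Set.Icc 0 1))
    (h : MemSobolev (m + 1) (derivWithin f (Set.Icc 0 1))) : MemSobolev (m + 2) f := by
  refine ⟨fun k hk => ?_, fun k hk => ?_, ?_⟩
  · cases k with
    | zero => simpa using hd
    | succ k => rw [iteratedDerivWithin_succ']; exact h.1 k (by omega)
  · cases k with
    | zero =>
      rw [iteratedDerivWithin_zero]
      apply ContDiffOn.absolutelyContinuousOnInterval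
      rw [Set.uIcc_of_le zero_le_one]
      rw [contDiffOn_one_iff_derivWithin (uniqueDiffOn_Icc zero_lt_one)]
      exact ⟨hd, h.continuousOn (by omega)⟩
    | succ k => rw [iteratedDerivWithin_succ']; exact h.2.1 k (by omega)
  · rw [iteratedDerivWithin_succ']; exact h.2.2

lemma derivWithin (h : MemSobolev (m + 2) f) :
    MemSobolev (m + 1) (_root_.derivWithin f (Set.Icc 0 1)) := by
  refine ⟨fun k hk => ?_, fun k hk => ?_, ?_⟩
  · rw [← iteratedDerivWithin_succ']; exact h.1 _ (by omega)
  · rw [← iteratedDerivWithin_succ']; exact h.2.1 _ (by omega)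
  · rw [← iteratedDerivWithin_succ']; exact h.2.2

end MemSobolev

/-- The primitive `t ↦ ∫₀ᵗ g`. -/
def primitiveZero (g : ℝ → ℝ) (t : ℝ) : ℝ := ∫ x in (0 : ℝ)..t, g x

lemma IntegrableOn.intervalIntegrable_of_mem_Icc {g : ℝ → ℝ}
    (hg : IntegrableOn g (Set.Icc (0 : ℝ) 1)) {t : ℝ} (ht : t ∈ Set.Icc (0 : ℝ) 1) :
    IntervalIntegrable g volume 0 t := by
  rw [intervalIntegrable_iff_integrableOn_Icc_of_le ht.1]
  exact hg.mono_set (Set.Icc_subset_Icc_right ht.2)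

lemma primitiveZero_absolutelyContinuous {g : ℝ → ℝ} (hg : IntegrableOn g (Set.Icc (0 : ℝ) 1)) :
    AbsolutelyContinuousOnInterval (primitiveZero g) 0 1 :=
  IntervalIntegrable.absolutelyContinuousOnInterval_intervalIntegral
    (IntegrableOn.intervalIntegrable_of_mem_Icc hg (by simp)) (by simp)

lemma primitiveZero_continuousOn {g : ℝ → ℝ} (hg : IntegrableOn g (Set.Icc (0 : ℝ) 1)) :
    ContinuousOn (primitiveZero g) (Set.Icc 0 1) := by
  have := (primitiveZero_absolutelyContinuous hg).continuousOn
  rwa [Set.uIcc_of_le zero_le_one] at this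

lemma primitiveZero_integrableOn {g : ℝ → ℝ} (hg : IntegrableOn g (Set.Icc (0 : ℝ) 1)) :
    IntegrableOn (primitiveZero g) (Set.Icc (0 : ℝ) 1) :=
  (primitiveZero_continuousOn hg).integrableOn_Icc

lemma iterate_primitiveZero_integrableOn {g : ℝ → ℝ} (hg : IntegrableOn g (Set.Icc (0 : ℝ) 1))
    (k : ℕ) : IntegrableOn (primitiveZero^[k] g) (Set.Icc (0 : ℝ) 1) := by
  induction k with
  | zero => simpa using hg
  | succ k ih => rw [Function.iterate_succ_apply']; exact primitiveZero_integrableOn ih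

lemma abs_primitiveZero_sub_le {g g' : ℝ → ℝ} (hg : IntegrableOn g (Set.Icc (0 : ℝ) 1))
    (hg' : IntegrableOn g' (Set.Icc (0 : ℝ) 1)) {t : ℝ} (ht : t ∈ Set.Icc (0 : ℝ) 1) :
    |primitiveZero g t - primitiveZero g' t| ≤ ∫ x in Set.Icc (0 : ℝ) 1, |g x - g' x| := by
  unfold primitiveZero
  rw [← intervalIntegral.integral_sub (IntegrableOn.intervalIntegrable_of_mem_Icc hg ht)
    (IntegrableOn.intervalIntegrable_of_mem_Icc hg' ht)]
  refine (intervalIntegral.abs_integral_le_integral_abs ht.1).trans ?_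
  rw [intervalIntegral.integral_of_le ht.1]
  refine setIntegral_mono_set (hg.sub hg').abs (ae_of_all _ fun x => abs_nonneg _) ?_
  exact LE.le.eventuallyLE
    (Set.Ioc_subset_Icc_self.trans (Set.Icc_subset_Icc_right ht.2))

/-- Iterated primitives of an `L¹`-convergent sequence converge in `L¹`. -/
lemma tendsto_iterate_primitiveZero_L1 {G : ℕ → ℝ → ℝ} {g : ℝ → ℝ}
    (hG : ∀ k, IntegrableOn (G k) (Set.Icc (0 : ℝ) 1)) (hg : IntegrableOn g (Set.Icc (0 : ℝ) 1))
    (h : Tendsto (fun k => ∫ x in Set.Icc (0 : ℝ) 1, |G k x - g x|) atTop (𝓝 0)) (j : ℕ) :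
    Tendsto (fun k => ∫ x in Set.Icc (0 : ℝ) 1,
      |(primitiveZero^[j] (G k)) x - (primitiveZero^[j] g) x|) atTop (𝓝 0) := by
  induction j with
  | zero => simpa using h
  | succ j ih =>
    refine squeeze_zero (fun k => integral_nonneg fun x => abs_nonneg _) (fun k => ?_) ih
    simp only [Function.iterate_succ_apply']
    have hA := iterate_primitiveZero_integrableOn (hG k) j
    have hB := iterate_primitiveZero_integrableOn hg j
    refine (setIntegral_mono_on (g := fun _ => ∫ x in Set.Icc (0 : ℝ) 1,
        |(primitiveZero^[j] (G k)) x - (primitiveZero^[j] g) x|)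
      ((primitiveZero_integrableOn hA).sub (primitiveZero_integrableOn hB)).abs
      (integrableOn_const (by simp)) measurableSet_Icc
      fun x hx => abs_primitiveZero_sub_le hA hB hx).trans ?_
    simp

lemma tendsto_iterate_primitiveZero {G : ℕ → ℝ → ℝ} {g : ℝ → ℝ}
    (hG : ∀ k, IntegrableOn (G k) (Set.Icc (0 : ℝ) 1)) (hg : IntegrableOn g (Set.Icc (0 : ℝ) 1))
    (h : Tendsto (fun k => ∫ x in Set.Icc (0 : ℝ) 1, |G k x - g x|) atTop (𝓝 0)) (j : ℕ)
    {t : ℝ} (ht : t ∈ Set.Icc (0 : ℝ) 1) :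
    Tendsto (fun k => (primitiveZero^[j + 1] (G k)) t) atTop
      (𝓝 ((primitiveZero^[j + 1] g) t)) := by
  rw [tendsto_iff_dist_tendsto_zero]
  refine squeeze_zero (fun k => dist_nonneg) (fun k => ?_)
    (tendsto_iterate_primitiveZero_L1 hG hg h j)
  simp only [Function.iterate_succ_apply', Real.dist_eq]
  exact abs_primitiveZero_sub_le (iterate_primitiveZero_integrableOn (hG k) j)
    (iterate_primitiveZero_integrableOn hg j) ht

lemma integrableOn_of_memLp_two {g : ℝ → ℝ}
    (hg : MemLp g 2 (volume.restrict (Set.Icc (0 : ℝ) 1))) :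
    IntegrableOn g (Set.Icc (0 : ℝ) 1) := hg.integrable (by norm_num)

/-- Taylor's formula: a member of `H^{m+1}` is a polynomial of degree at most `m` plus the
`(m+1)`-fold primitive of its highest derivative. -/
lemma MemSobolev.exists_taylor {m : ℕ} {f : ℝ → ℝ} (hf : MemSobolev (m + 1) f) :
    ∃ c : ℕ → ℝ, ∀ t ∈ Set.Icc (0 : ℝ) 1, f t = ∑ j ∈ Finset.range (m + 1), c j * t ^ j +
      (primitiveZero^[m + 1] (iteratedDerivWithin (m + 1) f (Set.Icc 0 1))) t := by
  induction m generalizing f with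
  | zero =>
    refine ⟨fun _ => f 0, fun t ht => ?_⟩
    have h := (hf.2.1 0 (by omega)).integral_derivWithin ht
    rw [iteratedDerivWithin_zero] at h
    simp only [zero_add, Finset.range_one, Finset.sum_singleton, pow_zero, mul_one,
      Function.iterate_one, primitiveZero, iteratedDerivWithin_one]
    rw [h]; ring
  | succ m ih =>
    obtain ⟨c, hc⟩ := ih hf.derivWithin
    refine ⟨fun j => if j = 0 then f 0 else c (j - 1) / j, fun t ht => ?_⟩
    have h := (hf.2.1 0 (by omega)).integral_derivWithin ht
    rw [iteratedDerivWithin_zero] at h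
    set g := iteratedDerivWithin (m + 1) (_root_.derivWithin f (Set.Icc 0 1)) (Set.Icc 0 1) with hg
    have hgi : IntegrableOn g (Set.Icc (0 : ℝ) 1) := integrableOn_of_memLp_two hf.derivWithin.2.2
    have hEq : ∫ x in (0 : ℝ)..t, _root_.derivWithin f (Set.Icc 0 1) x =
        ∫ x in (0 : ℝ)..t,
          (∑ j ∈ Finset.range (m + 1), c j * x ^ j + (primitiveZero^[m + 1] g) x) := by
      refine intervalIntegral.integral_congr fun x hx => ?_
      rw [Set.uIcc_of_le ht.1] at hx
      exact hc x ⟨hx.1, hx.2.trans ht.2⟩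
    rw [intervalIntegral.integral_add (Continuous.intervalIntegrable (by fun_prop) _ _)
      (IntegrableOn.intervalIntegrable_of_mem_Icc (iterate_primitiveZero_integrableOn hgi _) ht),
      intervalIntegral.integral_finsetSum
        (fun j _ => Continuous.intervalIntegrable (by fun_prop) _ _)] at hEq
    simp only [intervalIntegral.integral_const_mul, integral_pow] at hEq
    rw [Finset.sum_range_succ', iteratedDerivWithin_succ', ← hg, Function.iterate_succ_apply']
    simp only [Nat.add_eq_zero_iff, one_ne_zero, and_false, if_false, if_true, pow_zero, mul_one,
      Nat.add_sub_cancel]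
    have e : ∑ j ∈ Finset.range (m + 1), c j * ((t ^ (j + 1) - 0 ^ (j + 1)) / ((j : ℝ) + 1)) =
        ∑ j ∈ Finset.range (m + 1), c j / ((j + 1 : ℕ) : ℝ) * t ^ (j + 1) := by
      refine Finset.sum_congr rfl fun j _ => ?_
      push_cast; rw [zero_pow (by omega)]; ring
    rw [e] at hEq
    have : f t = f 0 + ∫ x in (0 : ℝ)..t, _root_.derivWithin f (Set.Icc 0 1) x := by rw [h]; ring
    rw [this, hEq]
    change _ = _ + ∫ x in (0 : ℝ)..t, (primitiveZero^[m + 1] g) x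
    ring

/-- Conversely, a polynomial plus an iterated primitive of a square integrable function lies in the
Sobolev space. -/
lemma memSobolev_of_taylor {m : ℕ} {f g : ℝ → ℝ}
    (hg : MemLp g 2 (volume.restrict (Set.Icc (0 : ℝ) 1))) {c : ℕ → ℝ}
    (h : ∀ t ∈ Set.Icc (0 : ℝ) 1, f t = ∑ j ∈ Finset.range (m + 1), c j * t ^ j +
      (primitiveZero^[m + 1] g) t) : MemSobolev (m + 1) f := by
  have hgi := integrableOn_of_memLp_two hg
  induction m generalizing f c with
  | zero =>
    have h' : Set.EqOn f (fun t => c 0 + primitiveZero g t) (Set.Icc 0 1) := fun t ht => by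
      simpa using h t ht
    have hac : AbsolutelyContinuousOnInterval f 0 1 := by
      refine AbsolutelyContinuousOnInterval.congr_uIcc (f := fun t => c 0 + primitiveZero g t)
        (AbsolutelyContinuousOnInterval.fun_add
          contDiffOn_const.absolutelyContinuousOnInterval
          (primitiveZero_absolutelyContinuous hgi)) ?_
      rwa [Set.uIcc_of_le zero_le_one]
    refine ⟨fun k hk => by omega, fun k hk => ?_, ?_⟩
    · obtain rfl : k = 0 := by omega
      simpa using hac
    · rw [zero_add, iteratedDerivWithin_one]
      refine (memLp_congr_ae ?_).2 hg
      have hI := (IntegrableOn.intervalIntegrable_of_mem_Icc hgi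
        (by simp : (1 : ℝ) ∈ Set.Icc (0 : ℝ) 1)).ae_hasDerivAt_integral
      filter_upwards [ae_restrict_of_ae hI, ae_restrict_mem measurableSet_Icc] with t hd ht
      rw [Set.uIcc_of_le zero_le_one] at hd
      have hd' : HasDerivAt (primitiveZero g) (g t) t := hd ht 0 (by simp)
      rw [derivWithin_congr h' (h' ht)]
      exact (hd'.const_add (c 0)).hasDerivWithinAt.derivWithin
        (uniqueDiffOn_Icc zero_lt_one t ht)
  | succ m ih =>
    have hd : ∀ t ∈ Set.Icc (0 : ℝ) 1, HasDerivWithinAt f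
        (∑ j ∈ Finset.range (m + 1), (((j : ℝ) + 1) * c (j + 1)) * t ^ j +
          (primitiveZero^[m + 1] g) t) (Set.Icc 0 1) t := by
      intro t ht
      have hc : ContinuousOn (primitiveZero^[m + 1] g) (Set.Icc 0 1) := by
        rw [Function.iterate_succ_apply']
        exact primitiveZero_continuousOn (iterate_primitiveZero_integrableOn hgi m)
      have h1 : HasDerivWithinAt (primitiveZero^[m + 1 + 1] g) ((primitiveZero^[m + 1] g) t)
          (Set.Icc 0 1) t := by
        rw [Function.iterate_succ_apply' primitiveZero (m + 1)]
        have : Fact (t ∈ Set.Icc (0 : ℝ) 1) := ⟨ht⟩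
        exact intervalIntegral.integral_hasDerivWithinAt_right
          (IntegrableOn.intervalIntegrable_of_mem_Icc
            (iterate_primitiveZero_integrableOn hgi (m + 1)) ht)
          (hc.stronglyMeasurableAtFilter_nhdsWithin measurableSet_Icc t) (hc t ht)
      have h2 : HasDerivWithinAt (fun t : ℝ => ∑ j ∈ Finset.range (m + 1 + 1), c j * t ^ j)
          (∑ j ∈ Finset.range (m + 1), (((j : ℝ) + 1) * c (j + 1)) * t ^ j)
          (Set.Icc 0 1) t := by
        have : HasDerivAt (fun t : ℝ => ∑ j ∈ Finset.range (m + 1 + 1), c j * t ^ j)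
            (∑ j ∈ Finset.range (m + 1 + 1), c j * ((j : ℝ) * t ^ (j - 1))) t :=
          HasDerivAt.fun_sum fun j _ => (hasDerivAt_pow j t).const_mul (c j)
        refine (this.congr_deriv ?_).hasDerivWithinAt
        rw [Finset.sum_range_succ']
        simp only [Nat.cast_zero, zero_mul, mul_zero, add_zero, Nat.add_sub_cancel]
        refine Finset.sum_congr rfl fun j _ => ?_
        push_cast; ring
      exact (h2.add h1).congr (fun x hx => h x hx) (h t ht)
    refine MemSobolev.of_derivWithin (fun t ht => (hd t ht).differentiableWithinAt) ?_
    exact ih (c := fun j => ((j : ℝ) + 1) * c (j + 1)) fun t ht =>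
      (hd t ht).derivWithin (uniqueDiffOn_Icc zero_lt_one t ht)

/-- A pointwise limit on `[0,1]` of polynomials of degree less than `m` is such a polynomial: these
polynomials form a finite dimensional, hence closed, space of functions. -/
lemma exists_polynomial_of_tendsto (m : ℕ) {c : ℕ → ℕ → ℝ} {p : ℝ → ℝ}
    (h : ∀ t ∈ Set.Icc (0 : ℝ) 1,
      Tendsto (fun k => ∑ j ∈ Finset.range m, c k j * t ^ j) atTop (𝓝 (p t))) :
    ∃ a : ℕ → ℝ, ∀ t ∈ Set.Icc (0 : ℝ) 1, p t = ∑ j ∈ Finset.range m, a j * t ^ j := by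
  let b : Fin m → (Set.Icc (0 : ℝ) 1 → ℝ) := fun j t => (t : ℝ) ^ (j : ℕ)
  have : FiniteDimensional ℝ (Submodule.span ℝ (Set.range b)) :=
    FiniteDimensional.span_of_finite ℝ (Set.finite_range b)
  have hclosed : IsClosed (Submodule.span ℝ (Set.range b) : Set (Set.Icc (0 : ℝ) 1 → ℝ)) :=
    Submodule.closed_of_finiteDimensional _
  have hmem : (fun t : Set.Icc (0 : ℝ) 1 => p t) ∈ Submodule.span ℝ (Set.range b) := by
    refine hclosed.mem_of_tendsto
      (f := fun k (t : Set.Icc (0 : ℝ) 1) => ∑ j ∈ Finset.range m, c k j * (t : ℝ) ^ j)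
      (tendsto_pi_nhds.2 fun t => h t t.2) (Eventually.of_forall fun k => ?_)
    have : (fun t : Set.Icc (0 : ℝ) 1 => ∑ j ∈ Finset.range m, c k j * (t : ℝ) ^ j) =
        ∑ j : Fin m, c k j • b j := by
      funext t
      simp [b, Finset.sum_range]
    rw [this]
    exact Submodule.sum_mem _ fun j _ => Submodule.smul_mem _ _
      (Submodule.subset_span (Set.mem_range_self j))
  obtain ⟨a, ha⟩ := (Submodule.mem_span_range_iff_exists_fun ℝ).1 hmem
  refine ⟨fun j => if hj : j < m then a ⟨j, hj⟩ else 0, fun t ht => ?_⟩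
  have := congrFun ha ⟨t, ht⟩
  simp only [Finset.sum_apply, Pi.smul_apply, smul_eq_mul, b] at this
  rw [← this, Finset.sum_range]
  simp

/-- Completeness of the Sobolev space: if `F k ∈ H^m` converge pointwise on `[0,1]` and their `m`-th
derivatives converge in `L²`, then the limit lies in `H^m`. -/
lemma memSobolev_of_tendsto {m : ℕ} (hm : 1 ≤ m) {F : ℕ → ℝ → ℝ} {f g : ℝ → ℝ}
    (hF : ∀ k, MemSobolev m (F k))
    (hlim : ∀ t ∈ Set.Icc (0 : ℝ) 1, Tendsto (fun k => F k t) atTop (𝓝 (f t)))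
    (hg : MemLp g 2 (volume.restrict (Set.Icc (0 : ℝ) 1)))
    (h2 : Tendsto (fun k => eLpNorm (fun t => iteratedDerivWithin m (F k) (Set.Icc 0 1) t - g t) 2
      (volume.restrict (Set.Icc (0 : ℝ) 1))) atTop (𝓝 0)) :
    MemSobolev m f := by
  obtain ⟨m, rfl⟩ : ∃ k, m = k + 1 := ⟨m - 1, by omega⟩
  choose c hc using fun k => (hF k).exists_taylor
  set G : ℕ → ℝ → ℝ := fun k => iteratedDerivWithin (m + 1) (F k) (Set.Icc 0 1) with hG
  have hGi : ∀ k, IntegrableOn (G k) (Set.Icc (0 : ℝ) 1) := fun k =>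
    integrableOn_of_memLp_two (hF k).2.2
  have hgi := integrableOn_of_memLp_two hg
  have : IsProbabilityMeasure (volume.restrict (Set.Icc (0 : ℝ) 1)) := ⟨by simp⟩
  have h1 : Tendsto (fun k => ∫ x in Set.Icc (0 : ℝ) 1, |G k x - g x|) atTop (𝓝 0) := by
    have h1' : Tendsto (fun k => eLpNorm (fun t => G k t - g t) 1
        (volume.restrict (Set.Icc (0 : ℝ) 1))) atTop (𝓝 0) := by
      refine tendsto_of_tendsto_of_tendsto_of_le_of_le tendsto_const_nhds h2
        (fun k => zero_le) (fun k => ?_)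
      exact eLpNorm_le_eLpNorm_of_exponent_le (by norm_num)
        ((hGi k).sub hgi).aestronglyMeasurable
    have := (ENNReal.tendsto_toReal ENNReal.zero_ne_top).comp h1'
    simp only [ENNReal.toReal_zero] at this
    refine this.congr fun k => ?_
    simp only [Function.comp_apply, eLpNorm_one_eq_lintegral_enorm]
    have := integral_norm_eq_lintegral_enorm ((hGi k).sub hgi).aestronglyMeasurable
    simpa [Real.norm_eq_abs] using this.symm
  have hp : ∀ t ∈ Set.Icc (0 : ℝ) 1,
      Tendsto (fun k => ∑ j ∈ Finset.range (m + 1), c k j * t ^ j) atTop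
        (𝓝 (f t - (primitiveZero^[m + 1] g) t)) := by
    intro t ht
    refine ((hlim t ht).sub (tendsto_iterate_primitiveZero hGi hgi h1 m ht)).congr fun k => ?_
    rw [hc k t ht]; ring
  obtain ⟨a, ha⟩ := exists_polynomial_of_tendsto (m + 1)
    (p := fun t => f t - (primitiveZero^[m + 1] g) t) hp
  refine memSobolev_of_taylor hg (c := a) fun t ht => ?_
  rw [← ha t ht]; ring

/-! ### The forms `V` and `J` and expansions in the eigenfunctions -/

/-- A probability measure with the same null sets as the Lebesgue measure on `[0,1]`. -/
structure IsUnitDesign (ν : Measure ℝ) : Prop where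
  isProb : IsProbabilityMeasure ν
  ac : ν ≪ volume.restrict (Set.Icc (0 : ℝ) 1)
  ac' : volume.restrict (Set.Icc (0 : ℝ) 1) ≪ ν

namespace IsUnitDesign

variable {ν : Measure ℝ} (hν : IsUnitDesign ν)
include hν

lemma ae_mem : ∀ᵐ t ∂ν, t ∈ Set.Icc (0 : ℝ) 1 :=
  hν.ac.ae_le (ae_restrict_mem measurableSet_Icc)

lemma aestronglyMeasurable {f : ℝ → ℝ} (hf : ContinuousOn f (Set.Icc 0 1)) :
    AEStronglyMeasurable f ν :=
  (hf.aestronglyMeasurable measurableSet_Icc).mono_ac hν.ac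

lemma integrable {f : ℝ → ℝ} (hf : ContinuousOn f (Set.Icc 0 1)) : Integrable f ν := by
  have := hν.isProb
  obtain ⟨C, hC⟩ := isCompact_Icc.exists_bound_of_continuousOn hf
  refine Integrable.of_bound (hν.aestronglyMeasurable hf) C ?_
  filter_upwards [hν.ae_mem] with t ht using hC t ht

lemma integrable_mul {f g : ℝ → ℝ} (hf : ContinuousOn f (Set.Icc 0 1))
    (hg : ContinuousOn g (Set.Icc 0 1)) : Integrable (fun t => f t * g t) ν :=
  hν.integrable (hf.mul hg)

lemma designForm_linComb_left {f g k : ℝ → ℝ} (hf : ContinuousOn f (Set.Icc 0 1))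
    (hg : ContinuousOn g (Set.Icc 0 1)) (hk : ContinuousOn k (Set.Icc 0 1)) (a b : ℝ) :
    designForm ν (fun t => a * f t + b * g t) k = a * designForm ν f k + b * designForm ν g k := by
  unfold designForm
  rw [← integral_const_mul, ← integral_const_mul, ← integral_add
    ((hν.integrable_mul hf hk).const_mul a) ((hν.integrable_mul hg hk).const_mul b)]
  congr 1; funext t; ring

lemma designForm_sum_left {e : ℕ → ℝ → ℝ} {k : ℝ → ℝ}
    (he : ∀ v, ContinuousOn (e v) (Set.Icc 0 1)) (hk : ContinuousOn k (Set.Icc 0 1)) (c : ℕ → ℝ)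
    (s : Finset ℕ) :
    designForm ν (fun t => ∑ v ∈ s, c v * e v t) k = ∑ v ∈ s, c v * designForm ν (e v) k := by
  unfold designForm
  simp_rw [← integral_const_mul]
  rw [← integral_finsetSum _ fun v _ => (hν.integrable_mul (he v) hk).const_mul (c v)]
  congr 1; funext t; rw [Finset.sum_mul]; exact Finset.sum_congr rfl fun v _ => by ring

end IsUnitDesign

lemma designForm_comm (ν : Measure ℝ) (f g : ℝ → ℝ) : designForm ν f g = designForm ν g f := by
  unfold designForm; congr 1; funext t; ring

lemma designForm_self_nonneg (ν : Measure ℝ) (f : ℝ → ℝ) : 0 ≤ designForm ν f f :=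
  integral_nonneg fun t => mul_self_nonneg (f t)

lemma roughness_comm (m : ℕ) (f g : ℝ → ℝ) : roughness m f g = roughness m g f := by
  unfold roughness; congr 1; funext t; ring

lemma roughness_self_nonneg (m : ℕ) (f : ℝ → ℝ) : 0 ≤ roughness m f f :=
  integral_nonneg fun _ => mul_self_nonneg _

namespace MemSobolev

variable {m : ℕ} {f g k : ℝ → ℝ}

lemma integrable_mul_iteratedDerivWithin (hf : MemSobolev m f) (hg : MemSobolev m g) :
    Integrable (fun t => iteratedDerivWithin m f (Set.Icc 0 1) t *
      iteratedDerivWithin m g (Set.Icc 0 1) t) (volume.restrict (Set.Icc (0 : ℝ) 1)) :=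
  hf.2.2.integrable_mul hg.2.2

lemma roughness_linComb_left (hf : MemSobolev m f) (hg : MemSobolev m g) (hk : MemSobolev m k)
    (a b : ℝ) : roughness m (fun t => a * f t + b * g t) k =
      a * roughness m f k + b * roughness m g k := by
  unfold roughness
  rw [← integral_const_mul, ← integral_const_mul, ← integral_add
    ((hf.integrable_mul_iteratedDerivWithin hk).const_mul a)
    ((hg.integrable_mul_iteratedDerivWithin hk).const_mul b)]
  refine integral_congr_ae ?_
  filter_upwards [hf.iteratedDerivWithin_linComb_ae hg a b] with t ht
  rw [ht]; ring

lemma roughness_sum_left {e : ℕ → ℝ → ℝ} (he : ∀ v, MemSobolev m (e v)) (hk : MemSobolev m k)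
    (c : ℕ → ℝ) (s : Finset ℕ) :
    roughness m (fun t => ∑ v ∈ s, c v * e v t) k = ∑ v ∈ s, c v * roughness m (e v) k := by
  unfold roughness
  simp_rw [← integral_const_mul]
  rw [← integral_finsetSum _ fun v _ =>
    ((he v).integrable_mul_iteratedDerivWithin hk).const_mul (c v)]
  refine integral_congr_ae ?_
  filter_upwards [MemSobolev.iteratedDerivWithin_sum_ae he c s] with t ht
  rw [ht, Finset.sum_mul]; exact Finset.sum_congr rfl fun v _ => by ring

lemma roughness_add_smul_self (hf : MemSobolev m f) (hg : MemSobolev m g) (s : ℝ) :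
    roughness m (fun t => f t + s * g t) (fun t => f t + s * g t) =
      roughness m f f + 2 * s * roughness m f g + s ^ 2 * roughness m g g := by
  have hfg : MemSobolev m (fun t => f t + s * g t) := by simpa using hf.linComb hg 1 s
  have h1 := hf.roughness_linComb_left hg hfg 1 s
  have h2 := hf.roughness_linComb_left hg hf 1 s
  have h3 := hf.roughness_linComb_left hg hg 1 s
  simp only [one_mul] at h1 h2 h3
  rw [h1, roughness_comm m f, roughness_comm m g, h2, h3, roughness_comm m g f]
  ring

/-- The Cauchy-Schwarz inequality for the form `J`. -/
lemma roughness_sq_le (hf : MemSobolev m f) (hg : MemSobolev m g) :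
    roughness m f g ^ 2 ≤ roughness m f f * roughness m g g := by
  have h : ∀ s : ℝ, 0 ≤ roughness m g g * (s * s) + 2 * roughness m f g * s + roughness m f f := by
    intro s
    have := roughness_self_nonneg m (fun t => f t + s * g t)
    rw [hf.roughness_add_smul_self hg] at this
    linarith
  have := discrim_le_zero h
  unfold discrim at this
  nlinarith

lemma ofReal_roughness_self (hf : MemSobolev m f) : ENNReal.ofReal (roughness m f f) =
    ∫⁻ t in Set.Icc (0 : ℝ) 1,
      ENNReal.ofReal ((iteratedDerivWithin m f (Set.Icc 0 1) t) ^ 2) := by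
  unfold roughness
  rw [ofReal_integral_eq_lintegral_ofReal (hf.integrable_mul_iteratedDerivWithin hf)
    (ae_of_all _ fun t => mul_self_nonneg _)]
  simp_rw [sq]

end MemSobolev

/-- The content of `EigenAssumption` for a fixed eigensystem `(e, γ)`: of the growth of `γ` only the
lower bound `γ v ≥ a (v+1)^(2m)` for `v ≥ v₀` is recorded. -/
structure IsEigensystem (m : ℕ) (ν : Measure ℝ) (e : ℕ → ℝ → ℝ) (γ : ℕ → ℝ) (B a : ℝ)
    (v₀ : ℕ) : Prop where
  one_le : 1 ≤ m
  design : IsUnitDesign ν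
  mem : ∀ v, MemSobolev m (e v)
  bound : ∀ v, ∀ t ∈ Set.Icc (0 : ℝ) 1, |e v t| ≤ B
  pos : 0 < a
  growth : ∀ v, v₀ ≤ v → a * ((v : ℝ) + 1) ^ (2 * m) ≤ γ v
  designForm_eq : ∀ u v, designForm ν (e u) (e v) = if u = v then 1 else 0
  roughness_eq : ∀ u v, roughness m (e u) (e v) = if u = v then γ u else 0
  tendsto : ∀ g, MemSobolev m g → ∀ lam : ℝ, 0 < lam → Tendsto (fun k => rkhsNorm m ν lam
    (fun t => g t - ∑ v ∈ Finset.range k, designForm ν g (e v) * e v t)) atTop (𝓝 0)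

lemma EigenAssumption.exists_isEigensystem {m : ℕ} {ν : Measure ℝ} (h : EigenAssumption m ν)
    (hm : 1 ≤ m) (hν : IsUnitDesign ν) :
    ∃ e γ B a v₀, IsEigensystem m ν e γ B a v₀ := by
  obtain ⟨e, γ, hmem, ⟨B, hB⟩, hmono, hΘ, hV, hJ, ht⟩ := h
  obtain ⟨c, hc, hev⟩ := hΘ.2.exists_pos
  obtain ⟨v₀, hv₀⟩ := eventually_atTop.1 (isBigOWith_iff.1 hev)
  have hγ : ∀ v, 0 ≤ γ v := fun v => by
    have := roughness_self_nonneg m (e v)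
    rwa [hJ, if_pos rfl] at this
  refine ⟨e, γ, B, c⁻¹, v₀, hm, hν, hmem, hB, by positivity, fun v hv => ?_, hV, hJ, ht⟩
  have := hv₀ v hv
  rw [Real.norm_of_nonneg (by positivity), Real.norm_of_nonneg (hγ v)] at this
  rwa [inv_mul_le_iff₀ hc]

lemma sum_inv_sq_le {h : ℝ} (hh : 0 < h) (k : ℕ) :
    ∑ v ∈ Finset.range k, 1 / (1 + h * ((v : ℝ) + 1)) ^ 2 ≤ 1 / h := by
  have key : ∑ v ∈ Finset.range k, 1 / (1 + h * ((v : ℝ) + 1)) ^ 2 ≤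
      1 / h * (1 - 1 / (1 + h * k)) := by
    induction k with
    | zero => simp
    | succ k ih =>
      rw [Finset.sum_range_succ]
      have e : 1 / h * (1 - 1 / (1 + h * ((k + 1 : ℕ) : ℝ))) =
          1 / h * (1 - 1 / (1 + h * k)) + 1 / ((1 + h * k) * (1 + h * (k + 1))) := by
        push_cast; field_simp; ring
      rw [e]
      refine add_le_add ih (one_div_le_one_div_of_le (by positivity) ?_)
      rw [sq]
      have : h * (k : ℝ) ≤ h * (k + 1) := by nlinarith
      gcongr
  refine key.trans (mul_le_of_le_one_right (by positivity) ?_)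
  have : 0 ≤ 1 / (1 + h * (k : ℝ)) := by positivity
  linarith

lemma one_add_sq_le {x : ℝ} (hx : 0 ≤ x) {m : ℕ} (hm : 1 ≤ m) :
    (1 + x) ^ 2 ≤ 4 * (1 + x ^ (2 * m)) := by
  have h0 : 0 ≤ x ^ (2 * m) := by positivity
  rcases le_total x 1 with h | h
  · nlinarith
  · have : x ^ 2 ≤ x ^ (2 * m) := pow_le_pow_right₀ h (by omega)
    nlinarith [sq_nonneg (x - 1)]

namespace IsEigensystem

variable {m : ℕ} {ν : Measure ℝ} {e : ℕ → ℝ → ℝ} {γ : ℕ → ℝ} {B a : ℝ} {v₀ : ℕ}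
  (E : IsEigensystem m ν e γ B a v₀)
include E

lemma gamma_nonneg (v : ℕ) : 0 ≤ γ v := by
  have := roughness_self_nonneg m (e v)
  rwa [E.roughness_eq, if_pos rfl] at this

lemma B_nonneg : 0 ≤ B := (abs_nonneg _).trans (E.bound 0 0 (by simp))

lemma continuousOn (v : ℕ) : ContinuousOn (e v) (Set.Icc 0 1) := (E.mem v).continuousOn E.one_le

/-- The effective dimension `∑ 1 / (1 + λ γ_v)` of the smoothing spline with `λ = h^(2m)` is of
order `1/h`. -/
lemma exists_sum_inv_le : ∃ C : ℝ, 0 < C ∧ ∀ h : ℝ, 0 < h → h ≤ 1 → ∀ k : ℕ,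
    ∑ v ∈ Finset.range k, 1 / (1 + h ^ (2 * m) * γ v) ≤ C / h := by
  have ha := E.pos
  set b := min 1 a with hb
  have hb0 : 0 < b := lt_min one_pos ha
  refine ⟨v₀ + 4 / b, by positivity, fun h hh hh1 k => ?_⟩
  have hterm : ∀ v : ℕ, 1 / (1 + h ^ (2 * m) * γ v) ≤
      (if v < v₀ then 1 else 0) + 4 / b * (1 / (1 + h * ((v : ℝ) + 1)) ^ 2) := by
    intro v
    have hγ := E.gamma_nonneg v
    split_ifs with hv
    · have h1 : 1 / (1 + h ^ (2 * m) * γ v) ≤ 1 := by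
        rw [div_le_one (by positivity)]
        have : 0 ≤ h ^ (2 * m) * γ v := by positivity
        linarith
      have : 0 ≤ 4 / b * (1 / (1 + h * ((v : ℝ) + 1)) ^ 2) := by positivity
      linarith
    · rw [zero_add, div_mul_div_comm, mul_one, div_le_div_iff₀ (by positivity) (by positivity)]
      have hg := E.growth v (not_lt.1 hv)
      have hx := one_add_sq_le (x := h * ((v : ℝ) + 1)) (by positivity) E.one_le
      rw [mul_pow] at hx
      have hy : h ^ (2 * m) * (a * ((v : ℝ) + 1) ^ (2 * m)) ≤ h ^ (2 * m) * γ v := by gcongr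
      have hz : 0 ≤ h ^ (2 * m) * ((v : ℝ) + 1) ^ (2 * m) := by positivity
      have hba : b ≤ a := min_le_right _ _
      have hb1 : b ≤ 1 := min_le_left _ _
      nlinarith [mul_le_mul_of_nonneg_right hba hz, mul_le_mul_of_nonneg_left hx hb0.le]
  calc ∑ v ∈ Finset.range k, 1 / (1 + h ^ (2 * m) * γ v)
      ≤ ∑ v ∈ Finset.range k, ((if v < v₀ then (1 : ℝ) else 0) +
          4 / b * (1 / (1 + h * ((v : ℝ) + 1)) ^ 2)) := Finset.sum_le_sum fun v _ => hterm v
    _ ≤ v₀ + 4 / b * (1 / h) := by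
        rw [Finset.sum_add_distrib, ← Finset.mul_sum]
        refine add_le_add ?_ (mul_le_mul_of_nonneg_left (sum_inv_sq_le hh k) (by positivity))
        rw [← Finset.sum_filter, Finset.sum_const, nsmul_eq_mul, mul_one]
        norm_cast
        calc _ ≤ (Finset.range v₀).card := Finset.card_le_card fun v hv => by
                simp at hv ⊢; exact hv.2
          _ = v₀ := Finset.card_range _
    _ ≤ v₀ * (1 / h) + 4 / b * (1 / h) := by
        gcongr
        exact le_mul_of_one_le_right (by positivity) (by rw [le_div_iff₀ hh]; linarith)
    _ = (v₀ + 4 / b) / h := by ring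

lemma summable_inv : Summable fun v => 1 / (1 + γ v) := by
  obtain ⟨C, _, hC⟩ := E.exists_sum_inv_le
  refine summable_of_sum_range_le (c := C) (fun v => ?_) fun k => ?_
  · have := E.gamma_nonneg v; positivity
  · simpa using hC 1 one_pos le_rfl k

section Expansion

variable {f : ℝ → ℝ} (hf : MemSobolev m f)
include hf

lemma tendsto_designForm_sub : Tendsto (fun k => designForm ν
    (fun t => f t - ∑ v ∈ Finset.range k, designForm ν f (e v) * e v t)
    (fun t => f t - ∑ v ∈ Finset.range k, designForm ν f (e v) * e v t)) atTop (𝓝 0) := by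
  have h := (E.tendsto f hf 1 one_pos).pow 2
  rw [zero_pow two_ne_zero] at h
  refine squeeze_zero (fun k => designForm_self_nonneg _ _) (fun k => ?_) h
  have h1 := designForm_self_nonneg ν
    (fun t => f t - ∑ v ∈ Finset.range k, designForm ν f (e v) * e v t)
  have h2 := roughness_self_nonneg m
    (fun t => f t - ∑ v ∈ Finset.range k, designForm ν f (e v) * e v t)
  unfold rkhsNorm rkhsInner
  rw [Real.sq_sqrt (by linarith)]
  linarith

lemma tendsto_roughness_sub : Tendsto (fun k => roughness m
    (fun t => f t - ∑ v ∈ Finset.range k, designForm ν f (e v) * e v t)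
    (fun t => f t - ∑ v ∈ Finset.range k, designForm ν f (e v) * e v t)) atTop (𝓝 0) := by
  have h := (E.tendsto f hf 1 one_pos).pow 2
  rw [zero_pow two_ne_zero] at h
  refine squeeze_zero (fun k => roughness_self_nonneg _ _) (fun k => ?_) h
  have h1 := designForm_self_nonneg ν
    (fun t => f t - ∑ v ∈ Finset.range k, designForm ν f (e v) * e v t)
  have h2 := roughness_self_nonneg m
    (fun t => f t - ∑ v ∈ Finset.range k, designForm ν f (e v) * e v t)
  unfold rkhsNorm rkhsInner
  rw [Real.sq_sqrt (by linarith)]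
  linarith

/-- Parseval's identity for `V`. -/
lemma hasSum_designForm : HasSum (fun v => designForm ν f (e v) ^ 2) (designForm ν f f) := by
  rw [hasSum_iff_tendsto_nat_of_nonneg (fun v => sq_nonneg _)]
  have hfc := hf.continuousOn E.one_le
  have key : ∀ k, designForm ν
      (fun t => f t - ∑ v ∈ Finset.range k, designForm ν f (e v) * e v t)
      (fun t => f t - ∑ v ∈ Finset.range k, designForm ν f (e v) * e v t) =
      designForm ν f f - ∑ v ∈ Finset.range k, designForm ν f (e v) ^ 2 := by
    intro k
    set S : ℝ → ℝ := fun t => ∑ v ∈ Finset.range k, designForm ν f (e v) * e v t with hS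
    have hSc : ContinuousOn S (Set.Icc 0 1) :=
      (MemSobolev.sum E.mem _ _).continuousOn E.one_le
    have hd : ContinuousOn (fun t => f t - S t) (Set.Icc 0 1) := hfc.sub hSc
    have lin : ∀ g, ContinuousOn g (Set.Icc 0 1) →
        designForm ν (fun t => f t - S t) g = designForm ν f g - designForm ν S g := by
      intro g hg
      have := E.design.designForm_linComb_left hfc hSc hg 1 (-1)
      simpa [sub_eq_add_neg] using this
    have hSg : ∀ g, ContinuousOn g (Set.Icc 0 1) → designForm ν S g =
        ∑ v ∈ Finset.range k, designForm ν f (e v) * designForm ν (e v) g := fun g hg =>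
      E.design.designForm_sum_left E.continuousOn hg _ _
    rw [lin _ hd, designForm_comm ν f, designForm_comm ν S, lin _ hfc, lin _ hSc, hSg _ hfc,
      hSg _ hSc, designForm_comm ν f S, hSg _ hfc]
    have : ∀ v ∈ Finset.range k, designForm ν (e v) S = designForm ν f (e v) := by
      intro v hv
      rw [designForm_comm, hSg _ (E.continuousOn v)]
      simp [E.designForm_eq, Finset.mem_range.1 hv]
    have hsum : ∑ v ∈ Finset.range k, designForm ν f (e v) * designForm ν (e v) S =
        ∑ v ∈ Finset.range k, designForm ν f (e v) * designForm ν f (e v) :=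
      Finset.sum_congr rfl fun v hv => by rw [this v hv]
    rw [hsum]
    simp_rw [fun v => designForm_comm ν (e v) f, ← sq]
    ring
  have h := E.tendsto_designForm_sub hf
  simp_rw [key] at h
  simpa using (tendsto_const_nhds (x := designForm ν f f)).sub h

/-- The coefficients diagonalize `J` as well. -/
lemma roughness_eq_mul (u : ℕ) : roughness m f (e u) = γ u * designForm ν f (e u) := by
  set S : ℕ → ℝ → ℝ := fun k t => ∑ v ∈ Finset.range k, designForm ν f (e v) * e v t with hS
  have hSm : ∀ k, MemSobolev m (S k) := fun k => MemSobolev.sum E.mem _ _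
  have h0 : Tendsto (fun k => roughness m (fun t => f t - S k t) (e u)) atTop (𝓝 0) := by
    have h := (E.tendsto_roughness_sub hf).mul_const (γ u)
    rw [zero_mul] at h
    have hsq : Tendsto (fun k => roughness m (fun t => f t - S k t) (e u) ^ 2) atTop (𝓝 0) := by
      refine squeeze_zero (fun k => sq_nonneg _) (fun k => ?_) h
      refine ((hf.sub (hSm k)).roughness_sq_le (E.mem u)).trans ?_
      rw [E.roughness_eq u u, if_pos rfl]
    have := hsq.sqrt
    simp only [Real.sqrt_sq_eq_abs, Real.sqrt_zero] at this
    exact (tendsto_zero_iff_abs_tendsto_zero _).2 this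
  have h1 : ∀ᶠ k in atTop, roughness m (fun t => f t - S k t) (e u) =
      roughness m f (e u) - γ u * designForm ν f (e u) := by
    filter_upwards [eventually_gt_atTop u] with k hk
    have l := hf.roughness_linComb_left (hSm k) (E.mem u) 1 (-1)
    have l2 := MemSobolev.roughness_sum_left E.mem (E.mem u) (fun v => designForm ν f (e v))
      (Finset.range k)
    simp only [one_mul, neg_mul, ← sub_eq_add_neg] at l
    rw [l, hS]
    simp only
    rw [l2]
    simp [E.roughness_eq, hk, mul_comm]
  have := tendsto_nhds_unique (h0.congr' h1) tendsto_const_nhds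
  linarith

/-- Parseval's identity for `J`. -/
lemma hasSum_roughness :
    HasSum (fun v => γ v * designForm ν f (e v) ^ 2) (roughness m f f) := by
  rw [hasSum_iff_tendsto_nat_of_nonneg (fun v => mul_nonneg (E.gamma_nonneg v) (sq_nonneg _))]
  have key : ∀ k, roughness m
      (fun t => f t - ∑ v ∈ Finset.range k, designForm ν f (e v) * e v t)
      (fun t => f t - ∑ v ∈ Finset.range k, designForm ν f (e v) * e v t) =
      roughness m f f - ∑ v ∈ Finset.range k, γ v * designForm ν f (e v) ^ 2 := by
    intro k
    set S : ℝ → ℝ := fun t => ∑ v ∈ Finset.range k, designForm ν f (e v) * e v t with hS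
    have hSm : MemSobolev m S := MemSobolev.sum E.mem _ _
    have hd := hf.roughness_add_smul_self hSm (-1)
    simp only [neg_mul, one_mul, ← sub_eq_add_neg] at hd
    have hSg : ∀ g, MemSobolev m g → roughness m S g =
        ∑ v ∈ Finset.range k, designForm ν f (e v) * roughness m (e v) g := fun g hg =>
      MemSobolev.roughness_sum_left E.mem hg _ _
    rw [hd, roughness_comm m f S, hSg _ hf, hSg _ hSm]
    have h1 : ∀ v ∈ Finset.range k, roughness m (e v) S = γ v * designForm ν f (e v) := by
      intro v hv
      rw [roughness_comm, hSg _ (E.mem v)]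
      simp [E.roughness_eq, Finset.mem_range.1 hv, mul_comm]
    have h2 : ∀ v, roughness m (e v) f = γ v * designForm ν f (e v) := fun v => by
      rw [roughness_comm, E.roughness_eq_mul hf]
    have hsum : ∑ v ∈ Finset.range k, designForm ν f (e v) * roughness m (e v) S =
        ∑ v ∈ Finset.range k, γ v * designForm ν f (e v) ^ 2 :=
      Finset.sum_congr rfl fun v hv => by rw [h1 v hv]; ring
    have hsum' : ∑ v ∈ Finset.range k, designForm ν f (e v) * roughness m (e v) f =
        ∑ v ∈ Finset.range k, γ v * designForm ν f (e v) ^ 2 :=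
      Finset.sum_congr rfl fun v _ => by rw [h2 v]; ring
    rw [hsum, hsum']
    ring
  have h := E.tendsto_roughness_sub hf
  simp_rw [key] at h
  simpa using (tendsto_const_nhds (x := roughness m f f)).sub h

/-- Parseval's identity for the norm with parameter `lam`. -/
lemma hasSum_rkhsInner (lam : ℝ) :
    HasSum (fun v => (1 + lam * γ v) * designForm ν f (e v) ^ 2) (rkhsInner m ν lam f f) := by
  refine ((E.hasSum_designForm hf).add ((E.hasSum_roughness hf).mul_left lam)).congr_fun
    fun v => ?_
  ring

end Expansion

/-- Square summability against the weights `1 + γ_v` makes the expansion absolutely summable. -/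
lemma summable_abs_of_weighted {c : ℕ → ℝ} (hc : Summable fun v => (1 + γ v) * c v ^ 2) :
    Summable fun v => |c v| := by
  refine Summable.of_nonneg_of_le (fun v => abs_nonneg _) (fun v => ?_)
    ((E.summable_inv.add hc).mul_left (1 / 2))
  have hγ := E.gamma_nonneg v
  have h1 : 0 < 1 + γ v := by linarith
  have h2 : |c v| * (1 + γ v) ≤ (1 / 2) * (1 + ((1 + γ v) * |c v|) ^ 2) := by
    nlinarith [sq_nonneg ((1 + γ v) * |c v| - 1)]
  rw [← sq_abs (c v)]
  have h3 : |c v| ≤ (1 / 2) * (1 + ((1 + γ v) * |c v|) ^ 2) / (1 + γ v) := by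
    rwa [le_div_iff₀ h1]
  refine h3.trans (le_of_eq ?_)
  field_simp

lemma abs_mul_le (c : ℕ → ℝ) (v : ℕ) {t : ℝ} (ht : t ∈ Set.Icc (0 : ℝ) 1) :
    |c v * e v t| ≤ B * |c v| := by
  rw [abs_mul, mul_comm]
  exact mul_le_mul_of_nonneg_right (E.bound v t ht) (abs_nonneg _)

/-- The eigenfunction expansion of a member of the Sobolev space converges pointwise on `[0,1]`. The
limit is continuous by uniform convergence and agrees with the function almost everywhere. -/
lemma hasSum_apply {f : ℝ → ℝ} (hf : MemSobolev m f) {t : ℝ} (ht : t ∈ Set.Icc (0 : ℝ) 1) :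
    HasSum (fun v => designForm ν f (e v) * e v t) (f t) := by
  set c : ℕ → ℝ := fun v => designForm ν f (e v) with hc
  have hsum : Summable fun v => |c v| := by
    refine E.summable_abs_of_weighted ?_
    simpa using (E.hasSum_rkhsInner hf 1).summable
  have hsum' : Summable fun v => B * |c v| := hsum.mul_left B
  set s : ℝ → ℝ := fun t => ∑' v, c v * e v t with hs
  have hsc : ContinuousOn s (Set.Icc 0 1) :=
    continuousOn_tsum (fun v => continuousOn_const.mul (E.continuousOn v)) hsum'
      fun v t ht => by rw [Real.norm_eq_abs]; exact E.abs_mul_le c v ht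
  have hfc := hf.continuousOn E.one_le
  have := E.design.isProb
  have hV := E.tendsto_designForm_sub hf
  have hzero : ∫ t, (f t - s t) ^ 2 ∂ν = 0 := by
    have hbd : ∃ D, ∀ t ∈ Set.Icc (0 : ℝ) 1, |f t| ≤ D := by
      simpa using isCompact_Icc.exists_bound_of_continuousOn hfc
    obtain ⟨D, hD⟩ := hbd
    have hdom : Tendsto (fun k => designForm ν
        (fun t => f t - ∑ v ∈ Finset.range k, designForm ν f (e v) * e v t)
        (fun t => f t - ∑ v ∈ Finset.range k, designForm ν f (e v) * e v t)) atTop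
        (𝓝 (∫ t, (f t - s t) ^ 2 ∂ν)) := by
      unfold designForm
      refine tendsto_integral_of_dominated_convergence (fun _ => (D + ∑' v, B * |c v|) ^ 2)
        (fun k => ?_) (integrable_const _) (fun k => ?_) ?_
      · have : ContinuousOn (fun t => f t - ∑ v ∈ Finset.range k, c v * e v t)
          (Set.Icc 0 1) := (hf.sub (MemSobolev.sum E.mem c _)).continuousOn E.one_le
        exact E.design.aestronglyMeasurable (this.mul this)
      · filter_upwards [E.design.ae_mem] with t ht
        rw [← sq, Real.norm_eq_abs, abs_of_nonneg (sq_nonneg _), ← sq_abs]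
        gcongr
        refine (abs_sub _ _).trans (add_le_add (hD t ht) ?_)
        refine (Finset.abs_sum_le_sum_abs _ _).trans ?_
        refine (Finset.sum_le_sum fun v _ => E.abs_mul_le c v ht).trans ?_
        exact hsum'.sum_le_tsum _ fun v _ => mul_nonneg E.B_nonneg (abs_nonneg _)
      · filter_upwards [E.design.ae_mem] with t ht
        have hst : Summable fun v => c v * e v t :=
          Summable.of_norm_bounded hsum' fun v => E.abs_mul_le c v ht
        have h1 := (tendsto_const_nhds (x := f t)).sub hst.hasSum.tendsto_sum_nat
        have := h1.mul h1
        rw [sq]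
        exact this
    exact tendsto_nhds_unique hdom hV
  have hae : f =ᵐ[ν] s := by
    have hI : Integrable (fun t => (f t - s t) ^ 2) ν := E.design.integrable ((hfc.sub hsc).pow 2)
    have := (integral_eq_zero_iff_of_nonneg (fun t => sq_nonneg _) hI).1 hzero
    filter_upwards [this] with t ht
    have : f t - s t = 0 := by simpa using ht
    linarith
  have heq := Measure.eqOn_Icc_of_ae_eq volume zero_ne_one (E.design.ac'.ae_le hae) hfc hsc ht
  rw [heq]
  exact (Summable.of_norm_bounded hsum' fun v => E.abs_mul_le c v ht).hasSum

end IsEigensystem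

/-! ### The deterministic error bound for smoothing splines -/

/-- The first order condition for a smoothing spline with data `(t p, y p)`, `p ∈ s`. -/
lemma sum_residual_mul_eq_of_minimizer {ι : Type*} {m : ℕ} {s : Finset ι} {t y : ι → ℝ}
    {M lam : ℝ} (hM : 0 < M) {f g : ℝ → ℝ} (hf : MemSobolev m f) (hg : MemSobolev m g)
    (hmin : ∀ k, MemSobolev m k →
      1 / (2 * M) * ∑ p ∈ s, (y p - f (t p)) ^ 2 + lam / 2 * roughness m f f ≤
      1 / (2 * M) * ∑ p ∈ s, (y p - k (t p)) ^ 2 + lam / 2 * roughness m k k) :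
    ∑ p ∈ s, (y p - f (t p)) * g (t p) = M * (lam * roughness m f g) := by
  have hq : ∀ x : ℝ, 0 ≤ (1 / (2 * M) * ∑ p ∈ s, g (t p) ^ 2 + lam / 2 * roughness m g g) * (x * x)
      + (lam * roughness m f g - 1 / M * ∑ p ∈ s, (y p - f (t p)) * g (t p)) * x + 0 := by
    intro x
    have h := hmin (fun u => f u + x * g u) (by simpa using hf.linComb hg 1 x)
    rw [hf.roughness_add_smul_self hg] at h
    have e : ∑ p ∈ s, (y p - (f (t p) + x * g (t p))) ^ 2 = ∑ p ∈ s, (y p - f (t p)) ^ 2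
        - 2 * x * ∑ p ∈ s, (y p - f (t p)) * g (t p) + x ^ 2 * ∑ p ∈ s, g (t p) ^ 2 := by
      rw [Finset.mul_sum, Finset.mul_sum, ← Finset.sum_sub_distrib, ← Finset.sum_add_distrib]
      exact Finset.sum_congr rfl fun p _ => by ring
    rw [e] at h
    have e2 : 1 / M = 2 * (1 / (2 * M)) := by field_simp
    rw [e2]
    nlinarith
  have hd := discrim_le_zero hq
  unfold discrim at hd
  simp only [mul_zero, sub_zero] at hd
  have h0 := pow_eq_zero_iff two_ne_zero |>.1 (le_antisymm hd (sq_nonneg _))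
  have : lam * roughness m f g = 1 / M * ∑ p ∈ s, (y p - f (t p)) * g (t p) := by linarith
  rw [this]; field_simp

namespace IsEigensystem

variable {m : ℕ} {ν : Measure ℝ} {e : ℕ → ℝ → ℝ} {γ : ℕ → ℝ} {B a : ℝ} {v₀ : ℕ}
  (E : IsEigensystem m ν e γ B a v₀)
include E

/-- If the empirical Gram matrix of the eigenfunctions is close to the identity, the empirical
squared norm dominates `V` up to half of the squared norm with parameter `lam`. -/
lemma sum_sq_ge_of_gram {ι : Type*} {s : Finset ι} {t : ι → ℝ}
    (ht : ∀ p ∈ s, t p ∈ Set.Icc (0 : ℝ) 1) {M lam : ℝ} (hM : 0 ≤ M) (hlam : 0 ≤ lam)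
    {δ : ℝ → ℝ} (hδ : MemSobolev m δ)
    (hA : ∀ k, ∑ q ∈ Finset.range k ×ˢ Finset.range k,
      (∑ p ∈ s, e q.1 (t p) * e q.2 (t p) - M * if q.1 = q.2 then 1 else 0) ^ 2 /
        ((1 + lam * γ q.1) * (1 + lam * γ q.2)) ≤ M ^ 2 / 4) :
    M * designForm ν δ δ - M / 2 * rkhsInner m ν lam δ δ ≤ ∑ p ∈ s, δ (t p) ^ 2 := by
  set d : ℕ → ℝ := fun v => designForm ν δ (e v) with hd
  have hw : ∀ v, 0 < 1 + lam * γ v := fun v => by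
    have := mul_nonneg hlam (E.gamma_nonneg v); linarith
  have hD := E.hasSum_rkhsInner hδ lam
  set D := rkhsInner m ν lam δ δ with hDdef
  have hlim : Tendsto (fun k => ∑ p ∈ s, (∑ v ∈ Finset.range k, d v * e v (t p)) ^ 2) atTop
      (𝓝 (∑ p ∈ s, δ (t p) ^ 2)) :=
    tendsto_finsetSum _ fun p hp => ((E.hasSum_apply hδ (ht p hp)).tendsto_sum_nat).pow 2
  have hlim2 : Tendsto (fun k => M * ∑ v ∈ Finset.range k, d v ^ 2 - M / 2 * D) atTop
      (𝓝 (M * designForm ν δ δ - M / 2 * D)) :=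
    ((E.hasSum_designForm hδ).tendsto_sum_nat.const_mul M).sub_const _
  refine le_of_tendsto_of_tendsto' hlim2 hlim fun k => ?_
  set A : ℕ × ℕ → ℝ := fun q => ∑ p ∈ s, e q.1 (t p) * e q.2 (t p) -
    M * if q.1 = q.2 then 1 else 0 with hAdef
  have hexp : ∑ p ∈ s, (∑ v ∈ Finset.range k, d v * e v (t p)) ^ 2 =
      M * ∑ v ∈ Finset.range k, d v ^ 2 +
        ∑ q ∈ Finset.range k ×ˢ Finset.range k, d q.1 * d q.2 * A q := by
    have h1 : ∀ p, (∑ v ∈ Finset.range k, d v * e v (t p)) ^ 2 =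
        ∑ q ∈ Finset.range k ×ˢ Finset.range k,
          d q.1 * d q.2 * (e q.1 (t p) * e q.2 (t p)) := by
      intro p
      rw [sq, Finset.sum_mul_sum, Finset.sum_product]
      exact Finset.sum_congr rfl fun u _ => Finset.sum_congr rfl fun v _ => by ring
    simp_rw [h1]
    rw [Finset.sum_comm]
    simp_rw [← Finset.mul_sum, hAdef, mul_sub, Finset.sum_sub_distrib]
    have h2 : ∑ q ∈ Finset.range k ×ˢ Finset.range k,
        d q.1 * d q.2 * (M * if q.1 = q.2 then (1 : ℝ) else 0) =
        M * ∑ v ∈ Finset.range k, d v ^ 2 := by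
      rw [Finset.sum_product, Finset.mul_sum]
      refine Finset.sum_congr rfl fun u hu => ?_
      simp only [mul_ite, mul_one, mul_zero, Finset.sum_ite_eq, hu, if_true]
      ring
    rw [h2]; ring
  rw [hexp]
  set Dk := ∑ v ∈ Finset.range k, (1 + lam * γ v) * d v ^ 2 with hDk
  have hDk0 : 0 ≤ Dk := Finset.sum_nonneg fun v _ => mul_nonneg (hw v).le (sq_nonneg _)
  have hDkD : Dk ≤ D := sum_le_hasSum _ (fun v _ => mul_nonneg (hw v).le (sq_nonneg _)) hD
  have hCS : (∑ q ∈ Finset.range k ×ˢ Finset.range k, d q.1 * d q.2 * A q) ^ 2 ≤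
      Dk ^ 2 * (M ^ 2 / 4) := by
    have h1 := Finset.sum_sq_le_sum_mul_sum_of_sq_le_mul (Finset.range k ×ˢ Finset.range k)
      (r := fun q => d q.1 * d q.2 * A q)
      (f := fun q => ((1 + lam * γ q.1) * d q.1 ^ 2) * ((1 + lam * γ q.2) * d q.2 ^ 2))
      (g := fun q => A q ^ 2 / ((1 + lam * γ q.1) * (1 + lam * γ q.2)))
      (fun q _ => mul_nonneg (mul_nonneg (hw _).le (sq_nonneg _))
        (mul_nonneg (hw _).le (sq_nonneg _)))
      (fun q _ => div_nonneg (sq_nonneg _) (mul_nonneg (hw _).le (hw _).le))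
      (fun q _ => by
        have := (hw q.1).ne'
        have := (hw q.2).ne'
        refine le_of_eq ?_
        field_simp)
    refine h1.trans ?_
    have h2 : ∑ q ∈ Finset.range k ×ˢ Finset.range k,
        ((1 + lam * γ q.1) * d q.1 ^ 2) * ((1 + lam * γ q.2) * d q.2 ^ 2) = Dk ^ 2 := by
      rw [hDk, sq, Finset.sum_mul_sum, Finset.sum_product]
    rw [h2]
    exact mul_le_mul_of_nonneg_left (hA k) (sq_nonneg _)
  have habs : |∑ q ∈ Finset.range k ×ˢ Finset.range k, d q.1 * d q.2 * A q| ≤ Dk * (M / 2) := by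
    refine abs_le_of_sq_le_sq ?_ (by positivity)
    calc _ ≤ _ := hCS
      _ = (Dk * (M / 2)) ^ 2 := by ring
  have h3 := (abs_le.1 habs).1
  have h4 : Dk * (M / 2) ≤ M / 2 * D := by nlinarith
  linarith

/-- The noise term is bounded by the norm of its Riesz representer. -/
lemma sum_mul_le_of_noise {ι : Type*} {s : Finset ι} {t z : ι → ℝ}
    (ht : ∀ p ∈ s, t p ∈ Set.Icc (0 : ℝ) 1) {R lam : ℝ} (hR : 0 ≤ R) (hlam : 0 ≤ lam)
    {δ : ℝ → ℝ} (hδ : MemSobolev m δ)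
    (hU : ∀ k, ∑ v ∈ Finset.range k, (∑ p ∈ s, z p * e v (t p)) ^ 2 / (1 + lam * γ v) ≤ R ^ 2) :
    ∑ p ∈ s, z p * δ (t p) ≤ R * rkhsNorm m ν lam δ := by
  set d : ℕ → ℝ := fun v => designForm ν δ (e v) with hd
  have hw : ∀ v, 0 < 1 + lam * γ v := fun v => by
    have := mul_nonneg hlam (E.gamma_nonneg v); linarith
  have hD := E.hasSum_rkhsInner hδ lam
  unfold rkhsNorm
  set D := rkhsInner m ν lam δ δ with hDdef
  have hD0 : 0 ≤ D := hD.nonneg fun v => mul_nonneg (hw v).le (sq_nonneg _)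
  have hlim : Tendsto (fun k => ∑ p ∈ s, z p * ∑ v ∈ Finset.range k, d v * e v (t p)) atTop
      (𝓝 (∑ p ∈ s, z p * δ (t p))) :=
    tendsto_finsetSum _ fun p hp => ((E.hasSum_apply hδ (ht p hp)).tendsto_sum_nat).const_mul _
  refine le_of_tendsto' hlim fun k => ?_
  have hexp : ∑ p ∈ s, z p * ∑ v ∈ Finset.range k, d v * e v (t p) =
      ∑ v ∈ Finset.range k, d v * ∑ p ∈ s, z p * e v (t p) := by
    simp_rw [Finset.mul_sum]
    rw [Finset.sum_comm]
    exact Finset.sum_congr rfl fun u _ => Finset.sum_congr rfl fun v _ => by ring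
  rw [hexp]
  refine (le_abs_self _).trans (abs_le_of_sq_le_sq ?_ (by positivity))
  have h1 := Finset.sum_sq_le_sum_mul_sum_of_sq_le_mul (Finset.range k)
    (r := fun v => d v * ∑ p ∈ s, z p * e v (t p))
    (f := fun v => (1 + lam * γ v) * d v ^ 2)
    (g := fun v => (∑ p ∈ s, z p * e v (t p)) ^ 2 / (1 + lam * γ v))
    (fun v _ => mul_nonneg (hw v).le (sq_nonneg _))
    (fun v _ => div_nonneg (sq_nonneg _) (hw v).le)
    (fun v _ => by
      have := (hw v).ne'
      refine le_of_eq ?_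
      field_simp)
  rw [mul_pow, Real.sq_sqrt hD0, mul_comm (R ^ 2)]
  refine h1.trans (mul_le_mul ?_ (hU k) ?_ hD0)
  · exact sum_le_hasSum _ (fun v _ => mul_nonneg (hw v).le (sq_nonneg _)) hD
  · exact Finset.sum_nonneg fun v _ => div_nonneg (sq_nonneg _) (hw v).le

/-- The deterministic error bound: on the event that the empirical Gram matrix is close to the
identity, the error of a smoothing spline is at most twice the sum of the noise `r` and the bias
`(lam J(μ, μ))^(1/2)`. -/
lemma rkhsNorm_sub_le {ι : Type*} {s : Finset ι} {t y : ι → ℝ}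
    (ht : ∀ p ∈ s, t p ∈ Set.Icc (0 : ℝ) 1) {M r lam : ℝ} (hM : 0 < M) (hr : 0 ≤ r)
    (hlam : 0 ≤ lam) {f μ : ℝ → ℝ} (hf : MemSobolev m f) (hμ : MemSobolev m μ)
    (hmin : ∀ k, MemSobolev m k →
      1 / (2 * M) * ∑ p ∈ s, (y p - f (t p)) ^ 2 + lam / 2 * roughness m f f ≤
      1 / (2 * M) * ∑ p ∈ s, (y p - k (t p)) ^ 2 + lam / 2 * roughness m k k)
    (hA : ∀ k, ∑ q ∈ Finset.range k ×ˢ Finset.range k,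
      (∑ p ∈ s, e q.1 (t p) * e q.2 (t p) - M * if q.1 = q.2 then 1 else 0) ^ 2 /
        ((1 + lam * γ q.1) * (1 + lam * γ q.2)) ≤ M ^ 2 / 4)
    (hU : ∀ k, ∑ v ∈ Finset.range k,
      (∑ p ∈ s, (y p - μ (t p)) * e v (t p)) ^ 2 / (1 + lam * γ v) ≤ (M * r) ^ 2) :
    rkhsNorm m ν lam (fun t => f t - μ t) ≤ 2 * (r + Real.sqrt (lam * roughness m μ μ)) := by
  have hδ : MemSobolev m (fun t => f t - μ t) := hf.sub hμ
  have hnorm := sum_residual_mul_eq_of_minimizer hM hf hδ hmin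
  have h1 := E.sum_sq_ge_of_gram ht hM.le hlam hδ hA
  have h2 := E.sum_mul_le_of_noise (z := fun p => y p - μ (t p)) ht (by positivity) hlam hδ hU
  set δ : ℝ → ℝ := fun t => f t - μ t with hδdef
  set x := rkhsNorm m ν lam δ with hx
  have hx0 : 0 ≤ x := Real.sqrt_nonneg _
  have hJ0 := roughness_self_nonneg m δ
  have hJμ := roughness_self_nonneg m μ
  have hV0 := designForm_self_nonneg ν δ
  have hD : rkhsInner m ν lam δ δ = x ^ 2 := by
    rw [hx, rkhsNorm, Real.sq_sqrt]
    exact add_nonneg hV0 (mul_nonneg hlam hJ0)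
  have hDdef : rkhsInner m ν lam δ δ = designForm ν δ δ + lam * roughness m δ δ := rfl
  have hlin : roughness m f δ = roughness m δ δ + roughness m μ δ := by
    have := hδ.roughness_linComb_left hμ hδ 1 1
    simp only [one_mul] at this
    rw [← this]
    congr 1; funext u; simp [hδdef]
  have hsplit : ∑ p ∈ s, (y p - f (t p)) * δ (t p) =
      ∑ p ∈ s, (y p - μ (t p)) * δ (t p) - ∑ p ∈ s, δ (t p) ^ 2 := by
    rw [← Finset.sum_sub_distrib]
    exact Finset.sum_congr rfl fun p _ => by simp only [hδdef]; ring
  have hbias : -(lam * roughness m μ δ) ≤ Real.sqrt (lam * roughness m μ μ) * x := by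
    refine (neg_le_abs _).trans (abs_le_of_sq_le_sq ?_ (by positivity))
    rw [mul_pow (Real.sqrt _) x, Real.sq_sqrt (by positivity), ← hD, hDdef]
    have h3 := hμ.roughness_sq_le hδ
    calc (lam * roughness m μ δ) ^ 2 = lam ^ 2 * roughness m μ δ ^ 2 := by ring
      _ ≤ lam ^ 2 * (roughness m μ μ * roughness m δ δ) := by gcongr
      _ = lam * roughness m μ μ * (lam * roughness m δ δ) := by ring
      _ ≤ lam * roughness m μ μ * (designForm ν δ δ + lam * roughness m δ δ) := by
        gcongr; linarith
  replace hnorm := hsplit.symm.trans hnorm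
  rw [hlin] at hnorm
  rw [hD] at h1
  set b := Real.sqrt (lam * roughness m μ μ) with hb
  have hkey : M * (x * x) ≤ M * (2 * (r + b) * x) := by
    have h5 : M * (-(lam * roughness m μ δ)) ≤ M * (b * x) := by gcongr
    have h6 : M * x ^ 2 = M * designForm ν δ δ + M * (lam * roughness m δ δ) := by
      rw [← hD, hDdef]; ring
    nlinarith
  have hkey2 := le_of_mul_le_mul_left hkey hM
  rcases hx0.eq_or_lt with h0 | h0
  · rw [← h0]; positivity
  · exact le_of_mul_le_mul_right hkey2 h0

end IsEigensystem

/-! ### Second moments of sums with a random number of terms -/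

/-- Second moment of a sum over `n` subjects with random numbers `N i` of terms, independent of the
terms. Terms of different subjects are uncorrelated; nothing is assumed about terms of the same
subject, for which the Cauchy-Schwarz inequality is used. -/
lemma lintegral_sq_randomSum_le {Ω : Type*} [MeasurableSpace Ω] {P : Measure Ω}
    [IsProbabilityMeasure P] {W : ℕ → ℕ → Ω → ℝ} {N : ℕ → Ω → ℕ} (hW : ∀ i j, Measurable (W i j))
    (hN : ∀ i, Measurable (N i))
    (hind : IndepFun (fun ω (p : ℕ × ℕ) => W p.1 p.2 ω) (fun ω (i : ℕ) => N i ω) P)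
    (hL2 : ∀ i j, MemLp (W i j) 2 P) {σ : ℝ} (hσ : ∀ i j, ∫ ω, W i j ω ^ 2 ∂P ≤ σ)
    (horth : ∀ i i', i ≠ i' → ∀ j j', ∫ ω, W i j ω * W i' j' ω ∂P = 0)
    {κ : ENNReal} (hκ : ∀ i, ∫⁻ ω, (N i ω : ENNReal) ^ 2 ∂P ≤ κ) (n : ℕ) :
    ∫⁻ ω, ENNReal.ofReal ((∑ i ∈ Finset.range n, ∑ j ∈ Finset.range (N i ω), W i j ω) ^ 2) ∂P ≤
      n * κ * ENNReal.ofReal σ := by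
  have hWm : Measurable (fun ω (p : ℕ × ℕ) => W p.1 p.2 ω) :=
    measurable_pi_lambda _ fun p => hW p.1 p.2
  have hNm : Measurable (fun ω (i : ℕ) => N i ω) := measurable_pi_lambda _ hN
  let F : (ℕ × ℕ → ℝ) × (ℕ → ℕ) → ENNReal := fun z =>
    ENNReal.ofReal ((∑ i ∈ Finset.range n, ∑ j ∈ Finset.range (z.2 i), z.1 (i, j)) ^ 2)
  have hF : Measurable F := by
    refine ENNReal.measurable_ofReal.comp (Measurable.pow_const ?_ 2)
    refine Finset.measurable_fun_sum _ fun i _ => ?_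
    have h1 : Measurable (fun z : (ℕ × ℕ → ℝ) × ℕ => ∑ j ∈ Finset.range z.2, z.1 (i, j)) :=
      measurable_from_prod_countable_left fun k =>
        Finset.measurable_fun_sum (Finset.range k) fun j _ =>
          measurable_pi_apply ((i, j) : ℕ × ℕ)
    exact h1.comp (measurable_fst.prodMk ((measurable_pi_apply i).comp measurable_snd))
  have hσ0 : 0 ≤ σ := (integral_nonneg fun ω => sq_nonneg _).trans (hσ 0 0)
  have hint : ∀ i j i' j', Integrable (fun ω => W i j ω * W i' j' ω) P := fun i j i' j' =>
    (hL2 i j).integrable_mul (hL2 i' j')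
  -- the second moment for given numbers of terms
  have hfix : ∀ k : ℕ → ℕ, ∫⁻ ω, F (fun p => W p.1 p.2 ω, k) ∂P ≤
      (∑ i ∈ Finset.range n, (k i : ENNReal) ^ 2) * ENNReal.ofReal σ := by
    intro k
    set S : ℕ → Ω → ℝ := fun i ω => ∑ j ∈ Finset.range (k i), W i j ω with hS
    have hSS : ∀ i i', Integrable (fun ω => S i ω * S i' ω) P := fun i i' => by
      simp only [hS, Finset.sum_mul_sum]
      exact integrable_finsetSum _ fun j _ => integrable_finsetSum _ fun j' _ => hint _ _ _ _
    have hoff : ∀ i i', i ≠ i' → ∫ ω, S i ω * S i' ω ∂P = 0 := fun i i' hne => by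
      simp only [hS, Finset.sum_mul_sum]
      rw [integral_finsetSum _ fun j _ => integrable_finsetSum _ fun j' _ => hint _ _ _ _]
      refine Finset.sum_eq_zero fun j _ => ?_
      rw [integral_finsetSum _ fun j' _ => hint _ _ _ _]
      exact Finset.sum_eq_zero fun j' _ => horth i i' hne j j'
    have hdiag : ∀ i, ∫ ω, S i ω * S i ω ∂P ≤ (k i : ℝ) ^ 2 * σ := fun i => by
      have hsq : ∀ j, Integrable (fun ω => W i j ω ^ 2) P := fun j => (hL2 i j).integrable_sq
      calc ∫ ω, S i ω * S i ω ∂P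
          ≤ ∫ ω, (k i : ℝ) * ∑ j ∈ Finset.range (k i), W i j ω ^ 2 ∂P := by
            refine integral_mono (hSS i i)
              ((integrable_finsetSum _ fun j _ => hsq j).const_mul _) fun ω => ?_
            simp only [hS]
            rw [← sq]
            simpa using sq_sum_le_card_mul_sum_sq (s := Finset.range (k i))
              (f := fun j => W i j ω)
        _ = (k i : ℝ) * ∑ j ∈ Finset.range (k i), ∫ ω, W i j ω ^ 2 ∂P := by
            rw [integral_const_mul, integral_finsetSum _ fun j _ => hsq j]
        _ ≤ (k i : ℝ) * ∑ j ∈ Finset.range (k i), σ := by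
            gcongr; exact hσ _ _
        _ = (k i : ℝ) ^ 2 * σ := by simp; ring
    have hsum : ∀ ω, (∑ i ∈ Finset.range n, S i ω) ^ 2 =
        ∑ i ∈ Finset.range n, ∑ i' ∈ Finset.range n, S i ω * S i' ω := fun ω => by
      rw [sq, Finset.sum_mul_sum]
    have hI : Integrable (fun ω => (∑ i ∈ Finset.range n, S i ω) ^ 2) P := by
      simp_rw [hsum]
      exact integrable_finsetSum _ fun j _ => integrable_finsetSum _ fun j' _ => hSS _ _
    have hle : ∫ ω, (∑ i ∈ Finset.range n, S i ω) ^ 2 ∂P ≤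
        (∑ i ∈ Finset.range n, (k i : ℝ) ^ 2) * σ := by
      simp_rw [hsum]
      rw [integral_finsetSum _ fun i _ => integrable_finsetSum _ fun i' _ => hSS _ _,
        Finset.sum_mul]
      refine Finset.sum_le_sum fun i hi => ?_
      rw [integral_finsetSum _ fun i' _ => hSS _ _, Finset.sum_eq_single i]
      · exact hdiag i
      · exact fun i' _ hne => hoff i i' (Ne.symm hne)
      · exact fun h => absurd hi h
    change ∫⁻ ω, ENNReal.ofReal ((∑ i ∈ Finset.range n, S i ω) ^ 2) ∂P ≤ _
    rw [← ofReal_integral_eq_lintegral_ofReal hI (ae_of_all _ fun ω => sq_nonneg _)]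
    refine (ENNReal.ofReal_le_ofReal hle).trans (le_of_eq ?_)
    rw [ENNReal.ofReal_mul (by positivity), ENNReal.ofReal_sum_of_nonneg fun i _ => by positivity]
    congr 1
    refine Finset.sum_congr rfl fun i _ => ?_
    rw [ENNReal.ofReal_pow (by positivity), ENNReal.ofReal_natCast]
  calc ∫⁻ ω, ENNReal.ofReal
        ((∑ i ∈ Finset.range n, ∑ j ∈ Finset.range (N i ω), W i j ω) ^ 2) ∂P
      = ∫⁻ z, F z ∂(P.map fun ω => ((fun p : ℕ × ℕ => W p.1 p.2 ω), fun i : ℕ => N i ω)) := by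
        rw [lintegral_map hF (hWm.prodMk hNm)]
    _ = ∫⁻ k, ∫⁻ w, F (w, k) ∂(P.map fun ω (p : ℕ × ℕ) => W p.1 p.2 ω)
          ∂(P.map fun ω (i : ℕ) => N i ω) := by
        have := Measure.isProbabilityMeasure_map (μ := P) hWm.aemeasurable
        have := Measure.isProbabilityMeasure_map (μ := P) hNm.aemeasurable
        rw [hind.map_prod_eq_prod_map_map hWm.aemeasurable hNm.aemeasurable,
          lintegral_prod_symm' _ hF]
    _ ≤ ∫⁻ k, (∑ i ∈ Finset.range n, ((k i : ℕ) : ENNReal) ^ 2) * ENNReal.ofReal σ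
          ∂(P.map fun ω (i : ℕ) => N i ω) := by
        refine lintegral_mono fun k => ?_
        have hFk : Measurable fun w => F (w, k) := hF.comp (measurable_id.prodMk measurable_const)
        rw [lintegral_map hFk hWm]
        exact hfix k
    _ = (∑ i ∈ Finset.range n, ∫⁻ ω, (N i ω : ENNReal) ^ 2 ∂P) * ENNReal.ofReal σ := by
        have hm : ∀ i : ℕ, Measurable fun k : ℕ → ℕ => ((k i : ℕ) : ENNReal) ^ 2 := fun i =>
          (Measurable.of_discrete (f := fun k : ℕ => (k : ENNReal) ^ 2)).comp
            (measurable_pi_apply i)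
        rw [lintegral_mul_const _ (Finset.measurable_fun_sum _ fun i _ => hm i),
          lintegral_finsetSum _ fun i _ => hm i]
        congr 1
        exact Finset.sum_congr rfl fun i _ => lintegral_map (hm i) hNm
    _ ≤ n * κ * ENNReal.ofReal σ := by
        gcongr
        refine (Finset.sum_le_sum fun i _ => hκ i).trans ?_
        simp

/-! ### Consequences of the sampling model -/

/-- Pairs built from two independent pairs, across which there is independence too. -/
lemma IndepFun.prodMk_prodMk_comm {Ω α α' β β' : Type*} [MeasurableSpace Ω] [MeasurableSpace α]
    [MeasurableSpace α'] [MeasurableSpace β] [MeasurableSpace β'] {P : Measure Ω}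
    [IsProbabilityMeasure P]
    {a : Ω → α} {a' : Ω → α'} {b : Ω → β} {b' : Ω → β'} (ha : Measurable a) (ha' : Measurable a')
    (hb : Measurable b) (hb' : Measurable b') (h1 : IndepFun a a' P) (h2 : IndepFun b b' P)
    (h : IndepFun (fun ω => (a ω, a' ω)) (fun ω => (b ω, b' ω)) P) :
    IndepFun (fun ω => (a ω, b ω)) (fun ω => (a' ω, b' ω)) P := by
  have hab : IndepFun a b P := h.comp measurable_fst measurable_fst
  have hab' : IndepFun a' b' P := h.comp measurable_snd measurable_snd
  rw [IndepFun_iff_Indep]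
  refine IndepSets.indep (ha.prodMk hb).comap_le (ha'.prodMk hb').comap_le
    ((isPiSystem_prod (α := α) (β := β)).comap fun ω => (a ω, b ω))
    ((isPiSystem_prod (α := α') (β := β')).comap fun ω => (a' ω, b' ω)) ?_ ?_ ?_
  · rw [← generateFrom_prod, MeasurableSpace.comap_generateFrom]; rfl
  · rw [← generateFrom_prod, MeasurableSpace.comap_generateFrom]; rfl
  · rw [IndepSets_iff]
    rintro _ _ ⟨_, ⟨s, hs, t, ht, rfl⟩, rfl⟩ ⟨_, ⟨s', hs', t', ht', rfl⟩, rfl⟩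
    have e1 : (fun ω => (a ω, b ω)) ⁻¹' (s ×ˢ t) ∩ (fun ω => (a' ω, b' ω)) ⁻¹' (s' ×ˢ t') =
        (fun ω => (a ω, a' ω)) ⁻¹' (s ×ˢ s') ∩ (fun ω => (b ω, b' ω)) ⁻¹' (t ×ˢ t') := by
      ext ω; simp only [Set.mem_inter_iff, Set.mem_preimage, Set.mem_prod]; tauto
    rw [e1, h.measure_inter_preimage_eq_mul _ _ (hs.prod hs') (ht.prod ht'),
      show (fun ω => (a ω, a' ω)) ⁻¹' (s ×ˢ s') = a ⁻¹' s ∩ a' ⁻¹' s' from rfl,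
      show (fun ω => (b ω, b' ω)) ⁻¹' (t ×ˢ t') = b ⁻¹' t ∩ b' ⁻¹' t' from rfl,
      h1.measure_inter_preimage_eq_mul _ _ hs hs', h2.measure_inter_preimage_eq_mul _ _ ht ht',
      show (fun ω => (a ω, b ω)) ⁻¹' (s ×ˢ t) = a ⁻¹' s ∩ b ⁻¹' t from rfl,
      show (fun ω => (a' ω, b' ω)) ⁻¹' (s' ×ˢ t') = a' ⁻¹' s' ∩ b' ⁻¹' t' from rfl,
      hab.measure_inter_preimage_eq_mul _ _ hs ht, hab'.measure_inter_preimage_eq_mul _ _ hs' ht']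
    ring

/-- A jointly measurable evaluation of a function `x` on `[0,1]` at `t`: the upper limit of the
values of `x` at the grid points `⌊t k⌋ / k`. Evaluation itself is not measurable for the product
σ-algebra, but the two agree for continuous `x`. -/
def pathEval (x : Set.Icc (0 : ℝ) 1 → ℝ) (t : ℝ) : ℝ :=
  limsup (fun k : ℕ => x (Set.projIcc 0 1 zero_le_one ((⌊t * k⌋₊ : ℝ) / k))) atTop

lemma measurable_pathEval :
    Measurable fun z : (Set.Icc (0 : ℝ) 1 → ℝ) × ℝ => pathEval z.1 z.2 := by
  refine Measurable.limsup fun k => ?_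
  have h1 : Measurable (fun z : (Set.Icc (0 : ℝ) 1 → ℝ) × ℕ =>
      z.1 (Set.projIcc 0 1 zero_le_one ((z.2 : ℝ) / k))) :=
    measurable_from_prod_countable_left fun j =>
      measurable_pi_apply (Set.projIcc (0 : ℝ) 1 zero_le_one ((j : ℝ) / k))
  exact h1.comp (measurable_fst.prodMk (Nat.measurable_floor.comp (measurable_snd.mul_const _)))

lemma pathEval_eq {f : ℝ → ℝ} (hf : ContinuousOn f (Set.Icc 0 1)) {t : ℝ}
    (ht : t ∈ Set.Icc (0 : ℝ) 1) : pathEval ((Set.Icc (0 : ℝ) 1).domRestrict f) t = f t := by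
  refine Tendsto.limsup_eq ?_
  have h1 : Tendsto (fun k : ℕ => (⌊t * k⌋₊ : ℝ) / k) atTop (𝓝 t) :=
    (tendsto_nat_floor_mul_div_atTop ht.1).comp tendsto_natCast_atTop_atTop
  have h2 := (continuous_projIcc (h := zero_le_one (α := ℝ))).continuousAt.tendsto.comp h1
  rw [Set.projIcc_of_mem zero_le_one ht] at h2
  exact ((continuousOn_iff_continuous_domRestrict.1 hf).tendsto _).comp h2

attribute [irreducible] pathEval

lemma Measurable.pathEval {Ω : Type*} [MeasurableSpace Ω] {x : Ω → Set.Icc (0 : ℝ) 1 → ℝ}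
    {t : Ω → ℝ} (hx : Measurable x) (ht : Measurable t) :
    Measurable fun ω => _root_.pathEval (x ω) (t ω) :=
  Measurable.comp (g := fun z : (Set.Icc (0 : ℝ) 1 → ℝ) × ℝ => _root_.pathEval z.1 z.2)
    measurable_pathEval (hx.prodMk ht)

namespace SamplingModel

variable {Ω : Type*} [MeasurableSpace Ω] {P : Measure Ω}
  {X : ℕ → Ω → ℝ → ℝ} {T ε : ℕ → ℕ → Ω → ℝ} {N : ℕ → Ω → ℕ} {μ : ℝ → ℝ}

/-- What is observed at the `j`-th measurement of the `i`-th subject: the path, the design point and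
the measurement error. -/
def triple (X : ℕ → Ω → ℝ → ℝ) (T ε : ℕ → ℕ → Ω → ℝ) (i j : ℕ) (ω : Ω) :
    ((Set.Icc (0 : ℝ) 1 → ℝ) × ℝ) × ℝ :=
  (((Set.Icc (0 : ℝ) 1).domRestrict (X i ω), T i j ω), ε i j ω)

variable (h : SamplingModel P X T ε N μ)
include h

lemma measurable_path (i : ℕ) : Measurable fun ω => (Set.Icc (0 : ℝ) 1).domRestrict (X i ω) :=
  measurable_pi_lambda _ fun t => h.measurable_X i t t.2

lemma measurable_triple (i j : ℕ) : Measurable (triple X T ε i j) :=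
  ((h.measurable_path i).prodMk (h.measurable_T i j)).prodMk (h.measurable_ε i j)

lemma indepFun_path_T (i j : ℕ) :
    IndepFun (fun ω => (Set.Icc (0 : ℝ) 1).domRestrict (X i ω)) (T i j) P :=
  h.indep_X_T.comp (measurable_pi_apply i) (measurable_pi_apply (i, j))

lemma indepFun_path_T_ε (i j : ℕ) :
    IndepFun (fun ω => ((Set.Icc (0 : ℝ) 1).domRestrict (X i ω), T i j ω)) (ε i j) P :=
  h.indep_XT_ε.comp (φ := fun z => (z.1 i, z.2 (i, j))) (by fun_prop)
    (measurable_pi_apply (i, j))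

lemma identDistrib_triple [IsProbabilityMeasure P] (i j : ℕ) :
    IdentDistrib (triple X T ε i j) (triple X T ε 0 0) P P :=
  ((h.ident_X i).prodMk (h.ident_T i j) (h.indepFun_path_T i j)
    (h.indepFun_path_T 0 0)).prodMk (h.ident_ε i j) (h.indepFun_path_T_ε i j)
      (h.indepFun_path_T_ε 0 0)

lemma indepFun_triple [IsProbabilityMeasure P] {i i' : ℕ} (hi : i ≠ i') (j j' : ℕ) :
    IndepFun (triple X T ε i j) (triple X T ε i' j') P := by
  have hp : ((i, j) : ℕ × ℕ) ≠ (i', j') := fun hh => hi (congrArg Prod.fst hh)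
  have hX := h.iIndep_X.indepFun hi
  have hT := h.iIndep_T.indepFun hp
  have hε := h.iIndep_ε.indepFun hp
  have h1 := IndepFun.prodMk_prodMk_comm (h.measurable_path i) (h.measurable_path i')
    (h.measurable_T i j) (h.measurable_T i' j') hX hT
    (h.indep_X_T.comp (φ := fun z => (z i, z i')) (ψ := fun z => (z (i, j), z (i', j')))
      (by fun_prop) (by fun_prop))
  exact IndepFun.prodMk_prodMk_comm ((h.measurable_path i).prodMk (h.measurable_T i j))
    ((h.measurable_path i').prodMk (h.measurable_T i' j')) (h.measurable_ε i j)
    (h.measurable_ε i' j') h1 hε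
    (h.indep_XT_ε.comp
      (φ := fun z => ((z.1 i, z.2 (i, j)), (z.1 i', z.2 (i', j'))))
      (ψ := fun z => (z (i, j), z (i', j'))) (by fun_prop) (by fun_prop))

/-- Second moments of random sums of a centred function of the observed triples. -/
lemma lintegral_sq_sum_le [IsProbabilityMeasure P]
    {Φ : ((Set.Icc (0 : ℝ) 1 → ℝ) × ℝ) × ℝ → ℝ} (hΦ : Measurable Φ)
    (hL2 : MemLp (fun ω => Φ (triple X T ε 0 0 ω)) 2 P)
    (hzero : ∫ ω, Φ (triple X T ε 0 0 ω) ∂P = 0)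
    {σ : ℝ} (hσ : ∫ ω, Φ (triple X T ε 0 0 ω) ^ 2 ∂P ≤ σ) (n : ℕ) :
    ∫⁻ ω, ENNReal.ofReal ((∑ i ∈ Finset.range n, ∑ j ∈ Finset.range (N i ω),
      Φ (triple X T ε i j ω)) ^ 2) ∂P ≤
      n * (∫⁻ ω, (N 0 ω : ENNReal) ^ 2 ∂P) * ENNReal.ofReal σ := by
  have hid : ∀ i j, IdentDistrib (fun ω => Φ (triple X T ε i j ω))
      (fun ω => Φ (triple X T ε 0 0 ω)) P P := fun i j => (h.identDistrib_triple i j).comp hΦ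
  have hmean : ∀ i j, ∫ ω, Φ (triple X T ε i j ω) ∂P = 0 := fun i j =>
    ((hid i j).integral_eq).trans hzero
  refine lintegral_sq_randomSum_le (W := fun i j ω => Φ (triple X T ε i j ω))
    (fun i j => hΦ.comp (h.measurable_triple i j)) h.measurable_N ?_
    (fun i j => (hid i j).memLp_iff.2 hL2)
    (fun i j => ((hid i j).sq.integral_eq).trans_le hσ) ?_ ?_ n
  · exact h.indep_XTε_N.comp
      (φ := fun z (p : ℕ × ℕ) => Φ ((z.1 p.1, z.2.1 p), z.2.2 p))
      (ψ := fun z => z)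
      (measurable_pi_lambda _ fun p => hΦ.comp (by fun_prop)) measurable_id
  · intro i i' hi j j'
    refine (((h.indepFun_triple hi j j').comp hΦ hΦ).integral_fun_mul_eq_mul_integral
      (hΦ.comp (h.measurable_triple i j)).aestronglyMeasurable
      (hΦ.comp (h.measurable_triple i' j')).aestronglyMeasurable).trans ?_
    simp only [Function.comp_def]
    rw [hmean, zero_mul]
  · intro i
    refine le_of_eq (IdentDistrib.lintegral_eq ?_)
    exact (h.ident_N i).comp (u := fun k : ℕ => (k : ENNReal) ^ 2) Measurable.of_discrete

end SamplingModel

/-! ### Moments of the sample paths and regularity of the mean function -/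

lemma norm_toLp_sq_eq_integral {α : Type*} [MeasurableSpace α] {ρ : Measure α} {f : α → ℝ}
    (hf : MemLp f 2 ρ) : ‖hf.toLp f‖ ^ 2 = ∫ t, f t * f t ∂ρ := by
  rw [← real_inner_self_eq_norm_sq, L2.inner_def]
  refine integral_congr_ae ?_
  filter_upwards [hf.coeFn_toLp] with t ht
  rw [ht]; simp [sq]

/-- Completeness of the Sobolev space in terms of the form `J`. -/
lemma memSobolev_of_tendsto_of_roughness {m : ℕ} (hm : 1 ≤ m) {F : ℕ → ℝ → ℝ} {f : ℝ → ℝ}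
    (hF : ∀ k, MemSobolev m (F k))
    (hlim : ∀ t ∈ Set.Icc (0 : ℝ) 1, Tendsto (fun k => F k t) atTop (𝓝 (f t)))
    {s : ℕ → ℝ} (hs : CauchySeq s)
    (hJ : ∀ k l, roughness m (fun t => F k t - F l t) (fun t => F k t - F l t) ≤ |s k - s l|) :
    MemSobolev m f := by
  set u : ℕ → Lp ℝ 2 (volume.restrict (Set.Icc (0 : ℝ) 1)) := fun k => (hF k).2.2.toLp _ with hu
  have hdist : ∀ k l, ‖u k - u l‖ ^ 2 ≤ |s k - s l| := by
    intro k l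
    refine le_trans (le_of_eq ?_) (hJ k l)
    rw [hu]
    simp only
    rw [← MemLp.toLp_sub, norm_toLp_sq_eq_integral]
    unfold roughness
    refine integral_congr_ae ?_
    have h := (hF k).iteratedDerivWithin_linComb_ae (hF l) 1 (-1)
    simp only [one_mul, neg_mul, ← sub_eq_add_neg] at h
    filter_upwards [h] with t ht
    rw [ht]; simp
  have hc : CauchySeq u := by
    rw [Metric.cauchySeq_iff'] at hs ⊢
    intro ε hε
    obtain ⟨K, hK⟩ := hs (ε ^ 2) (by positivity)
    refine ⟨K, fun n hn => ?_⟩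
    have h1 := hK n hn
    rw [Real.dist_eq] at h1
    rw [dist_eq_norm]
    exact lt_of_pow_lt_pow_left₀ 2 hε.le ((hdist n K).trans_lt h1)
  obtain ⟨g, hg⟩ := cauchySeq_tendsto_of_complete hc
  refine memSobolev_of_tendsto hm hF hlim (Lp.memLp g) ?_
  have h2 := (Lp.tendsto_Lp_iff_tendsto_eLpNorm'' (fun k => iteratedDerivWithin m (F k)
    (Set.Icc 0 1)) (fun k => (hF k).2.2) g (Lp.memLp g)).1 (by simpa using hg)
  exact h2

lemma ContinuousOn.measurable_indicator_unitInterval {f : ℝ → ℝ}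
    (hf : ContinuousOn f (Set.Icc (0 : ℝ) 1)) : Measurable ((Set.Icc (0 : ℝ) 1).indicator f) := by
  classical
  rw [← Set.piecewise_eq_indicator]
  exact ContinuousOn.measurable_piecewise hf continuousOn_const measurableSet_Icc

namespace IsEigensystem

variable {m : ℕ} {ν : Measure ℝ} {e : ℕ → ℝ → ℝ} {γ : ℕ → ℝ} {B a : ℝ} {v₀ : ℕ}
  (E : IsEigensystem m ν e γ B a v₀)
include E

/-- A function whose coefficients are square summable against `1 + γ_v` lies in `H^m`. -/
lemma memSobolev_of_hasSum {c : ℕ → ℝ} {f : ℝ → ℝ} (hc : Summable fun v => γ v * c v ^ 2)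
    (hf : ∀ t ∈ Set.Icc (0 : ℝ) 1, HasSum (fun v => c v * e v t) (f t)) : MemSobolev m f := by
  refine memSobolev_of_tendsto_of_roughness E.one_le (fun k => MemSobolev.sum E.mem c
    (Finset.range k)) (fun t ht => (hf t ht).tendsto_sum_nat)
    hc.hasSum.tendsto_sum_nat.cauchySeq ?_
  have key : ∀ k l, l ≤ k → roughness m
      (fun t => ∑ v ∈ Finset.range k, c v * e v t - ∑ v ∈ Finset.range l, c v * e v t)
      (fun t => ∑ v ∈ Finset.range k, c v * e v t - ∑ v ∈ Finset.range l, c v * e v t) =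
      ∑ v ∈ Finset.range k, γ v * c v ^ 2 - ∑ v ∈ Finset.range l, γ v * c v ^ 2 := by
    intro k l hlk
    simp_rw [← Finset.sum_Ico_eq_sub _ hlk]
    rw [MemSobolev.roughness_sum_left E.mem (MemSobolev.sum E.mem _ _)]
    refine Finset.sum_congr rfl fun v hv => ?_
    rw [roughness_comm, MemSobolev.roughness_sum_left E.mem (E.mem v)]
    simp only [E.roughness_eq, mul_ite, mul_zero, Finset.sum_ite_eq', hv, if_true]
    ring
  intro k l
  rcases le_total l k with h | h
  · rw [key k l h]; exact le_abs_self _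
  · have e1 : (fun t => ∑ v ∈ Finset.range k, c v * e v t - ∑ v ∈ Finset.range l, c v * e v t) =
        fun t => -(∑ v ∈ Finset.range l, c v * e v t - ∑ v ∈ Finset.range k, c v * e v t) := by
      funext t; ring
    have hm1 : MemSobolev m (fun t => ∑ v ∈ Finset.range l, c v * e v t -
      ∑ v ∈ Finset.range k, c v * e v t) :=
      (MemSobolev.sum E.mem _ _).sub (MemSobolev.sum E.mem _ _)
    have h2 := MemSobolev.zero.roughness_add_smul_self hm1 (-1)
    have h3 : roughness m (fun _ => (0 : ℝ)) (fun _ => (0 : ℝ)) = 0 := by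
      simp [roughness, iteratedDerivWithin_fun_const_zero]
    have h4 : ∀ g, roughness m (fun _ => (0 : ℝ)) g = 0 := fun g => by
      simp [roughness, iteratedDerivWithin_fun_const_zero]
    simp only [zero_add, neg_mul, one_mul, h3, h4] at h2
    rw [e1, h2, key l k h, abs_sub_comm]
    simp [le_abs_self]

/-- The Sobolev inequality `f(t)² ≤ C (V(f, f) + J(f, f))`. -/
lemma sq_apply_le {f : ℝ → ℝ} (hf : MemSobolev m f) {t : ℝ} (ht : t ∈ Set.Icc (0 : ℝ) 1) :
    f t ^ 2 ≤ B ^ 2 * (∑' v, 1 / (1 + γ v)) * rkhsInner m ν 1 f f := by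
  have hw : ∀ v, 0 < 1 + γ v := fun v => by have := E.gamma_nonneg v; linarith
  have hQ := E.hasSum_rkhsInner hf 1
  simp only [one_mul] at hQ
  refine le_of_tendsto' ((E.hasSum_apply hf ht).tendsto_sum_nat.pow 2) fun k => ?_
  have h1 := Finset.sum_sq_le_sum_mul_sum_of_sq_le_mul (Finset.range k)
    (r := fun v => designForm ν f (e v) * e v t)
    (f := fun v => B ^ 2 * (1 / (1 + γ v)))
    (g := fun v => (1 + γ v) * designForm ν f (e v) ^ 2)
    (fun v _ => by have := hw v; positivity)
    (fun v _ => mul_nonneg (hw v).le (sq_nonneg _))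
    (fun v _ => by
      have h2 := (hw v).ne'
      have h3 : e v t ^ 2 ≤ B ^ 2 := sq_le_sq.2 ((E.bound v t ht).trans (le_abs_self B))
      calc (designForm ν f (e v) * e v t) ^ 2 = designForm ν f (e v) ^ 2 * e v t ^ 2 := by ring
        _ ≤ designForm ν f (e v) ^ 2 * B ^ 2 := by gcongr
        _ = B ^ 2 * (1 / (1 + γ v)) * ((1 + γ v) * designForm ν f (e v) ^ 2) := by field_simp)
  refine h1.trans (mul_le_mul ?_ ?_ ?_ ?_)
  · rw [← Finset.mul_sum]
    gcongr
    exact E.summable_inv.sum_le_tsum _ fun v _ => by have := hw v; positivity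
  · exact sum_le_hasSum _ (fun v _ => mul_nonneg (hw v).le (sq_nonneg _)) hQ
  · exact Finset.sum_nonneg fun v _ => mul_nonneg (hw v).le (sq_nonneg _)
  · exact mul_nonneg (sq_nonneg _) (tsum_nonneg fun v => by have := hw v; positivity)

lemma exists_one_le_gamma : ∃ v₁, ∀ v, v₁ ≤ v → 1 ≤ γ v := by
  have ha := E.pos
  refine ⟨max v₀ ⌈1 / a⌉₊, fun v hv => ?_⟩
  refine le_trans ?_ (E.growth v ((le_max_left _ _).trans hv))
  have h1 : 1 / a ≤ v := (Nat.le_ceil _).trans (by exact_mod_cast (le_max_right _ _).trans hv)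
  have h2 : (v : ℝ) + 1 ≤ ((v : ℝ) + 1) ^ (2 * m) :=
    le_self_pow₀ (by linarith [(Nat.cast_nonneg v : (0 : ℝ) ≤ v)])
      (by have := E.one_le; omega)
  rw [div_le_iff₀ ha] at h1
  nlinarith

/-- Without the first `v₁` terms of its expansion, `f(t)` is controlled by `J(f, f)` alone. -/
lemma sq_sub_sum_le {v₁ : ℕ} (hv₁ : ∀ v, v₁ ≤ v → 1 ≤ γ v) {f : ℝ → ℝ} (hf : MemSobolev m f)
    {t : ℝ} (ht : t ∈ Set.Icc (0 : ℝ) 1) :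
    (f t - ∑ v ∈ Finset.range v₁, designForm ν f (e v) * e v t) ^ 2 ≤
      2 * B ^ 2 * (∑' v, 1 / (1 + γ v)) * roughness m f f := by
  have hw : ∀ v, 0 < 1 + γ v := fun v => by have := E.gamma_nonneg v; linarith
  have hlim := ((E.hasSum_apply hf ht).tendsto_sum_nat.sub_const
    (∑ v ∈ Finset.range v₁, designForm ν f (e v) * e v t)).pow 2
  refine le_of_tendsto hlim ?_
  filter_upwards [eventually_ge_atTop v₁] with k hk
  rw [← Finset.sum_Ico_eq_sub _ hk]
  have h1 := Finset.sum_sq_le_sum_mul_sum_of_sq_le_mul (Finset.Ico v₁ k)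
    (r := fun v => designForm ν f (e v) * e v t)
    (f := fun v => 2 * B ^ 2 * (1 / (1 + γ v)))
    (g := fun v => γ v * designForm ν f (e v) ^ 2)
    (fun v _ => by have := hw v; positivity)
    (fun v _ => mul_nonneg (E.gamma_nonneg v) (sq_nonneg _))
    (fun v hv => by
      have h2 := hw v
      have h3 : e v t ^ 2 ≤ B ^ 2 := sq_le_sq.2 ((E.bound v t ht).trans (le_abs_self B))
      have h4 := hv₁ v (Finset.mem_Ico.1 hv).1
      have h5 : 1 ≤ 2 * (1 / (1 + γ v)) * γ v := by
        rw [mul_one_div, div_mul_eq_mul_div, le_div_iff₀ h2]; linarith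
      calc (designForm ν f (e v) * e v t) ^ 2 = designForm ν f (e v) ^ 2 * e v t ^ 2 := by ring
        _ ≤ designForm ν f (e v) ^ 2 * B ^ 2 * 1 := by rw [mul_one]; gcongr
        _ ≤ designForm ν f (e v) ^ 2 * B ^ 2 * (2 * (1 / (1 + γ v)) * γ v) := by gcongr
        _ = 2 * B ^ 2 * (1 / (1 + γ v)) * (γ v * designForm ν f (e v) ^ 2) := by ring)
  refine h1.trans (mul_le_mul ?_ ?_ ?_ ?_)
  · rw [← Finset.mul_sum]
    gcongr
    exact E.summable_inv.sum_le_tsum _ fun v _ => by have := hw v; positivity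
  · exact sum_le_hasSum _ (fun v _ => mul_nonneg (E.gamma_nonneg v) (sq_nonneg _))
      (E.hasSum_roughness hf)
  · exact Finset.sum_nonneg fun v _ => mul_nonneg (E.gamma_nonneg v) (sq_nonneg _)
  · exact mul_nonneg (by positivity) (tsum_nonneg fun v => by have := hw v; positivity)

/-- The vectors `(e_v(t))_{v < d}`, `t ∈ [0,1]`, span `ℝ^d`, since the `e_v` are linearly
independent. -/
lemma span_eval_eq_top (d : ℕ) : Submodule.span ℝ
    ((fun t => (WithLp.toLp 2 fun v : Fin d => e v t : EuclideanSpace ℝ (Fin d))) ''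
      Set.Icc (0 : ℝ) 1) = ⊤ := by
  rw [← Submodule.orthogonal_eq_bot_iff, Submodule.eq_bot_iff]
  intro z hz
  rw [Submodule.mem_orthogonal] at hz
  have h0 : ∀ t ∈ Set.Icc (0 : ℝ) 1, ∑ v : Fin d, z v * e v t = 0 := by
    intro t ht
    have := hz _ (Submodule.subset_span (Set.mem_image_of_mem _ ht))
    simpa [PiLp.inner_apply] using this
  ext u
  let c : ℕ → ℝ := fun v => if hv : v < d then z ⟨v, hv⟩ else 0
  have h1 : ∀ t ∈ Set.Icc (0 : ℝ) 1, ∑ v ∈ Finset.range d, c v * e v t = 0 := by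
    intro t ht
    rw [Finset.sum_range, ← h0 t ht]
    simp [c]
  have h2 := E.design.designForm_sum_left E.continuousOn (E.continuousOn u) c (Finset.range d)
  have h3 : designForm ν (fun t => ∑ v ∈ Finset.range d, c v * e v t) (e u) = 0 := by
    unfold designForm
    refine integral_eq_zero_of_ae ?_
    filter_upwards [E.design.ae_mem] with t ht
    rw [h1 t ht]; simp
  rw [h3] at h2
  simp only [E.designForm_eq, mul_ite, mul_one, mul_zero, Finset.sum_ite_eq', Finset.mem_range,
    u.2, if_true] at h2
  simpa [c] using h2.symm

section SamplePaths

variable {Ω : Type*} [MeasurableSpace Ω] {P : Measure Ω}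
  {X : Ω → ℝ → ℝ} (hmeas : ∀ t ∈ Set.Icc (0 : ℝ) 1, Measurable fun ω => X ω t)
  (hpath : ∀ᵐ ω ∂P, MemSobolev m (X ω))
include hmeas hpath

/-- The coefficients of a random function are random variables. -/
lemma aemeasurable_coeff (v : ℕ) : AEMeasurable (fun ω => designForm ν (X ω) (e v)) P := by
  have := E.design.isProb
  have hX : Measurable fun ω => (Set.Icc (0 : ℝ) 1).domRestrict (X ω) :=
    measurable_pi_lambda _ fun t => hmeas t t.2
  have he := (E.continuousOn v).measurable_indicator_unitInterval
  refine ⟨fun ω => ∫ t, pathEval ((Set.Icc (0 : ℝ) 1).domRestrict (X ω)) t *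
    (Set.Icc (0 : ℝ) 1).indicator (e v) t ∂ν, ?_, ?_⟩
  · refine (StronglyMeasurable.integral_prod_right (f := fun ω t =>
      pathEval ((Set.Icc (0 : ℝ) 1).domRestrict (X ω)) t *
      (Set.Icc (0 : ℝ) 1).indicator (e v) t) ?_).measurable
    refine Measurable.stronglyMeasurable ?_
    exact ((hX.comp measurable_fst).pathEval measurable_snd).mul
      (he.comp measurable_snd)
  · filter_upwards [hpath] with ω hω
    refine integral_congr_ae ?_
    filter_upwards [E.design.ae_mem] with t ht
    rw [pathEval_eq (hω.continuousOn E.one_le) ht, Set.indicator_of_mem ht]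

variable (hL2 : ∀ t ∈ Set.Icc (0 : ℝ) 1, MemLp (fun ω => X ω t) 2 P)
  (hJ : ∫⁻ ω, (∫⁻ t in Set.Icc (0 : ℝ) 1,
      ENNReal.ofReal ((iteratedDerivWithin m (X ω) (Set.Icc 0 1) t) ^ 2)) ∂P < ⊤)
include hJ

lemma tsum_lintegral_coeff_lt_top :
    ∑' v, ∫⁻ ω, ENNReal.ofReal (γ v * designForm ν (X ω) (e v) ^ 2) ∂P < ⊤ := by
  rw [← lintegral_tsum fun v =>
    (((E.aemeasurable_coeff hmeas hpath v).pow_const 2).const_mul _).ennreal_ofReal]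
  refine lt_of_eq_of_lt (lintegral_congr_ae ?_) hJ
  filter_upwards [hpath] with ω hω
  rw [← hω.ofReal_roughness_self, ← (E.hasSum_roughness hω).tsum_eq,
    ENNReal.ofReal_tsum_of_nonneg (fun v => mul_nonneg (E.gamma_nonneg v) (sq_nonneg _))
      (E.hasSum_roughness hω).summable]

lemma summable_integral_coeff_sq :
    Summable fun v => (1 + γ v) * ∫ ω, designForm ν (X ω) (e v) ^ 2 ∂P := by
  obtain ⟨v₁, hv₁⟩ := E.exists_one_le_gamma
  have h1 : Summable fun v => γ v * ∫ ω, designForm ν (X ω) (e v) ^ 2 ∂P := by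
    refine (ENNReal.summable_toReal (E.tsum_lintegral_coeff_lt_top hmeas hpath hJ).ne).congr
      fun v => ?_
    rw [← integral_const_mul, integral_eq_lintegral_of_nonneg_ae
      (ae_of_all _ fun ω => mul_nonneg (E.gamma_nonneg v) (sq_nonneg _))]
    exact (((E.aemeasurable_coeff hmeas hpath v).pow_const 2).const_mul _).aestronglyMeasurable
  have h0 : ∀ v, 0 ≤ ∫ ω, designForm ν (X ω) (e v) ^ 2 ∂P := fun v =>
    integral_nonneg fun ω => sq_nonneg _
  have h2 : Summable fun v => ∫ ω, designForm ν (X ω) (e v) ^ 2 ∂P := by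
    refine Summable.of_norm_bounded_eventually_nat h1 ?_
    filter_upwards [eventually_ge_atTop v₁] with v hv
    rw [Real.norm_of_nonneg (h0 v)]
    exact le_mul_of_one_le_left (h0 v) (hv₁ v hv)
  refine (h2.add h1).congr fun v => ?_
  ring

include hL2

/-- Second moments of the coefficients. For large `v` they are controlled by `E J(X, X)`; the others
are linear combinations of finitely many values `X(t)`, up to terms controlled by
`E J(X, X)`. -/
lemma memLp_coeff (v : ℕ) : MemLp (fun ω => designForm ν (X ω) (e v)) 2 P := by
  obtain ⟨v₁, hv₁⟩ := E.exists_one_le_gamma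
  set c : ℕ → Ω → ℝ := fun v ω => designForm ν (X ω) (e v) with hc
  have hcm : ∀ v, AEMeasurable (c v) P := E.aemeasurable_coeff hmeas hpath
  have hlow : ∀ z : EuclideanSpace ℝ (Fin v₁),
      MemLp (fun ω => ∑ v : Fin v₁, z v * c v ω) 2 P := by
    intro z
    have hz : z ∈ Submodule.span ℝ
      ((fun t => (WithLp.toLp 2 fun v : Fin v₁ => e v t : EuclideanSpace ℝ (Fin v₁))) ''
      Set.Icc (0 : ℝ) 1) := by rw [E.span_eval_eq_top]; trivial
    induction hz using Submodule.span_induction with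
    | mem z hz =>
      obtain ⟨t, ht, rfl⟩ := hz
      have hR : MemLp (fun ω => X ω t - ∑ v ∈ Finset.range v₁, c v ω * e v t) 2 P := by
        have hRm : AEStronglyMeasurable
            (fun ω => X ω t - ∑ v ∈ Finset.range v₁, c v ω * e v t) P :=
          ((hmeas t ht).aemeasurable.sub (Finset.aemeasurable_fun_sum _ fun v _ =>
            (hcm v).mul_const _)).aestronglyMeasurable
        rw [memLp_two_iff_integrable_sq hRm]
        refine ⟨hRm.pow 2, ?_⟩
        rw [hasFiniteIntegral_iff_ofReal (ae_of_all _ fun ω => sq_nonneg _)]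
        set D := 2 * B ^ 2 * (∑' v, 1 / (1 + γ v))
        have hD : 0 ≤ D := mul_nonneg (by positivity) (tsum_nonneg fun v => by
          have := E.gamma_nonneg v; positivity)
        refine lt_of_le_of_lt (b := ENNReal.ofReal D * ∫⁻ ω, (∫⁻ t in Set.Icc (0 : ℝ) 1,
          ENNReal.ofReal ((iteratedDerivWithin m (X ω) (Set.Icc 0 1) t) ^ 2)) ∂P) ?_
          (ENNReal.mul_lt_top ENNReal.ofReal_lt_top hJ)
        rw [← lintegral_const_mul' _ _ ENNReal.ofReal_ne_top]
        refine lintegral_mono_ae ?_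
        filter_upwards [hpath] with ω hω
        rw [← hω.ofReal_roughness_self, ← ENNReal.ofReal_mul hD]
        exact ENNReal.ofReal_le_ofReal (E.sq_sub_sum_le hv₁ hω ht)
      refine ((hL2 t ht).sub hR).ae_eq (ae_of_all _ fun ω => ?_)
      simp only [Pi.sub_apply, sub_sub_cancel]
      rw [Finset.sum_range]
      exact Finset.sum_congr rfl fun v _ => mul_comm _ _
    | zero => simp
    | add x y _ _ hx hy =>
      refine (hx.add hy).ae_eq (ae_of_all _ fun ω => ?_)
      simp [add_mul, Finset.sum_add_distrib]
    | smul r x _ hx =>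
      refine (hx.const_mul r).ae_eq (ae_of_all _ fun ω => ?_)
      simp [Finset.mul_sum, mul_assoc]
  by_cases hv : v < v₁
  · refine (hlow (EuclideanSpace.single ⟨v, hv⟩ 1)).ae_eq (ae_of_all _ fun ω => ?_)
    simp [hc]
  · rw [memLp_two_iff_integrable_sq (hcm v).aestronglyMeasurable]
    refine ⟨(hcm v).aestronglyMeasurable.pow 2, ?_⟩
    rw [hasFiniteIntegral_iff_ofReal (ae_of_all _ fun ω => sq_nonneg _)]
    refine lt_of_le_of_lt (lintegral_mono fun ω => ?_)
      ((ENNReal.le_tsum v).trans_lt (E.tsum_lintegral_coeff_lt_top hmeas hpath hJ))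
    exact ENNReal.ofReal_le_ofReal
      (le_mul_of_one_le_left (sq_nonneg _) (hv₁ v (not_lt.1 hv)))

/-- The second moments `E X(t)²` are bounded uniformly in `t`. -/
lemma exists_lintegral_sq_le : ∃ C : ℝ, ∀ t ∈ Set.Icc (0 : ℝ) 1,
    ∫⁻ ω, ENNReal.ofReal (X ω t ^ 2) ∂P ≤ ENNReal.ofReal C := by
  have hw : ∀ v, 0 < 1 + γ v := fun v => by have := E.gamma_nonneg v; linarith
  have hS := E.summable_integral_coeff_sq hmeas hpath hJ
  set D := B ^ 2 * (∑' v, 1 / (1 + γ v)) with hD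
  have hD0 : 0 ≤ D := mul_nonneg (sq_nonneg _) (tsum_nonneg fun v => by
    have := E.gamma_nonneg v; positivity)
  refine ⟨D * ∑' v, (1 + γ v) * ∫ ω, designForm ν (X ω) (e v) ^ 2 ∂P, fun t ht => ?_⟩
  calc ∫⁻ ω, ENNReal.ofReal (X ω t ^ 2) ∂P
      ≤ ∫⁻ ω, ENNReal.ofReal D *
          ∑' v, ENNReal.ofReal ((1 + γ v) * designForm ν (X ω) (e v) ^ 2) ∂P := by
        refine lintegral_mono_ae ?_
        filter_upwards [hpath] with ω hω
        have hQ := E.hasSum_rkhsInner hω 1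
        simp only [one_mul] at hQ
        rw [← ENNReal.ofReal_tsum_of_nonneg (fun v => mul_nonneg (hw v).le (sq_nonneg _))
          hQ.summable, hQ.tsum_eq, ← ENNReal.ofReal_mul hD0]
        exact ENNReal.ofReal_le_ofReal (E.sq_apply_le hω ht)
    _ = ENNReal.ofReal D *
          ∑' v, ENNReal.ofReal ((1 + γ v) * ∫ ω, designForm ν (X ω) (e v) ^ 2 ∂P) := by
        rw [lintegral_const_mul' _ _ ENNReal.ofReal_ne_top, lintegral_tsum fun v =>
          (((E.aemeasurable_coeff hmeas hpath v).pow_const 2).const_mul _).ennreal_ofReal]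
        congr 1
        refine tsum_congr fun v => ?_
        rw [← integral_const_mul, ofReal_integral_eq_lintegral_ofReal
          ((E.memLp_coeff hmeas hpath hL2 hJ v).integrable_sq.const_mul _)
          (ae_of_all _ fun ω => mul_nonneg (hw v).le (sq_nonneg _))]
    _ = _ := by
        rw [← ENNReal.ofReal_tsum_of_nonneg (fun v => mul_nonneg (hw v).le
          (integral_nonneg fun ω => sq_nonneg _)) hS, ← ENNReal.ofReal_mul hD0]

/-- The mean function lies in the Sobolev space: its coefficients are the means of the coefficients
of the process. -/
lemma memSobolev_mean [IsProbabilityMeasure P] {μ : ℝ → ℝ}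
    (hμ : ∀ t ∈ Set.Icc (0 : ℝ) 1, ∫ ω, X ω t ∂P = μ t) :
    MemSobolev m μ := by
  set c : ℕ → Ω → ℝ := fun v ω => designForm ν (X ω) (e v) with hc
  have hw : ∀ v, 0 < 1 + γ v := fun v => by have := E.gamma_nonneg v; linarith
  have hc2 : ∀ v, MemLp (c v) 2 P := E.memLp_coeff hmeas hpath hL2 hJ
  have hS := E.summable_integral_coeff_sq hmeas hpath hJ
  have hvar : ∀ f : Ω → ℝ, MemLp f 2 P → (∫ ω, f ω ∂P) ^ 2 ≤ ∫ ω, f ω ^ 2 ∂P := fun f hf => by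
    have h1 := variance_eq_sub hf
    have h2 := variance_nonneg f P
    rw [h1] at h2
    simp only [Pi.pow_apply] at h2
    linarith
  have hA : Summable fun v => (1 + γ v) * (∫ ω, c v ω ∂P) ^ 2 :=
    Summable.of_nonneg_of_le (fun v => mul_nonneg (hw v).le (sq_nonneg _))
      (fun v => mul_le_mul_of_nonneg_left (hvar _ (hc2 v)) (hw v).le) hS
  have habs : Summable fun v => ∫ ω, |c v ω| ∂P := by
    have h1 : Summable fun v => (1 + γ v) * (∫ ω, |c v ω| ∂P) ^ 2 := by
      refine Summable.of_nonneg_of_le (fun v => mul_nonneg (hw v).le (sq_nonneg _))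
        (fun v => mul_le_mul_of_nonneg_left ?_ (hw v).le) hS
      exact (hvar _ (hc2 v).abs).trans
        (le_of_eq (integral_congr_ae (ae_of_all _ fun ω => sq_abs (c v ω))))
    refine (E.summable_abs_of_weighted h1).congr fun v => ?_
    exact abs_of_nonneg (integral_nonneg fun ω => abs_nonneg _)
  refine E.memSobolev_of_hasSum (c := fun v => ∫ ω, c v ω ∂P) ?_ fun t ht => ?_
  · refine Summable.of_nonneg_of_le (fun v => mul_nonneg (E.gamma_nonneg v) (sq_nonneg _))
      (fun v => ?_) hA
    gcongr
    linarith
  · have hi : ∀ v, Integrable (fun ω => c v ω * e v t) P := fun v =>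
      ((hc2 v).integrable (by norm_num)).mul_const _
    have h1 := hasSum_integral_of_summable_integral_norm hi ?_
    · have h2 : ∫ ω, ∑' v, c v ω * e v t ∂P = μ t := by
        rw [← hμ t ht]
        refine integral_congr_ae ?_
        filter_upwards [hpath] with ω hω using (E.hasSum_apply hω ht).tsum_eq
      rw [h2] at h1
      simpa [integral_mul_const] using h1
    · refine Summable.of_nonneg_of_le (fun v => integral_nonneg fun ω => norm_nonneg _)
        (fun v => ?_) (habs.mul_left B)
      rw [← integral_const_mul]
      refine integral_mono (hi v).norm
        (((hc2 v).integrable (by norm_num)).abs.const_mul B) fun ω => ?_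
      exact E.abs_mul_le (fun v => c v ω) v ht

end SamplePaths

end IsEigensystem

/-! ### The noise and the empirical Gram matrix -/

lemma DensityAssumption.isUnitDesign {Ω : Type*} [MeasurableSpace Ω] {P : Measure Ω}
    [IsProbabilityMeasure P] {X : ℕ → Ω → ℝ → ℝ} {T ε : ℕ → ℕ → Ω → ℝ}
    (h : DensityAssumption P X T ε) (hT : Measurable (T 0 0)) : IsUnitDesign (P.map (T 0 0)) := by
  obtain ⟨q, b, B, hq, hb, hqb, hlaw⟩ := h.marginal
  refine ⟨Measure.isProbabilityMeasure_map hT.aemeasurable, ?_, ?_⟩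
  · rw [hlaw]; exact withDensity_absolutelyContinuous _ _
  · rw [hlaw]
    refine withDensity_absolutelyContinuous' hq.ennreal_ofReal.aemeasurable ?_
    filter_upwards [ae_restrict_mem measurableSet_Icc] with t ht
    exact (ENNReal.ofReal_pos.2 (hb.trans_le (hqb t ht).1)).ne'

/-- Markov's inequality for a weighted sum of squares with uniformly bounded second moments. -/
lemma measure_lt_tsum_sq_le {Ω ι : Type*} [Countable ι] [MeasurableSpace Ω] {P : Measure Ω}
    {U : ι → Ω → ℝ} (hU : ∀ i, Measurable (U i)) {w : ι → ℝ} (hw : ∀ i, 0 ≤ w i) {A S c : ℝ}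
    (hA : 0 ≤ A) (hc : 0 < c) (h2 : ∀ i, ∫⁻ ω, ENNReal.ofReal (U i ω ^ 2) ∂P ≤ ENNReal.ofReal A)
    (hS : ∑' i, ENNReal.ofReal (w i) ≤ ENNReal.ofReal S) :
    P {ω | ENNReal.ofReal c < ∑' i, ENNReal.ofReal (w i * U i ω ^ 2)} ≤
      ENNReal.ofReal (A * S / c) := by
  have hm : ∀ i, Measurable fun ω => ENNReal.ofReal (w i * U i ω ^ 2) := fun i =>
    (((hU i).pow_const 2).const_mul _).ennreal_ofReal
  have hI : ∫⁻ ω, ∑' i, ENNReal.ofReal (w i * U i ω ^ 2) ∂P ≤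
      ENNReal.ofReal (A * S) := by
    rw [lintegral_tsum fun i => (hm i).aemeasurable]
    calc ∑' i, ∫⁻ ω, ENNReal.ofReal (w i * U i ω ^ 2) ∂P
        ≤ ∑' i, ENNReal.ofReal A * ENNReal.ofReal (w i) := by
          refine ENNReal.tsum_le_tsum fun i => ?_
          simp_rw [ENNReal.ofReal_mul (hw i)]
          rw [lintegral_const_mul' _ _ ENNReal.ofReal_ne_top, mul_comm]
          gcongr
          exact h2 i
      _ ≤ ENNReal.ofReal A * ENNReal.ofReal S := by
          rw [ENNReal.tsum_mul_left]; gcongr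
      _ = ENNReal.ofReal (A * S) := (ENNReal.ofReal_mul hA).symm
  have hc0 : ENNReal.ofReal c ≠ 0 := (ENNReal.ofReal_pos.2 hc).ne'
  calc P {ω | ENNReal.ofReal c < ∑' i, ENNReal.ofReal (w i * U i ω ^ 2)}
      ≤ P {ω | ENNReal.ofReal c ≤ ∑' i, ENNReal.ofReal (w i * U i ω ^ 2)} :=
        measure_mono (Set.ofPred_subset_ofPred.2 fun ω hω => le_of_lt hω)
    _ ≤ (∫⁻ ω, ∑' i, ENNReal.ofReal (w i * U i ω ^ 2) ∂P) / ENNReal.ofReal c :=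
        meas_ge_le_lintegral_div (Measurable.tsum hm).aemeasurable hc0
          ENNReal.ofReal_ne_top
    _ ≤ ENNReal.ofReal (A * S) / ENNReal.ofReal c := by gcongr
    _ = ENNReal.ofReal (A * S / c) := (ENNReal.ofReal_div_of_pos hc).symm

lemma sum_le_of_tsum_ofReal_le {ι : Type*} {x : ι → ℝ} (hx : ∀ i, 0 ≤ x i) {c : ℝ} (hc : 0 ≤ c)
    (h : ∑' i, ENNReal.ofReal (x i) ≤ ENNReal.ofReal c) (s : Finset ι) : ∑ i ∈ s, x i ≤ c := by
  rw [← ENNReal.ofReal_le_ofReal_iff hc, ENNReal.ofReal_sum_of_nonneg fun i _ => hx i]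
  exact (ENNReal.sum_le_tsum s).trans h

lemma measurable_randomSum {Ω : Type*} [MeasurableSpace Ω] {W : ℕ → ℕ → Ω → ℝ} {N : ℕ → Ω → ℕ}
    (hW : ∀ i j, Measurable (W i j)) (hN : ∀ i, Measurable (N i)) (n : ℕ) :
    Measurable fun ω => ∑ i ∈ Finset.range n, ∑ j ∈ Finset.range (N i ω), W i j ω := by
  refine Finset.measurable_fun_sum _ fun i _ => ?_
  have h1 : Measurable fun z : Ω × ℕ => ∑ j ∈ Finset.range z.2, W i j z.1 :=
    measurable_from_prod_countable_left fun k =>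
      Finset.measurable_fun_sum (Finset.range k) fun j _ => hW i j
  exact h1.comp (measurable_id.prodMk (hN i))

/-- The product of the residual `X(t) - μ(t) + s` with `g(t)`, as a measurable function of the
observed triple. -/
def noiseFun (μ g : ℝ → ℝ) (z : ((Set.Icc (0 : ℝ) 1 → ℝ) × ℝ) × ℝ) : ℝ :=
  (pathEval z.1.1 z.1.2 - (Set.Icc (0 : ℝ) 1).indicator μ z.1.2 + z.2) *
    (Set.Icc (0 : ℝ) 1).indicator g z.1.2

/-- The centred product `f(t) g(t) - c`, as a measurable function of the observed triple. -/
def gramFun (f g : ℝ → ℝ) (c : ℝ) (z : ((Set.Icc (0 : ℝ) 1 → ℝ) × ℝ) × ℝ) : ℝ :=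
  (Set.Icc (0 : ℝ) 1).indicator f z.1.2 * (Set.Icc (0 : ℝ) 1).indicator g z.1.2 - c

lemma measurable_noiseFun {μ g : ℝ → ℝ} (hμ : ContinuousOn μ (Set.Icc 0 1))
    (hg : ContinuousOn g (Set.Icc 0 1)) : Measurable (noiseFun μ g) := by
  have h1 := hμ.measurable_indicator_unitInterval
  have h2 := hg.measurable_indicator_unitInterval
  have ht : Measurable fun z : ((Set.Icc (0 : ℝ) 1 → ℝ) × ℝ) × ℝ => z.1.2 :=
    measurable_snd.comp measurable_fst
  exact (((measurable_pathEval.comp measurable_fst).sub (h1.comp ht)).add measurable_snd).mul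
    (h2.comp ht)

lemma measurable_gramFun {f g : ℝ → ℝ} (hf : ContinuousOn f (Set.Icc 0 1))
    (hg : ContinuousOn g (Set.Icc 0 1)) (c : ℝ) : Measurable (gramFun f g c) := by
  have h1 := hf.measurable_indicator_unitInterval
  have h2 := hg.measurable_indicator_unitInterval
  have ht : Measurable fun z : ((Set.Icc (0 : ℝ) 1 → ℝ) × ℝ) × ℝ => z.1.2 :=
    measurable_snd.comp measurable_fst
  exact ((h1.comp ht).mul (h2.comp ht)).sub_const c

namespace SamplingModel

variable {Ω : Type*} [MeasurableSpace Ω] {P : Measure Ω}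
  {X : ℕ → Ω → ℝ → ℝ} {T ε : ℕ → ℕ → Ω → ℝ} {N : ℕ → Ω → ℕ} {μ : ℝ → ℝ}
  (h : SamplingModel P X T ε N μ) (hD : IsUnitDesign (P.map (T 0 0)))
include h hD

lemma ae_T_mem (i j : ℕ) : ∀ᵐ ω ∂P, T i j ω ∈ Set.Icc (0 : ℝ) 1 := by
  have h1 : ∀ᵐ ω ∂P, T 0 0 ω ∈ Set.Icc (0 : ℝ) 1 :=
    (ae_map_iff (h.measurable_T 0 0).aemeasurable measurableSet_Icc).1 hD.ae_mem
  exact (h.ident_T i j).symm.ae_mem_snd measurableSet_Icc h1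

variable [IsProbabilityMeasure P] (hX : ∀ᵐ ω ∂P, ContinuousOn (X 0 ω) (Set.Icc 0 1)) {C : ℝ}
  (hC : ∀ t ∈ Set.Icc (0 : ℝ) 1, ∫⁻ ω, ENNReal.ofReal (X 0 ω t ^ 2) ∂P ≤ ENNReal.ofReal C)
include hX hC

lemma memLp_pathEval :
    MemLp (fun ω => pathEval ((Set.Icc (0 : ℝ) 1).domRestrict (X 0 ω)) (T 0 0 ω)) 2 P := by
  have hm : Measurable fun ω =>
      pathEval ((Set.Icc (0 : ℝ) 1).domRestrict (X 0 ω)) (T 0 0 ω) :=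
    (h.measurable_path 0).pathEval (h.measurable_T 0 0)
  rw [memLp_two_iff_integrable_sq hm.aestronglyMeasurable]
  refine ⟨(hm.pow_const 2).aestronglyMeasurable, ?_⟩
  rw [hasFiniteIntegral_iff_ofReal (ae_of_all _ fun ω => sq_nonneg _)]
  have hF : Measurable fun z : (Set.Icc (0 : ℝ) 1 → ℝ) × ℝ =>
      ENNReal.ofReal (pathEval z.1 z.2 ^ 2) :=
    (measurable_pathEval.pow_const 2).ennreal_ofReal
  have hp := hD.isProb
  have := Measure.isProbabilityMeasure_map (μ := P) (h.measurable_path 0).aemeasurable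
  calc ∫⁻ ω, ENNReal.ofReal
        (pathEval ((Set.Icc (0 : ℝ) 1).domRestrict (X 0 ω)) (T 0 0 ω) ^ 2) ∂P
      = ∫⁻ t, ∫⁻ x, ENNReal.ofReal (pathEval x t ^ 2)
          ∂(P.map fun ω => (Set.Icc (0 : ℝ) 1).domRestrict (X 0 ω)) ∂(P.map (T 0 0)) := by
        rw [← lintegral_prod_symm' _ hF, ← (h.indepFun_path_T 0 0).map_prod_eq_prod_map_map
          (h.measurable_path 0).aemeasurable (h.measurable_T 0 0).aemeasurable,
          lintegral_map hF ((h.measurable_path 0).prodMk (h.measurable_T 0 0))]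
    _ ≤ ∫⁻ t, ENNReal.ofReal C ∂(P.map (T 0 0)) := by
        refine lintegral_mono_ae ?_
        filter_upwards [hD.ae_mem] with t ht
        have hFt : Measurable fun x : Set.Icc (0 : ℝ) 1 → ℝ =>
          ENNReal.ofReal (pathEval x t ^ 2) := hF.comp (measurable_id.prodMk measurable_const)
        rw [lintegral_map hFt (h.measurable_path 0)]
        refine le_trans (le_of_eq (lintegral_congr_ae ?_)) (hC t ht)
        filter_upwards [hX] with ω hω
        rw [pathEval_eq hω ht]
    _ < ⊤ := by simp

lemma integral_pathEval_mul {g : ℝ → ℝ} (hg : ContinuousOn g (Set.Icc 0 1)) :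
    ∫ ω, pathEval ((Set.Icc (0 : ℝ) 1).domRestrict (X 0 ω)) (T 0 0 ω) *
      (Set.Icc (0 : ℝ) 1).indicator g (T 0 0 ω) ∂P = ∫ t, μ t * g t ∂(P.map (T 0 0)) := by
  have hgm := hg.measurable_indicator_unitInterval
  have hF : Measurable fun z : (Set.Icc (0 : ℝ) 1 → ℝ) × ℝ =>
      pathEval z.1 z.2 * (Set.Icc (0 : ℝ) 1).indicator g z.2 :=
    measurable_pathEval.mul (hgm.comp measurable_snd)
  have hpair := (h.measurable_path 0).prodMk (h.measurable_T 0 0)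
  have hlaw := (h.indepFun_path_T 0 0).map_prod_eq_prod_map_map
          (h.measurable_path 0).aemeasurable (h.measurable_T 0 0).aemeasurable
  have hp := hD.isProb
  have := Measure.isProbabilityMeasure_map (μ := P) (h.measurable_path 0).aemeasurable
  obtain ⟨D, hDg⟩ := isCompact_Icc.exists_bound_of_continuousOn hg
  have hint : Integrable (fun z : (Set.Icc (0 : ℝ) 1 → ℝ) × ℝ =>
      pathEval z.1 z.2 * (Set.Icc (0 : ℝ) 1).indicator g z.2)
      ((P.map fun ω => (Set.Icc (0 : ℝ) 1).domRestrict (X 0 ω)).prod (P.map (T 0 0))) := by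
    rw [← hlaw, integrable_map_measure hF.aestronglyMeasurable hpair.aemeasurable]
    refine ((h.memLp_pathEval hD hX hC).integrable (by norm_num)).mul_bdd (c := D)
      (hgm.comp (h.measurable_T 0 0)).aestronglyMeasurable ?_
    filter_upwards [h.ae_T_mem hD 0 0] with ω hω
    rw [Set.indicator_of_mem hω]; exact hDg _ hω
  calc ∫ ω, pathEval ((Set.Icc (0 : ℝ) 1).domRestrict (X 0 ω)) (T 0 0 ω) *
        (Set.Icc (0 : ℝ) 1).indicator g (T 0 0 ω) ∂P
      = ∫ t, ∫ x, pathEval x t * (Set.Icc (0 : ℝ) 1).indicator g t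
          ∂(P.map fun ω => (Set.Icc (0 : ℝ) 1).domRestrict (X 0 ω)) ∂(P.map (T 0 0)) := by
        rw [← integral_prod_symm _ hint, ← hlaw,
          integral_map hpair.aemeasurable hF.aestronglyMeasurable]
    _ = ∫ t, μ t * g t ∂(P.map (T 0 0)) := by
        refine integral_congr_ae ?_
        filter_upwards [hD.ae_mem] with t ht
        have hFt : Measurable fun x : Set.Icc (0 : ℝ) 1 → ℝ => pathEval x t :=
          Measurable.pathEval measurable_id measurable_const
        rw [integral_mul_const, integral_map (h.measurable_path 0).aemeasurable
          hFt.aestronglyMeasurable, Set.indicator_of_mem ht, ← h.mean_X 0 t ht]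
        congr 1
        refine integral_congr_ae ?_
        filter_upwards [hX] with ω hω
        rw [pathEval_eq hω ht]

variable (herr : ErrorAssumption P ε) (hμ : ContinuousOn μ (Set.Icc 0 1))
include herr hμ

/-- The noise is centred and its second moment is bounded in terms of a bound for `g`. -/
lemma noiseFun_moments : ∃ σ : ℝ, 0 ≤ σ ∧ ∀ (g : ℝ → ℝ) (D : ℝ), ContinuousOn g (Set.Icc 0 1) →
    (∀ t ∈ Set.Icc (0 : ℝ) 1, |g t| ≤ D) →
    MemLp (fun ω => noiseFun μ g (triple X T ε 0 0 ω)) 2 P ∧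
    ∫ ω, noiseFun μ g (triple X T ε 0 0 ω) ∂P = 0 ∧
    ∫ ω, noiseFun μ g (triple X T ε 0 0 ω) ^ 2 ∂P ≤ D ^ 2 * σ := by
  set Y : Ω → ℝ := fun ω => pathEval ((Set.Icc (0 : ℝ) 1).domRestrict (X 0 ω)) (T 0 0 ω) with hY
  set μT : Ω → ℝ := fun ω => (Set.Icc (0 : ℝ) 1).indicator μ (T 0 0 ω) with hμT
  have hYL := h.memLp_pathEval hD hX hC
  have hμm := hμ.measurable_indicator_unitInterval
  have hTm := h.measurable_T 0 0
  have hTmem := h.ae_T_mem hD 0 0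
  have hbd : ∀ (g : ℝ → ℝ) (D : ℝ), ContinuousOn g (Set.Icc 0 1) →
      (∀ t ∈ Set.Icc (0 : ℝ) 1, |g t| ≤ D) →
      AEStronglyMeasurable (fun ω => (Set.Icc (0 : ℝ) 1).indicator g (T 0 0 ω)) P ∧
      ∀ᵐ ω ∂P, ‖(Set.Icc (0 : ℝ) 1).indicator g (T 0 0 ω)‖ ≤ D := fun g D hg hgD =>
    ⟨(hg.measurable_indicator_unitInterval.comp hTm).aestronglyMeasurable, by
      filter_upwards [hTmem] with ω hω
      rw [Set.indicator_of_mem hω]; exact hgD _ hω⟩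
  have hμL : MemLp μT 2 P := by
    obtain ⟨D, hDμ⟩ := isCompact_Icc.exists_bound_of_continuousOn hμ
    obtain ⟨h1, h2⟩ := hbd μ D hμ hDμ
    exact MemLp.of_bound h1 D h2
  have hΨ : MemLp (fun ω => Y ω - μT ω + ε 0 0 ω) 2 P := (hYL.sub hμL).add (herr 0 0).1
  refine ⟨∫ ω, (Y ω - μT ω + ε 0 0 ω) ^ 2 ∂P, integral_nonneg fun ω => sq_nonneg _,
    fun g D hg hgD => ?_⟩
  obtain ⟨hg1, hg2⟩ := hbd g D hg hgD
  have hgL : MemLp (fun ω => (Set.Icc (0 : ℝ) 1).indicator g (T 0 0 ω)) ⊤ P :=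
    memLp_top_of_bound hg1 D hg2
  have hprod : MemLp (fun ω => noiseFun μ g (triple X T ε 0 0 ω)) 2 P := hgL.mul' hΨ
  refine ⟨hprod, ?_, ?_⟩
  · have hi1 : Integrable (fun ω => Y ω * (Set.Icc (0 : ℝ) 1).indicator g (T 0 0 ω)) P :=
      (hYL.integrable (by norm_num)).mul_bdd (c := D) hg1 hg2
    have hi2 : Integrable (fun ω => μT ω * (Set.Icc (0 : ℝ) 1).indicator g (T 0 0 ω)) P :=
      (hμL.integrable (by norm_num)).mul_bdd (c := D) hg1 hg2
    have hi3 : Integrable (fun ω => ε 0 0 ω * (Set.Icc (0 : ℝ) 1).indicator g (T 0 0 ω)) P :=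
      ((herr 0 0).1.integrable (by norm_num)).mul_bdd (c := D) hg1 hg2
    have e1 : ∫ ω, noiseFun μ g (triple X T ε 0 0 ω) ∂P =
        ∫ ω, Y ω * (Set.Icc (0 : ℝ) 1).indicator g (T 0 0 ω) ∂P -
        ∫ ω, μT ω * (Set.Icc (0 : ℝ) 1).indicator g (T 0 0 ω) ∂P +
        ∫ ω, ε 0 0 ω * (Set.Icc (0 : ℝ) 1).indicator g (T 0 0 ω) ∂P := by
      have hi12 : Integrable (fun ω => Y ω * (Set.Icc (0 : ℝ) 1).indicator g (T 0 0 ω) -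
        μT ω * (Set.Icc (0 : ℝ) 1).indicator g (T 0 0 ω)) P := hi1.sub hi2
      rw [← integral_sub hi1 hi2, ← integral_add hi12 hi3]
      refine integral_congr_ae (ae_of_all _ fun ω => ?_)
      simp only [noiseFun, triple, hY, hμT]
      ring
    have e2 : ∫ ω, μT ω * (Set.Icc (0 : ℝ) 1).indicator g (T 0 0 ω) ∂P =
        ∫ t, μ t * g t ∂(P.map (T 0 0)) := by
      have := integral_map (μ := P) (φ := T 0 0) hTm.aemeasurable
        (f := fun t => (Set.Icc (0 : ℝ) 1).indicator μ t * (Set.Icc (0 : ℝ) 1).indicator g t)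
        (hμm.mul hg.measurable_indicator_unitInterval).aestronglyMeasurable
      rw [← this]
      refine integral_congr_ae ?_
      filter_upwards [hD.ae_mem] with t ht
      rw [Set.indicator_of_mem ht, Set.indicator_of_mem ht]
    have hεT : IndepFun (ε 0 0) (T 0 0) P :=
      ((h.indepFun_path_T_ε 0 0).comp measurable_snd measurable_id).symm
    have e3 : ∫ ω, ε 0 0 ω * (Set.Icc (0 : ℝ) 1).indicator g (T 0 0 ω) ∂P = 0 := by
      refine ((hεT.comp measurable_id
        hg.measurable_indicator_unitInterval).integral_fun_mul_eq_mul_integral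
        (h.measurable_ε 0 0).aestronglyMeasurable hg1).trans ?_
      simp only [Function.comp_def, id_eq]
      rw [(herr 0 0).2, zero_mul]
    rw [e1, h.integral_pathEval_mul hD hX hC hg, e2, e3]
    ring
  · rw [← integral_const_mul]
    refine integral_mono_ae hprod.integrable_sq (hΨ.integrable_sq.const_mul _) ?_
    filter_upwards [hg2] with ω hω
    have h1 : (Set.Icc (0 : ℝ) 1).indicator g (T 0 0 ω) ^ 2 ≤ D ^ 2 :=
      sq_le_sq.2 (le_trans hω (le_abs_self D))
    simp only [noiseFun, triple, hY, hμT, mul_pow]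
    rw [mul_comm]
    gcongr

end SamplingModel

/-- The Gram terms are centred and bounded. -/
lemma SamplingModel.gramFun_moments {Ω : Type*} [MeasurableSpace Ω] {P : Measure Ω}
    [IsProbabilityMeasure P] {X : ℕ → Ω → ℝ → ℝ} {T ε : ℕ → ℕ → Ω → ℝ} {N : ℕ → Ω → ℕ} {μ : ℝ → ℝ}
    (h : SamplingModel P X T ε N μ) (hD : IsUnitDesign (P.map (T 0 0))) {f g : ℝ → ℝ} {B c : ℝ}
    (hf : ContinuousOn f (Set.Icc 0 1)) (hg : ContinuousOn g (Set.Icc 0 1))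
    (hfB : ∀ t ∈ Set.Icc (0 : ℝ) 1, |f t| ≤ B) (hgB : ∀ t ∈ Set.Icc (0 : ℝ) 1, |g t| ≤ B)
    (hc : |c| ≤ 1) (hfg : designForm (P.map (T 0 0)) f g = c) :
    MemLp (fun ω => gramFun f g c (triple X T ε 0 0 ω)) 2 P ∧
    ∫ ω, gramFun f g c (triple X T ε 0 0 ω) ∂P = 0 ∧
    ∫ ω, gramFun f g c (triple X T ε 0 0 ω) ^ 2 ∂P ≤ (B ^ 2 + 1) ^ 2 := by
  have hm : Measurable fun ω => gramFun f g c (triple X T ε 0 0 ω) :=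
    (measurable_gramFun hf hg c).comp (h.measurable_triple 0 0)
  have hbd : ∀ᵐ ω ∂P, ‖gramFun f g c (triple X T ε 0 0 ω)‖ ≤ B ^ 2 + 1 := by
    filter_upwards [h.ae_T_mem hD 0 0] with ω hω
    simp only [gramFun, triple, Set.indicator_of_mem hω, Real.norm_eq_abs]
    refine (abs_sub _ _).trans (add_le_add ?_ hc)
    rw [abs_mul, sq]
    exact mul_le_mul (hfB _ hω) (hgB _ hω) (abs_nonneg _) ((abs_nonneg _).trans (hfB _ hω))
  have hL : MemLp (fun ω => gramFun f g c (triple X T ε 0 0 ω)) 2 P :=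
    MemLp.of_bound hm.aestronglyMeasurable _ hbd
  refine ⟨hL, ?_, ?_⟩
  · have hF : Measurable fun t =>
        (Set.Icc (0 : ℝ) 1).indicator f t * (Set.Icc (0 : ℝ) 1).indicator g t - c :=
      (hf.measurable_indicator_unitInterval.mul hg.measurable_indicator_unitInterval).sub_const c
    have e1 := integral_map (μ := P) (φ := T 0 0) (h.measurable_T 0 0).aemeasurable
      hF.aestronglyMeasurable
    change ∫ ω, (Set.Icc (0 : ℝ) 1).indicator f (T 0 0 ω) *
      (Set.Icc (0 : ℝ) 1).indicator g (T 0 0 ω) - c ∂P = 0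
    rw [← e1]
    have hp := hD.isProb
    have e2 : ∫ t, (Set.Icc (0 : ℝ) 1).indicator f t * (Set.Icc (0 : ℝ) 1).indicator g t - c
        ∂(P.map (T 0 0)) = ∫ t, f t * g t - c ∂(P.map (T 0 0)) := by
      refine integral_congr_ae ?_
      filter_upwards [hD.ae_mem] with t ht
      rw [Set.indicator_of_mem ht, Set.indicator_of_mem ht]
    rw [e2, integral_sub (hD.integrable_mul hf hg) (integrable_const c)]
    unfold designForm at hfg
    rw [hfg]; simp
  · calc ∫ ω, gramFun f g c (triple X T ε 0 0 ω) ^ 2 ∂P ≤ ∫ _, (B ^ 2 + 1) ^ 2 ∂P := by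
          refine integral_mono_ae hL.integrable_sq (integrable_const _) ?_
          filter_upwards [hbd] with ω hω
          exact sq_le_sq.2 (hω.trans (le_abs_self _))
      _ = (B ^ 2 + 1) ^ 2 := by simp

/-! ### The stochastic error bound -/

lemma IsEigensystem.tsum_ofReal_inv_le {m : ℕ} {ν : Measure ℝ} {e : ℕ → ℝ → ℝ} {γ : ℕ → ℝ}
    {B a : ℝ} {v₀ : ℕ} (E : IsEigensystem m ν e γ B a v₀) {lam S : ℝ} (hlam : 0 ≤ lam)
    (hS : ∀ k, ∑ v ∈ Finset.range k, 1 / (1 + lam * γ v) ≤ S) :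
    ∑' v, ENNReal.ofReal (1 / (1 + lam * γ v)) ≤ ENNReal.ofReal S := by
  refine ENNReal.tsum_le_of_sum_range_le fun k => ?_
  have hw : ∀ v, 0 ≤ 1 / (1 + lam * γ v) := fun v => by
    have := mul_nonneg hlam (E.gamma_nonneg v); positivity
  rw [← ENNReal.ofReal_sum_of_nonneg fun v _ => hw v]
  exact ENNReal.ofReal_le_ofReal (hS k)

/-- The error bound at a fixed sample size: apart from an event of probability
`O(1 / (n h r²)) + O(1 / (n h²))`, the error is at most twice the sum of `r` and the bias. The first
term comes from the noise, the second one from the empirical Gram matrix, whose Hilbert-Schmidt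
distance to the identity is controlled. -/
lemma SamplingModel.exists_measure_lt_le {Ω : Type*} [MeasurableSpace Ω] {P : Measure Ω}
    [IsProbabilityMeasure P] {m : ℕ} {X : ℕ → Ω → ℝ → ℝ} {T ε : ℕ → ℕ → Ω → ℝ} {N : ℕ → Ω → ℕ}
    {μ : ℝ → ℝ} (hmodel : SamplingModel P X T ε N μ) (herr : ErrorAssumption P ε)
    (hcount : CountAssumption P N) (hpath : PathAssumption P m X)
    {e : ℕ → ℝ → ℝ} {γ : ℕ → ℝ} {B a : ℝ} {v₀ : ℕ}
    (E : IsEigensystem m (P.map (T 0 0)) e γ B a v₀) (hμ : MemSobolev m μ) :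
    ∃ K : ℝ, 0 < K ∧ ∀ n : ℕ, 1 ≤ n → ∀ h : ℝ, 0 < h → h ≤ 1 → ∀ r : ℝ, 0 < r →
      ∀ f : Ω → ℝ → ℝ, (∀ᵐ ω ∂P, IsSmoothingSpline m X T ε N (h ^ (2 * m)) n ω (f ω)) →
      P {ω | 2 * (r + Real.sqrt (h ^ (2 * m) * roughness m μ μ)) <
        rkhsNorm m (P.map (T 0 0)) (h ^ (2 * m)) (fun t => f ω t - μ t)} ≤
      ENNReal.ofReal (K / (n * h * r ^ 2)) + ENNReal.ofReal (K / (n * h ^ 2)) := by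
  have hD := E.design
  have hXc : ∀ i, ∀ᵐ ω ∂P, ContinuousOn (X i ω) (Set.Icc 0 1) := fun i =>
    (hpath i).1.mono fun ω hω => hω.continuousOn E.one_le
  have hμc := hμ.continuousOn E.one_le
  obtain ⟨C₂, hC₂⟩ := E.exists_lintegral_sq_le (hmodel.measurable_X 0) (hpath 0).1
    (hmodel.memLp_X 0) (hpath 0).2
  obtain ⟨σ, hσ0, hσ⟩ := hmodel.noiseFun_moments hD (hXc 0) hC₂ herr hμc
  obtain ⟨C, hC0, hC⟩ := E.exists_sum_inv_le
  obtain ⟨κ, hκ0, hκ⟩ : ∃ κ : ℝ, 0 ≤ κ ∧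
      ∫⁻ ω, (N 0 ω : ENNReal) ^ 2 ∂P = ENNReal.ofReal κ := by
    refine ⟨∫ ω, (N 0 ω : ℝ) ^ 2 ∂P, integral_nonneg fun ω => sq_nonneg _, ?_⟩
    rw [ofReal_integral_eq_lintegral_ofReal (hcount 0).2.1.integrable_sq
      (ae_of_all _ fun ω => sq_nonneg _)]
    refine lintegral_congr fun ω => ?_
    rw [ENNReal.ofReal_pow (by positivity), ENNReal.ofReal_natCast]
  refine ⟨κ * (B ^ 2 * σ) * C + 4 * κ * (B ^ 2 + 1) ^ 2 * C ^ 2 + 1, by positivity,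
    fun n hn h hh hh1 r hr f hf => ?_⟩
  have hn0 : (0 : ℝ) < n := by exact_mod_cast hn
  set lam : ℝ := h ^ (2 * m) with hlamdef
  have hlam : 0 ≤ lam := by positivity
  have hw : ∀ v, 0 < 1 + lam * γ v := fun v => by
    have := mul_nonneg hlam (E.gamma_nonneg v); linarith
  have hS := E.tsum_ofReal_inv_le hlam (hC h hh hh1)
  set U : ℕ → Ω → ℝ := fun v ω => ∑ i ∈ Finset.range n, ∑ j ∈ Finset.range (N i ω),
    noiseFun μ (e v) (triple X T ε i j ω) with hU
  set A : ℕ × ℕ → Ω → ℝ := fun q ω => ∑ i ∈ Finset.range n, ∑ j ∈ Finset.range (N i ω),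
    gramFun (e q.1) (e q.2) (if q.1 = q.2 then 1 else 0) (triple X T ε i j ω) with hA
  have hUm : ∀ v, Measurable (U v) := fun v => measurable_randomSum
    (fun i j => (measurable_noiseFun hμc (E.continuousOn v)).comp (hmodel.measurable_triple i j))
    hmodel.measurable_N n
  have hAm : ∀ q, Measurable (A q) := fun q => measurable_randomSum
    (fun i j => (measurable_gramFun (E.continuousOn q.1) (E.continuousOn q.2) _).comp
      (hmodel.measurable_triple i j)) hmodel.measurable_N n
  have hofReal : ∀ s : ℝ, (n : ENNReal) * ENNReal.ofReal κ * ENNReal.ofReal s =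
      ENNReal.ofReal (n * κ * s) := fun s => by
    rw [ENNReal.ofReal_mul (by positivity), ENNReal.ofReal_mul (by positivity),
      ENNReal.ofReal_natCast]
  have hU2 : ∀ v, ∫⁻ ω, ENNReal.ofReal (U v ω ^ 2) ∂P ≤
      ENNReal.ofReal (n * κ * (B ^ 2 * σ)) := fun v => by
    obtain ⟨h1, h2, h3⟩ := hσ (e v) B (E.continuousOn v) (E.bound v)
    rw [← hofReal, ← hκ]
    exact hmodel.lintegral_sq_sum_le (measurable_noiseFun hμc (E.continuousOn v)) h1 h2 h3 n
  have hA2 : ∀ q, ∫⁻ ω, ENNReal.ofReal (A q ω ^ 2) ∂P ≤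
      ENNReal.ofReal (n * κ * (B ^ 2 + 1) ^ 2) := fun q => by
    obtain ⟨h1, h2, h3⟩ := hmodel.gramFun_moments hD (E.continuousOn q.1) (E.continuousOn q.2)
      (E.bound q.1) (E.bound q.2) (c := if q.1 = q.2 then 1 else 0)
      (by split_ifs <;> simp) (E.designForm_eq q.1 q.2)
    rw [← hofReal, ← hκ]
    exact hmodel.lintegral_sq_sum_le
      (measurable_gramFun (E.continuousOn q.1) (E.continuousOn q.2) _) h1 h2 h3 n
  have hSS : ∑' q : ℕ × ℕ, ENNReal.ofReal (1 / ((1 + lam * γ q.1) * (1 + lam * γ q.2))) ≤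
      ENNReal.ofReal ((C / h) ^ 2) := by
    have e1 : ∀ q : ℕ × ℕ, ENNReal.ofReal (1 / ((1 + lam * γ q.1) * (1 + lam * γ q.2))) =
        ENNReal.ofReal (1 / (1 + lam * γ q.1)) * ENNReal.ofReal (1 / (1 + lam * γ q.2)) :=
      fun q => by
        rw [← ENNReal.ofReal_mul (one_div_pos.2 (hw _)).le, one_div_mul_one_div]
    simp_rw [e1]
    rw [ENNReal.tsum_prod (f := fun u v => ENNReal.ofReal (1 / (1 + lam * γ u)) *
      ENNReal.ofReal (1 / (1 + lam * γ v)))]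
    simp_rw [ENNReal.tsum_mul_left, ENNReal.tsum_mul_right]
    rw [ENNReal.ofReal_pow (by positivity), sq]
    gcongr
  -- the exceptional events
  set E₁ : Set Ω := {ω | ENNReal.ofReal ((n * r) ^ 2) <
    ∑' v, ENNReal.ofReal (1 / (1 + lam * γ v) * U v ω ^ 2)} with hE₁
  set E₂ : Set Ω := {ω | ENNReal.ofReal ((n : ℝ) ^ 2 / 4) <
    ∑' q : ℕ × ℕ, ENNReal.ofReal (1 / ((1 + lam * γ q.1) * (1 + lam * γ q.2)) * A q ω ^ 2)}
    with hE₂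
  have hP₁ : P E₁ ≤ ENNReal.ofReal (n * κ * (B ^ 2 * σ) * (C / h) / (n * r) ^ 2) :=
    measure_lt_tsum_sq_le hUm (fun v => (one_div_pos.2 (hw v)).le) (by positivity)
      (by positivity) hU2 hS
  have hP₂ : P E₂ ≤
      ENNReal.ofReal (n * κ * (B ^ 2 + 1) ^ 2 * (C / h) ^ 2 / ((n : ℝ) ^ 2 / 4)) :=
    measure_lt_tsum_sq_le hAm (fun q => (one_div_pos.2 (mul_pos (hw _) (hw _))).le)
      (by positivity) (by positivity) hA2 hSS
  have hN : ∀ᵐ ω ∂P, ∀ i, 0 < N i ω := ae_all_iff.2 fun i => (hcount i).1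
  have hTmem : ∀ᵐ ω ∂P, ∀ i j, T i j ω ∈ Set.Icc (0 : ℝ) 1 :=
    ae_all_iff.2 fun i => ae_all_iff.2 fun j => hmodel.ae_T_mem hD i j
  have hXall : ∀ᵐ ω ∂P, ∀ i, ContinuousOn (X i ω) (Set.Icc 0 1) := ae_all_iff.2 hXc
  have hsub : ∀ᵐ ω ∂P, 2 * (r + Real.sqrt (lam * roughness m μ μ)) <
      rkhsNorm m (P.map (T 0 0)) lam (fun t => f ω t - μ t) → ω ∈ E₁ ∪ E₂ := by
    filter_upwards [hf, hN, hTmem, hXall] with ω hfω hNω hTω hXω hlt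
    by_contra hcon
    rw [Set.mem_union, not_or] at hcon
    have h1 : ∑' v, ENNReal.ofReal (1 / (1 + lam * γ v) * U v ω ^ 2) ≤
        ENNReal.ofReal ((n * r) ^ 2) := le_of_not_gt fun hlt => hcon.1 hlt
    have h2 : ∑' q : ℕ × ℕ, ENNReal.ofReal
        (1 / ((1 + lam * γ q.1) * (1 + lam * γ q.2)) * A q ω ^ 2) ≤
        ENNReal.ofReal ((n : ℝ) ^ 2 / 4) := le_of_not_gt fun hlt => hcon.2 hlt
    set s : Finset (Σ _ : ℕ, ℕ) := (Finset.range n).sigma fun i => Finset.range (N i ω) with hs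
    set M : ℝ := (totalObs N n ω : ℝ) with hM
    have hnM : (n : ℝ) ≤ M := by
      have h3 : n ≤ totalObs N n ω := by
        calc n = ∑ i ∈ Finset.range n, 1 := by simp
          _ ≤ totalObs N n ω := Finset.sum_le_sum fun i _ => hNω i
      exact Nat.cast_le.2 h3
    have hM0 : 0 < M := hn0.trans_le hnM
    have hsum : ∀ F : ℕ → ℕ → ℝ, ∑ p ∈ s, F p.1 p.2 =
        ∑ i ∈ Finset.range n, ∑ j ∈ Finset.range (N i ω), F i j := fun F => by
      rw [hs, Finset.sum_sigma]
    have hbound := E.rkhsNorm_sub_le (s := s) (t := fun p => T p.1 p.2 ω)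
      (y := fun p => obsY X T ε p.1 p.2 ω) (fun p _ => hTω p.1 p.2) hM0 hr.le hlam hfω.1 hμ
      (fun k hk => by
        have h3 := hfω.2 k hk
        unfold penalizedLoss at h3
        rw [← hsum fun i j => (obsY X T ε i j ω - f ω (T i j ω)) ^ 2,
          ← hsum fun i j => (obsY X T ε i j ω - k (T i j ω)) ^ 2] at h3
        exact h3)
      (fun k => by
        have h3 := sum_le_of_tsum_ofReal_le (fun q => mul_nonneg
          (one_div_pos.2 (mul_pos (hw _) (hw _))).le (sq_nonneg _)) (by positivity) h2
          (Finset.range k ×ˢ Finset.range k)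
        refine le_trans (le_of_eq (Finset.sum_congr rfl fun q _ => ?_)) (h3.trans ?_)
        · have h4 : ∑ p ∈ s, e q.1 (T p.1 p.2 ω) * e q.2 (T p.1 p.2 ω) -
              M * (if q.1 = q.2 then 1 else 0) = A q ω := by
            have h5 : M * (if q.1 = q.2 then (1 : ℝ) else 0) =
                ∑ i ∈ Finset.range n, ∑ j ∈ Finset.range (N i ω),
                  if q.1 = q.2 then (1 : ℝ) else 0 := by
              simp [hM, totalObs]
            rw [hsum fun i j => e q.1 (T i j ω) * e q.2 (T i j ω), h5,
              ← Finset.sum_sub_distrib]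
            refine Finset.sum_congr rfl fun i _ => ?_
            rw [← Finset.sum_sub_distrib]
            refine Finset.sum_congr rfl fun j _ => ?_
            simp only [gramFun, triple, Set.indicator_of_mem (hTω i j)]
          rw [h4, one_div_mul_eq_div]
        · gcongr)
      (fun k => by
        have h3 := sum_le_of_tsum_ofReal_le (fun v => mul_nonneg
          (one_div_pos.2 (hw v)).le (sq_nonneg _)) (by positivity) h1 (Finset.range k)
        refine le_trans (le_of_eq (Finset.sum_congr rfl fun v _ => ?_)) (h3.trans ?_)
        · have h4 : ∑ p ∈ s, (obsY X T ε p.1 p.2 ω - μ (T p.1 p.2 ω)) * e v (T p.1 p.2 ω) =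
              U v ω := by
            rw [hsum fun i j => (obsY X T ε i j ω - μ (T i j ω)) * e v (T i j ω)]
            refine Finset.sum_congr rfl fun i _ => Finset.sum_congr rfl fun j _ => ?_
            simp only [noiseFun, triple, Set.indicator_of_mem (hTω i j),
              pathEval_eq (hXω i) (hTω i j), obsY]
            ring
          rw [h4, one_div_mul_eq_div]
        · gcongr)
    exact absurd hbound (not_le.2 hlt)
  calc P {ω | 2 * (r + Real.sqrt (lam * roughness m μ μ)) <
        rkhsNorm m (P.map (T 0 0)) lam (fun t => f ω t - μ t)}
      ≤ P (E₁ ∪ E₂) := measure_mono_ae hsub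
    _ ≤ P E₁ + P E₂ := measure_union_le _ _
    _ ≤ _ := by
      have hK1 : 0 ≤ κ * (B ^ 2 * σ) * C := by positivity
      have hK2 : 0 ≤ 4 * κ * (B ^ 2 + 1) ^ 2 * C ^ 2 := by positivity
      refine add_le_add (hP₁.trans (ENNReal.ofReal_le_ofReal ?_))
        (hP₂.trans (ENNReal.ofReal_le_ofReal ?_))
      · calc n * κ * (B ^ 2 * σ) * (C / h) / (n * r) ^ 2
            = κ * (B ^ 2 * σ) * C / (n * h * r ^ 2) := by field_simp
          _ ≤ _ := by gcongr; linarith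
      · calc n * κ * (B ^ 2 + 1) ^ 2 * (C / h) ^ 2 / ((n : ℝ) ^ 2 / 4)
            = 4 * κ * (B ^ 2 + 1) ^ 2 * C ^ 2 / (n * h ^ 2) := by field_simp
          _ ≤ _ := by gcongr; linarith

/-! ### Rates -/

/-- The condition on the bandwidth entails `n h² → ∞`. -/
lemma tendsto_one_div_mul_sq {m : ℕ} (hm : 1 ≤ m) {h : ℕ → ℝ} (hpos : ∀ n, 0 < h n)
    (hzero : Tendsto h atTop (𝓝 0))
    (hrate : Tendsto (fun n : ℕ =>
        ((n : ℝ) * h n ^ (3 - 1 / (2 * (m : ℝ)))) ^ (-(1 / 2) : ℝ) *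
          (Real.log (Real.log n)) ^ (1 / 2 : ℝ)) atTop (𝓝 0)) :
    Tendsto (fun n : ℕ => 1 / ((n : ℝ) * h n ^ 2)) atTop (𝓝 0) := by
  have hLL : Tendsto (fun n : ℕ => Real.log (Real.log n)) atTop atTop :=
    Real.tendsto_log_atTop.comp (Real.tendsto_log_atTop.comp tendsto_natCast_atTop_atTop)
  have hsq := hrate.pow 2
  rw [zero_pow two_ne_zero] at hsq
  have hm' : (1 : ℝ) ≤ m := by exact_mod_cast hm
  refine squeeze_zero' (Eventually.of_forall fun n => by have := hpos n; positivity) ?_ hsq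
  filter_upwards [hLL.eventually_ge_atTop 1, eventually_ge_atTop 1,
    hzero.eventually (ge_mem_nhds (zero_lt_one))] with n hL hn hh
  have hn0 : (0 : ℝ) < n := by exact_mod_cast hn
  have hhn := hpos n
  have hp : 0 < h n ^ (3 - 1 / (2 * (m : ℝ))) := Real.rpow_pos_of_pos hhn _
  have hexp : h n ^ (3 - 1 / (2 * (m : ℝ))) ≤ h n ^ 2 := by
    rw [← Real.rpow_natCast]
    refine Real.rpow_le_rpow_of_exponent_ge hhn hh ?_
    have : 1 / (2 * (m : ℝ)) ≤ 1 := by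
      rw [div_le_one (by positivity)]; linarith
    push_cast; linarith
  have e1 : (((n : ℝ) * h n ^ (3 - 1 / (2 * (m : ℝ)))) ^ (-(1 / 2) : ℝ)) ^ 2 =
      1 / ((n : ℝ) * h n ^ (3 - 1 / (2 * (m : ℝ)))) := by
    rw [← Real.rpow_natCast, ← Real.rpow_mul (by positivity)]
    norm_num [Real.rpow_neg_one]
  have e2 : ((Real.log (Real.log n)) ^ (1 / 2 : ℝ)) ^ 2 = Real.log (Real.log n) := by
    rw [← Real.rpow_natCast, ← Real.rpow_mul (by linarith)]
    norm_num
  rw [mul_pow, e1, e2]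
  calc 1 / ((n : ℝ) * h n ^ 2) ≤ 1 / ((n : ℝ) * h n ^ (3 - 1 / (2 * (m : ℝ)))) := by gcongr
    _ ≤ _ := le_mul_of_one_le_right (by positivity) hL

lemma IsBigOInProb.mono {Ω : Type*} [MeasurableSpace Ω] {P : Measure Ω} {Z : ℕ → Ω → ℝ}
    {a b : ℕ → ℝ} (h : IsBigOInProb P Z a) (ha : ∀ n, 0 ≤ a n) {D : ℝ}
    (hab : ∀ᶠ n in atTop, a n ≤ D * b n) : IsBigOInProb P Z b := by
  intro δ hδ
  obtain ⟨C, hC⟩ := h δ hδ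
  refine ⟨|C| * D, ?_⟩
  filter_upwards [hC, hab] with n h1 h2
  refine (measure_mono (Set.ofPred_subset_ofPred.2 fun ω hω => ?_)).trans h1
  refine lt_of_le_of_lt ?_ hω
  calc C * a n ≤ |C| * a n := mul_le_mul_of_nonneg_right (le_abs_self C) (ha n)
    _ ≤ |C| * (D * b n) := by gcongr
    _ = |C| * D * b n := by ring

/-- The two terms of the rate balance at `x = n^(-1/(2m+1))`. -/
lemma rpow_le_pow_add_rpow (m n : ℕ) (hn : 1 ≤ n) {x : ℝ} (hx : 0 < x) :
    (n : ℝ) ^ (-((m : ℝ) / (2 * (m : ℝ) + 1))) ≤ x ^ m + ((n : ℝ) * x) ^ (-(1 / 2) : ℝ) := by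
  have hn0 : (0 : ℝ) < n := by exact_mod_cast hn
  have hm0 : (0 : ℝ) < 2 * (m : ℝ) + 1 := by positivity
  rcases le_total ((n : ℝ) ^ (-(1 / (2 * (m : ℝ) + 1)))) x with h | h
  · have h1 : ((n : ℝ) ^ (-(1 / (2 * (m : ℝ) + 1)))) ^ m ≤ x ^ m := by gcongr
    rw [← Real.rpow_natCast, ← Real.rpow_mul hn0.le] at h1
    have h2 : -(1 / (2 * (m : ℝ) + 1)) * (m : ℝ) = -((m : ℝ) / (2 * (m : ℝ) + 1)) := by ring
    rw [h2] at h1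
    have : 0 ≤ ((n : ℝ) * x) ^ (-(1 / 2) : ℝ) := by positivity
    linarith
  · have h1 : (n : ℝ) * x ≤ (n : ℝ) ^ (2 * (m : ℝ) / (2 * (m : ℝ) + 1)) := by
      calc (n : ℝ) * x ≤ (n : ℝ) * (n : ℝ) ^ (-(1 / (2 * (m : ℝ) + 1))) := by gcongr
        _ = (n : ℝ) ^ (1 + -(1 / (2 * (m : ℝ) + 1))) := by
          rw [Real.rpow_add hn0, Real.rpow_one]
        _ = _ := by congr 1; field_simp; ring
    have h2 := Real.rpow_le_rpow_of_nonpos (by positivity) h1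
      (by norm_num : (-(1 / 2) : ℝ) ≤ 0)
    rw [← Real.rpow_mul hn0.le] at h2
    have h3 : 2 * (m : ℝ) / (2 * (m : ℝ) + 1) * (-(1 / 2)) =
        -((m : ℝ) / (2 * (m : ℝ) + 1)) := by ring
    rw [h3] at h2
    have : 0 ≤ x ^ m := by positivity
    linarith

/-- Upper bound for the rate at bandwidths of the order `n^(-1/(2m+1))`. -/
lemma exists_rate_le {m : ℕ} {h : ℕ → ℝ} (hpos : ∀ n, 0 < h n)
    (hΘ : h =Θ[atTop] fun n : ℕ => (n : ℝ) ^ (-(1 / (2 * (m : ℝ) + 1)))) :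
    ∃ D : ℝ, ∀ᶠ n : ℕ in atTop, h n ^ m + ((n : ℝ) * h n) ^ (-(1 / 2) : ℝ) ≤
      D * (n : ℝ) ^ (-((m : ℝ) / (2 * (m : ℝ) + 1))) := by
  obtain ⟨c, hc, h1⟩ := hΘ.1.exists_pos
  obtain ⟨c', hc', h2⟩ := hΘ.2.exists_pos
  refine ⟨c ^ m + c' ^ (1 / 2 : ℝ), ?_⟩
  filter_upwards [h1.bound, h2.bound, eventually_ge_atTop 1] with n ha hb hn
  have hn0 : (0 : ℝ) < n := by exact_mod_cast hn
  have hm0 : (0 : ℝ) < 2 * (m : ℝ) + 1 := by positivity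
  have hhn := hpos n
  set b := (n : ℝ) ^ (-(1 / (2 * (m : ℝ) + 1))) with hbdef
  have hb0 : 0 < b := Real.rpow_pos_of_pos hn0 _
  rw [Real.norm_of_nonneg hhn.le, Real.norm_of_nonneg hb0.le] at ha hb
  have e1 : b ^ m = (n : ℝ) ^ (-((m : ℝ) / (2 * (m : ℝ) + 1))) := by
    rw [hbdef, ← Real.rpow_natCast, ← Real.rpow_mul hn0.le]
    congr 1; ring
  have e2 : ((n : ℝ) * b) ^ (-(1 / 2) : ℝ) = (n : ℝ) ^ (-((m : ℝ) / (2 * (m : ℝ) + 1))) := by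
    have : (n : ℝ) * b = (n : ℝ) ^ (2 * (m : ℝ) / (2 * (m : ℝ) + 1)) := by
      rw [hbdef]
      nth_rewrite 1 [← Real.rpow_one (n : ℝ)]
      rw [← Real.rpow_add hn0]
      congr 1; field_simp; ring
    rw [this, ← Real.rpow_mul hn0.le]
    congr 1; ring
  rw [add_mul]
  refine add_le_add ?_ ?_
  · calc h n ^ m ≤ (c * b) ^ m := by gcongr
      _ = c ^ m * (n : ℝ) ^ (-((m : ℝ) / (2 * (m : ℝ) + 1))) := by rw [mul_pow, e1]
  · have h3 : (n : ℝ) * b / c' ≤ n * h n := by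
      rw [div_le_iff₀ hc']; nlinarith
    calc ((n : ℝ) * h n) ^ (-(1 / 2) : ℝ) ≤ ((n : ℝ) * b / c') ^ (-(1 / 2) : ℝ) :=
          Real.rpow_le_rpow_of_nonpos (by positivity) h3 (by norm_num)
      _ = c' ^ (1 / 2 : ℝ) * (n : ℝ) ^ (-((m : ℝ) / (2 * (m : ℝ) + 1))) := by
          rw [Real.div_rpow (by positivity) hc'.le, e2, Real.rpow_neg hc'.le]
          field_simp

theorem lemma3p5 {Ω : Type*} [MeasurableSpace Ω] (P : Measure Ω) [IsProbabilityMeasure P]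
    (m : ℕ) (hm : 1 ≤ m)
    (X : ℕ → Ω → ℝ → ℝ) (T ε : ℕ → ℕ → Ω → ℝ) (N : ℕ → Ω → ℕ) (μ : ℝ → ℝ)
    (hmodel : SamplingModel P X T ε N μ)
    (hdens : DensityAssumption P X T ε)
    (herr : ErrorAssumption P ε)
    (hcount : CountAssumption P N)
    (hpath : PathAssumption P m X)
    (heig : EigenAssumption m (P.map (T 0 0)))
    (h : ℕ → ℝ) (hpos : ∀ n, 0 < h n)
    (hzero : Tendsto h atTop (𝓝 0))
    (hrate : Tendsto (fun n : ℕ =>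
        ((n : ℝ) * h n ^ (3 - 1 / (2 * (m : ℝ)))) ^ (-(1 / 2) : ℝ) *
          (Real.log (Real.log n)) ^ (1 / 2 : ℝ)) atTop (𝓝 0))
    (μhat : ℕ → Ω → ℝ → ℝ)
    (hμhat : ∀ n, ∀ᵐ ω ∂P, IsSmoothingSpline m X T ε N (h n ^ (2 * m)) n ω (μhat n ω)) :
    MemSobolev m μ ∧
    IsBigOInProb P
      (fun n ω => rkhsNorm m (P.map (T 0 0)) (h n ^ (2 * m)) (fun t => μhat n ω t - μ t))
      (fun n => h n ^ m + ((n : ℝ) * h n) ^ (-(1 / 2) : ℝ)) ∧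
    ((h =Θ[atTop] fun n : ℕ => (n : ℝ) ^ (-(1 / (2 * (m : ℝ) + 1)))) →
      IsBigOInProb P
        (fun n ω => rkhsNorm m (P.map (T 0 0)) (h n ^ (2 * m)) (fun t => μhat n ω t - μ t))
        (fun n => (n : ℝ) ^ (-((m : ℝ) / (2 * (m : ℝ) + 1))))) ∧
    (∀ n : ℕ, 1 ≤ n → ∀ x : ℝ, 0 < x →
      (n : ℝ) ^ (-((m : ℝ) / (2 * (m : ℝ) + 1))) ≤
        x ^ m + ((n : ℝ) * x) ^ (-(1 / 2) : ℝ)) := by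
  have hD := hdens.isUnitDesign (hmodel.measurable_T 0 0)
  obtain ⟨e, γ, B, a, v₀, E⟩ := heig.exists_isEigensystem hm hD
  have hμ : MemSobolev m μ := E.memSobolev_mean (hmodel.measurable_X 0) (hpath 0).1
    (hmodel.memLp_X 0) (hpath 0).2 (hmodel.mean_X 0)
  have main : IsBigOInProb P
      (fun n ω => rkhsNorm m (P.map (T 0 0)) (h n ^ (2 * m)) (fun t => μhat n ω t - μ t))
      (fun n => h n ^ m + ((n : ℝ) * h n) ^ (-(1 / 2) : ℝ)) := by
    obtain ⟨K, hK, hbound⟩ := hmodel.exists_measure_lt_le herr hcount hpath E hμ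
    intro δ hδ
    have hgram := (tendsto_one_div_mul_sq hm hpos hzero hrate).const_mul K
    rw [mul_zero] at hgram
    have hJ := roughness_self_nonneg m μ
    set ρ := Real.sqrt (2 * K / δ) with hρ
    have hρ0 : 0 < ρ := Real.sqrt_pos.2 (by positivity)
    refine ⟨2 * (ρ + Real.sqrt (roughness m μ μ)), ?_⟩
    filter_upwards [eventually_ge_atTop 1, hzero.eventually (ge_mem_nhds zero_lt_one),
      hgram.eventually (ge_mem_nhds (half_pos hδ))] with n hn hh1 hg
    have hn0 : (0 : ℝ) < n := by exact_mod_cast hn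
    have hhn := hpos n
    have hq : 0 < ((n : ℝ) * h n) ^ (-(1 / 2) : ℝ) := Real.rpow_pos_of_pos (by positivity) _
    have hqsq : (((n : ℝ) * h n) ^ (-(1 / 2) : ℝ)) ^ 2 = 1 / ((n : ℝ) * h n) := by
      rw [← Real.rpow_natCast, ← Real.rpow_mul (by positivity)]
      norm_num [Real.rpow_neg_one]
    -- with this noise level `r`, the noise event has probability at most `δ / 2`
    set r := ρ * ((n : ℝ) * h n) ^ (-(1 / 2) : ℝ) with hr
    have hr0 : 0 < r := mul_pos hρ0 hq
    have hsqrt : Real.sqrt (h n ^ (2 * m) * roughness m μ μ) =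
        h n ^ m * Real.sqrt (roughness m μ μ) := by
      rw [Real.sqrt_mul (by positivity), mul_comm 2 m, pow_mul, Real.sqrt_sq (by positivity)]
    have hP := hbound n hn (h n) hhn hh1 r hr0 (μhat n) (hμhat n)
    have hsub : 2 * (r + Real.sqrt (h n ^ (2 * m) * roughness m μ μ)) ≤
        2 * (ρ + Real.sqrt (roughness m μ μ)) *
          (h n ^ m + ((n : ℝ) * h n) ^ (-(1 / 2) : ℝ)) := by
      rw [hsqrt, hr]
      have h1 : 0 ≤ ρ * h n ^ m := by positivity
      have h2 : 0 ≤ Real.sqrt (roughness m μ μ) * ((n : ℝ) * h n) ^ (-(1 / 2) : ℝ) := by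
        positivity
      linarith
    refine (measure_mono (Set.ofPred_subset_ofPred.2 fun ω hω => ?_)).trans (hP.trans ?_)
    · have h0 : 0 ≤ rkhsNorm m (P.map (T 0 0)) (h n ^ (2 * m)) (fun t => μhat n ω t - μ t) :=
        Real.sqrt_nonneg _
      rw [abs_of_nonneg h0] at hω
      exact hsub.trans_lt hω
    · rw [← ENNReal.ofReal_add (by positivity) (by positivity)]
      refine ENNReal.ofReal_le_ofReal ?_
      have h1 : K / (n * h n * r ^ 2) = δ / 2 := by
        rw [hr, mul_pow, hqsq, hρ, Real.sq_sqrt (by positivity)]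
        field_simp
      have h2 : K / (n * h n ^ 2) = K * (1 / ((n : ℝ) * h n ^ 2)) := by ring
      rw [h1, h2]
      linarith
  refine ⟨hμ, main, fun hΘ => ?_, fun n hn x hx => rpow_le_pow_add_rpow m n hn hx⟩
  obtain ⟨D, hDle⟩ := exists_rate_le hpos hΘ
  exact main.mono (fun n => by have := hpos n; positivity) hDle

end
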